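/- **Setting.** Fix an odd prime $\ell$ and an integer $n\ge 1$. For a finite abelian $\ell$-group $G$ put $G^\vee=\mathrm{Hom}(G,\mathbb Q/\mathbb Z)$; let $\wedge^2G\subseteq G\otimes G$ be the subgroup spanned by the elements $x\otimes y-y\otimes x$, and $\mathrm{Sym}^2G=(G\otimes G)/\wedge^2G$. For $\omega\in\wedge^2G$ and $\alpha,\beta\in G^\vee[\ell^m]=\mathrm{Hom}(G,\mathbb Z/\ell^m)$ let $\omega_m(\alpha,\beta)\in\mathbb Z/\ell^m\cong\frac1{\ell^m}\mathbb Z/\mathbb Z$ be the value at $\omega$ of $x\otimes y\mapsto\alpha(x)\beta(y)$. An $\ell^n$-*BEG* is a triple $(G,\omega_G,\psi_G)$ of a finite abelian $\ell$-group $G$, an element $\omega_G\in(\wedge^2G)[\ell^n]$ and a homomorphism $\psi_G:G^\vee[\ell^n]\to G[\ell^n]$ such that for all $r\ge0$ and $\alpha,\beta\in G^\vee[\ell^{n+r}]$ $$\beta(\psi_G(\ell^r\alpha))=\alpha(\psi_G(\ell^r\beta))+2\,\omega_{n+r}(\alpha,\beta).$$ A morphism $(G,\omega_G,\psi_G)\to(H,\omega_H,\psi_H)$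 is a homomorphism $f:G\to H$ with $f_*\omega_G=\omega_H$ and $f\circ\psi_G\circ f^\vee=\psi_H$ on $H^\vee[\ell^n]$; $\mathrm{Surj}$ denotes the set of surjective morphisms and $\mathrm{Aut}$ the automorphism group. A quotient of $G$ by a subgroup carries the pushed-forward $\omega$ and $\psi$. Let $\mathcal C_{\ell,n}$ be the discrete set of isomorphism classes of $\ell^n$-BEGs. *The measure $\mu$.* Let $\langle\cdot,\cdot\rangle$ be the standard symplectic form on $\mathbb Z_\ell^{2g}$ with basis $e_i,f_i$ and $\langle e_i,f_i\rangle=1$. For a skew-symplectic matrix $M$ over $\mathbb Z_\ell$ (that is, $\langle Mv,w\rangle=-\langle v,Mw\rangle$) with $\det(M+\ell^n)\ne0$ let $G_M=\mathrm{coker}(M+\ell^n)$, let $\omega_M$ be the image of $\sum_i(e_i\otimes f_i-f_i\otimes e_i)$, and for $\gamma\in G_M^\vee[\ell^n]$, written as $\gamma=\langle\cdot,v\rangle \bmod \mathbb Z_\ell$ with $v\in\mathbb Q_\ell^{2g}$, let $\psi_M(\gamma)$ be the class of $(M+\ell^n)v$. Let $\mu_g$ be the pushforward to $\mathcal C_{\ell,n}$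 of the Haar probability measure on skew-symplectic matrices under $M\mapsto(G_M,\omega_M,\psi_M)$. Let $\mu$ be the probability measure on $\mathcal C_{\ell,n}$ to which $\mu_g$ weak-* converges (that is, $\mu_g(\{X\})\to\mu(\{X\})$ for every $X\in\mathcal C_{\ell,n}$) as $g\to\infty$. *The operation $Q$.* For a measure $\nu$ on $\mathcal C_{\ell,n}$ let $$Q\nu(G,\omega_G,\psi_G)=\int_{\mathcal C_{\ell,n}}\frac{\#\{f:\mathbb Z_\ell\to H\mid (H,\omega_H,\psi_H)/\mathrm{Im}f\cong(G,\omega_G,\psi_G)\}}{|H|}\,d\nu(H,\omega_H,\psi_H),$$ and let $Q^t$ be its $t$-fold iterate. Write $(x)_j=\prod_{i=1}^j(1-x^i)$. **Theorem.** The measure $\mu$ exists and is unique. Let $t\ge0$, let $(G,\omega_G,\psi_G)$ be an $\ell^n$-BEG, and let $s$ be the codimension of $\psi_G(G^\vee[\ell])$ in the $\mathbb F_\ell$-vector space $G[\ell]$. 1. If $s\le t$, then $$Q^t\mu(G,\omega_G,\psi_G)=\frac{1}{|\mathrm{Aut}(G,\omega_G,\psi_G)|\cdot|(\mathrm{Sym}^2G)[\ell^n]|\cdot|G|^t}\cdot\frac{(\ell^{-1})_t}{(\ell^{-1})_{t-s}}\prod_{i=t+1}^\infty(1+\ell^{-i})^{-1}.$$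 2. If $s>t$, then $Q^t\mu(G,\omega_G,\psi_G)=0$. 3. $\displaystyle\int\#\mathrm{Surj}(*,(G,\omega_G,\psi_G))\,dQ^t\mu=|G|^{-t}\int\#\mathrm{Surj}(*,(G,\omega_G,\psi_G))\,d\mu.$ -/

import Mathlib

open scoped TensorProduct ENNReal Topology
open MeasureTheory Filter

noncomputable section

/-! ### Duals, torsion, `∧²`, `Sym²` -/

/-- The dual group `G^∨ = Hom(G, ℚ/ℤ)`. -/
abbrev DualGroup (G : Type) [AddCommGroup G] : Type := G →+ AddCircle (1 : ℚ)

/-- The torsion subgroup `G[m]`. -/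
abbrev Tors (G : Type) [AddCommGroup G] (m : ℕ) : AddSubgroup G := AddSubgroup.torsionBy G (m : ℤ)

theorem mem_Tors {G : Type} [AddCommGroup G] {m : ℕ} {x : G} : x ∈ Tors G m ↔ m • x = 0 :=
  AddSubgroup.torsionBy.nsmul_iff

/-- The embedding `ℤ/N → ℚ/ℤ`, `a ↦ a/N`, identifying `ℤ/N` with `(1/N)ℤ/ℤ`. -/
def zmodToCircle (N : ℕ) : ZMod N →+ AddCircle (1 : ℚ) :=
  ZMod.lift N ⟨zmultiplesHom _ (((1 / (N : ℚ) : ℚ)) : AddCircle (1 : ℚ)), by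
    rcases Nat.eq_zero_or_pos N with rfl | hN
    · simp
    · have h : ((N : ℤ) • ((1 / (N : ℚ) : ℚ) : AddCircle (1 : ℚ))) =
          ((1 : ℚ) : AddCircle (1 : ℚ)) := by
        rw [← AddCircle.coe_zsmul]
        congr 1
        have : (N : ℚ) ≠ 0 := by positivity
        simp [this]
      rw [AddCircle.coe_period] at h
      exact h⟩

/-- The identification `Hom(G, ℤ/N) ≅ G^∨[N]`. -/
def toChar {G : Type} [AddCommGroup G] {N : ℕ} (α : G →+ ZMod N) : DualGroup G :=
  (zmodToCircle N).comp α

/-- `∧²G`: the subgroup of `G ⊗ G` spanned by the elements `x ⊗ y - y ⊗ x`. -/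
def wedgeSq (G : Type) [AddCommGroup G] : AddSubgroup (G ⊗[ℤ] G) :=
  AddSubgroup.closure {z | ∃ x y : G, z = x ⊗ₜ[ℤ] y - y ⊗ₜ[ℤ] x}

/-- `Sym²G`: the quotient of `G ⊗ G` by the elements `x ⊗ y - y ⊗ x`. -/
abbrev SymSq (G : Type) [AddCommGroup G] : Type := (G ⊗[ℤ] G) ⧸ wedgeSq G

/-- For `α, β ∈ Hom(G, ℤ/N)`, the homomorphism `G ⊗ G → ℤ/N`, `x ⊗ y ↦ α(x) β(y)`. -/
def tensorPairing {G : Type} [AddCommGroup G] {N : ℕ} (α β : G →+ ZMod N) :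
    G ⊗[ℤ] G →+ ZMod N :=
  (LinearMap.mul' ℤ (ZMod N) ∘ₗ
    TensorProduct.map α.toIntLinearMap β.toIntLinearMap).toAddMonoidHom

/-- The map `f ⊗ f : G ⊗ G → H ⊗ H`. -/
def mapTensorSq {G H : Type} [AddCommGroup G] [AddCommGroup H] (f : G →+ H) :
    G ⊗[ℤ] G →+ H ⊗[ℤ] H :=
  (TensorProduct.map f.toIntLinearMap f.toIntLinearMap).toAddMonoidHom

/-- `ℓ^r α ∈ G^∨[ℓ^n]` for `α ∈ G^∨[ℓ^{n+r}]`. -/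
def smulToChar {G : Type} [AddCommGroup G] {ℓ n r : ℕ} (α : G →+ ZMod (ℓ ^ (n + r))) :
    Tors (DualGroup G) (ℓ ^ n) :=
  ⟨ℓ ^ r • toChar α, by
    rw [mem_Tors, smul_smul, ← pow_add]
    ext x
    change ℓ ^ (n + r) • zmodToCircle _ (α x) = 0
    rw [← map_nsmul, ZModModule.char_nsmul_eq_zero, map_zero]⟩

/-- The map `G[m] → H[m]` induced by `f : G → H`. -/
def mapTors {G H : Type} [AddCommGroup G] [AddCommGroup H] (f : G →+ H) (m : ℕ) :
    Tors G m →+ Tors H m :=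
  (f.comp (Tors G m).subtype).codRestrict (Tors H m) (by
    rintro ⟨x, hx⟩
    rw [mem_Tors] at hx ⊢
    change m • f x = 0
    rw [← map_nsmul, hx, map_zero])

/-- The map `f^∨ : H^∨[m] → G^∨[m]`, `γ ↦ γ ∘ f`, induced by `f : G → H`. -/
def dualTors {G H : Type} [AddCommGroup G] [AddCommGroup H] (f : G →+ H) (m : ℕ) :
    Tors (DualGroup H) m →+ Tors (DualGroup G) m :=
  mapTors (AddMonoidHom.compHom' f) m

/-! ### Bilinearly enhanced groups -/

/-- An `ℓ^n`-BEG: a finite abelian `ℓ`-group `G` with `ω ∈ (∧²G)[ℓ^n]` and a homomorphism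
`ψ : G^∨[ℓ^n] → G[ℓ^n]` such that, for all `r` and all `α, β ∈ G^∨[ℓ^{n+r}] = Hom(G, ℤ/ℓ^{n+r})`,
`β(ψ(ℓ^r α)) = α(ψ(ℓ^r β)) + 2 ω_{n+r}(α, β)`, where `ω_m(α, β) ∈ (1/ℓ^m)ℤ/ℤ ≅ ℤ/ℓ^m` is the value
of `α ⊗ β` at `ω`. -/
structure BEG (ℓ n : ℕ) where
  carrier : Type
  [addCommGroup : AddCommGroup carrier]
  [finite : Finite carrier]
  isPGroup : ∀ x : carrier, ∃ k : ℕ, ℓ ^ k • x = 0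
  ω : carrier ⊗[ℤ] carrier
  ω_mem : ω ∈ wedgeSq carrier
  ω_torsion : ℓ ^ n • ω = 0
  ψ : Tors (DualGroup carrier) (ℓ ^ n) →+ Tors carrier (ℓ ^ n)
  compat : ∀ (r : ℕ) (α β : carrier →+ ZMod (ℓ ^ (n + r))),
    toChar β (ψ (smulToChar α)) =
      toChar α (ψ (smulToChar β)) + 2 • zmodToCircle (ℓ ^ (n + r)) (tensorPairing α β ω)

attribute [instance] BEG.addCommGroup BEG.finite

namespace BEG

variable {ℓ n : ℕ}

/-- `f : G → H` is a morphism of BEGs: `f_* ω_G = ω_H` and `f_* ψ_G = ψ_H`, where `f_* ψ_G` is the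
composite `H^∨[ℓ^n] → G^∨[ℓ^n] → G[ℓ^n] → H[ℓ^n]`. -/
def IsHom (X Y : BEG ℓ n) (f : X.carrier →+ Y.carrier) : Prop :=
  mapTensorSq f X.ω = Y.ω ∧
    (mapTors f (ℓ ^ n)).comp (X.ψ.comp (dualTors f (ℓ ^ n))) = Y.ψ

/-- `Surj(X, Y)`: the surjective morphisms. -/
def Surj (X Y : BEG ℓ n) : Type :=
  {f : X.carrier →+ Y.carrier // IsHom X Y f ∧ Function.Surjective f}

/-- `Aut(X)`: the automorphisms of `X`. -/
def Aut (X : BEG ℓ n) : Type := {e : X.carrier ≃+ X.carrier // IsHom X X e.toAddMonoidHom}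

theorem IsHom.id (X : BEG ℓ n) : IsHom X X (AddMonoidHom.id _) := by
  refine ⟨?_, ?_⟩
  · exact DFunLike.congr_fun (TensorProduct.map_id (R := ℤ)) X.ω
  · ext γ; rfl

theorem IsHom.comp {X Y Z : BEG ℓ n} {f : X.carrier →+ Y.carrier} {g : Y.carrier →+ Z.carrier}
    (hg : IsHom Y Z g) (hf : IsHom X Y f) : IsHom X Z (g.comp f) := by
  refine ⟨?_, ?_⟩
  · rw [← hg.1, ← hf.1]
    exact DFunLike.congr_fun (TensorProduct.map_comp (R := ℤ) g.toIntLinearMap g.toIntLinearMap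
      f.toIntLinearMap f.toIntLinearMap) X.ω
  · rw [← hg.2, ← hf.2]; rfl

theorem IsHom.symm {X Y : BEG ℓ n} {e : X.carrier ≃+ Y.carrier}
    (he : IsHom X Y e.toAddMonoidHom) : IsHom Y X e.symm.toAddMonoidHom := by
  have hid : e.symm.toAddMonoidHom.comp e.toAddMonoidHom = AddMonoidHom.id _ := by
    ext x; exact e.symm_apply_apply x
  refine ⟨?_, ?_⟩
  · rw [← he.1]
    have h := DFunLike.congr_fun (TensorProduct.map_comp (R := ℤ)
      e.symm.toAddMonoidHom.toIntLinearMap e.symm.toAddMonoidHom.toIntLinearMap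
      e.toAddMonoidHom.toIntLinearMap e.toAddMonoidHom.toIntLinearMap) X.ω
    refine h.symm.trans ?_
    have h' := (IsHom.id X).1
    rw [← hid] at h'
    exact h'
  · rw [← he.2]
    have h' := (IsHom.id X).2
    rw [← hid] at h'
    exact h'

/-- The quotient of a BEG by a subgroup, with `ω` and `ψ` pushed forward. -/
def quotient (X : BEG ℓ n) (N : AddSubgroup X.carrier) : BEG ℓ n where
  carrier := X.carrier ⧸ N
  isPGroup := by
    intro x
    obtain ⟨y, rfl⟩ := QuotientAddGroup.mk'_surjective N x
    obtain ⟨k, hk⟩ := X.isPGroup y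
    exact ⟨k, by rw [← map_nsmul, hk, map_zero]⟩
  ω := mapTensorSq (QuotientAddGroup.mk' N) X.ω
  ω_mem := by
    have h : wedgeSq X.carrier ≤
        (wedgeSq (X.carrier ⧸ N)).comap (mapTensorSq (QuotientAddGroup.mk' N)) := by
      refine (AddSubgroup.closure_le _).2 ?_
      rintro _ ⟨x, y, rfl⟩
      exact AddSubgroup.subset_closure ⟨_, _, by rw [map_sub]; rfl⟩
    exact h X.ω_mem
  ω_torsion := by rw [← map_nsmul, X.ω_torsion, map_zero]
  ψ := (mapTors (QuotientAddGroup.mk' N) (ℓ ^ n)).comp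
    (X.ψ.comp (dualTors (QuotientAddGroup.mk' N) (ℓ ^ n)))
  compat := by
    intro r α β
    have h : tensorPairing α β (mapTensorSq (QuotientAddGroup.mk' N) X.ω) =
        tensorPairing (α.comp (QuotientAddGroup.mk' N)) (β.comp (QuotientAddGroup.mk' N)) X.ω := by
      generalize X.ω = z
      induction z with
      | zero => simp only [map_zero]
      | tmul x y => rfl
      | add a b ha hb => simp only [map_add, ha, hb]
    rw [h]
    exact X.compat r (α.comp (QuotientAddGroup.mk' N)) (β.comp (QuotientAddGroup.mk' N))

/-- Isomorphism of BEGs. -/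
def Iso (X Y : BEG ℓ n) : Prop := ∃ e : X.carrier ≃+ Y.carrier, IsHom X Y e.toAddMonoidHom

theorem Iso.refl (X : BEG ℓ n) : Iso X X := ⟨AddEquiv.refl _, IsHom.id X⟩

theorem Iso.symm {X Y : BEG ℓ n} (h : Iso X Y) : Iso Y X := by
  obtain ⟨e, he⟩ := h
  exact ⟨e.symm, IsHom.symm he⟩

theorem Iso.trans {X Y Z : BEG ℓ n} (h : Iso X Y) (h' : Iso Y Z) : Iso X Z := by
  obtain ⟨e, he⟩ := h
  obtain ⟨e', he'⟩ := h'
  refine ⟨e.trans e', ?_⟩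
  have h : (e.trans e').toAddMonoidHom = e'.toAddMonoidHom.comp e.toAddMonoidHom := rfl
  rw [h]
  exact IsHom.comp he' he

instance isoSetoid (ℓ n : ℕ) : Setoid (BEG ℓ n) := ⟨Iso, ⟨Iso.refl, Iso.symm, Iso.trans⟩⟩

/-- The subgroup `ψ_G(G^∨[ℓ])` of `G`, where `G^∨[ℓ] ⊆ G^∨[ℓ^n]`. -/
def psiImage (X : BEG ℓ n) : AddSubgroup X.carrier :=
  ((Tors (DualGroup X.carrier) ℓ).comap (Tors (DualGroup X.carrier) (ℓ ^ n)).subtype).map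
    ((Tors X.carrier (ℓ ^ n)).subtype.comp X.ψ)

/-- `ψ_G(G^∨[ℓ])` has codimension `s` in `G[ℓ]`, as `𝔽_ℓ`-vector spaces: its index is `ℓ^s`. -/
def PsiCodim (X : BEG ℓ n) (s : ℕ) : Prop :=
  X.psiImage.relIndex (Tors X.carrier ℓ) = ℓ ^ s

end BEG

/-- The set `𝒞_{ℓ,n}` of isomorphism classes of `ℓ^n`-BEGs. -/
def BEGClass (ℓ n : ℕ) : Type 1 := Quotient (BEG.isoSetoid ℓ n)

/-- The isomorphism class of a BEG. -/
def BEG.cls {ℓ n : ℕ} (X : BEG ℓ n) : BEGClass ℓ n := Quotient.mk _ X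

/-- A representative of an isomorphism class. -/
def BEGClass.rep {ℓ n : ℕ} (X : BEGClass ℓ n) : BEG ℓ n := Quotient.out X

/-- `𝒞_{ℓ,n}` is a discrete space: every subset is measurable. -/
instance (ℓ n : ℕ) : MeasurableSpace (BEGClass ℓ n) := ⊤

/-! ### The operation `Q` and moments -/

/-- The measure `Qν` obtained by quotienting by a random element: the mass of `X` is
`∫ #{f : ℤ_ℓ → H | H / im f ≅ X} / |H| dν(H)`. -/
def quotientMeasure (ℓ n : ℕ) [Fact ℓ.Prime] (ν : Measure (BEGClass ℓ n)) :
    Measure (BEGClass ℓ n) :=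
  Measure.sum fun X : BEGClass ℓ n =>
    (∫⁻ H, (Nat.card {f : ℤ_[ℓ] →+ H.rep.carrier // (H.rep.quotient f.range).cls = X} : ℝ≥0∞) /
      (Nat.card H.rep.carrier : ℝ≥0∞) ∂ν) • Measure.dirac X

/-- The `X`-moment `𝔼_ν #Surj(*, X)`. -/
def moment {ℓ n : ℕ} (ν : Measure (BEGClass ℓ n)) (X : BEG ℓ n) : ℝ≥0∞ :=
  ∫⁻ H, (Nat.card (BEG.Surj H.rep X) : ℝ≥0∞) ∂ν

/-! ### The linear random matrix model -/

/-- The lattice `ℤ_ℓ^{2g}` with basis `e_i` (index `inl i`) and `f_i` (index `inr i`). -/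
abbrev SympLattice (ℓ g : ℕ) [Fact ℓ.Prime] : Type := Fin g ⊕ Fin g → ℤ_[ℓ]

/-- The standard symplectic pairing on `ℤ_ℓ^{2g}`, with `⟨e_i, f_i⟩ = 1`. -/
def symp {ℓ g : ℕ} [Fact ℓ.Prime] (x y : SympLattice ℓ g) : ℤ_[ℓ] :=
  ∑ i : Fin g, (x (Sum.inl i) * y (Sum.inr i) - x (Sum.inr i) * y (Sum.inl i))

theorem symp_add_left {ℓ g : ℕ} [Fact ℓ.Prime] (x x' y : SympLattice ℓ g) :
    symp (x + x') y = symp x y + symp x' y := by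
  simp only [symp, Pi.add_apply, ← Finset.sum_add_distrib]
  exact Finset.sum_congr rfl fun i _ => by ring

theorem symp_add_right {ℓ g : ℕ} [Fact ℓ.Prime] (x y y' : SympLattice ℓ g) :
    symp x (y + y') = symp x y + symp x y' := by
  simp only [symp, Pi.add_apply, ← Finset.sum_add_distrib]
  exact Finset.sum_congr rfl fun i _ => by ring

theorem symp_neg_left {ℓ g : ℕ} [Fact ℓ.Prime] (x y : SympLattice ℓ g) : symp (-x) y = -symp x y := by
  simp only [symp, Pi.neg_apply, ← Finset.sum_neg_distrib]
  exact Finset.sum_congr rfl fun i _ => by ring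

theorem symp_neg_right {ℓ g : ℕ} [Fact ℓ.Prime] (x y : SympLattice ℓ g) : symp x (-y) = -symp x y := by
  simp only [symp, Pi.neg_apply, ← Finset.sum_neg_distrib]
  exact Finset.sum_congr rfl fun i _ => by ring

open Matrix in
/-- The group of skew-symplectic matrices: `⟨M v, w⟩ = -⟨v, M w⟩`. -/
def skewSymplectic (ℓ g : ℕ) [Fact ℓ.Prime] :
    AddSubgroup (Matrix (Fin g ⊕ Fin g) (Fin g ⊕ Fin g) ℤ_[ℓ]) where
  carrier := {M | ∀ v w : SympLattice ℓ g, symp (M *ᵥ v) w = -symp v (M *ᵥ w)}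
  add_mem' := by
    intro M N hM hN v w
    rw [Matrix.add_mulVec, Matrix.add_mulVec, symp_add_left, symp_add_right, hM, hN]
    ring
  zero_mem' := by
    intro v w
    simp [symp]
  neg_mem' := by
    intro M hM v w
    rw [Matrix.neg_mulVec, Matrix.neg_mulVec, symp_neg_left, symp_neg_right, hM]

instance (ℓ g : ℕ) [Fact ℓ.Prime] : CompactSpace (skewSymplectic ℓ g) := by
  have hc : IsClosed ((skewSymplectic ℓ g : AddSubgroup _) :
      Set (Matrix (Fin g ⊕ Fin g) (Fin g ⊕ Fin g) ℤ_[ℓ])) := by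
    have h : ((skewSymplectic ℓ g : AddSubgroup _) :
        Set (Matrix (Fin g ⊕ Fin g) (Fin g ⊕ Fin g) ℤ_[ℓ])) =
        ⋂ (v : SympLattice ℓ g) (w : SympLattice ℓ g),
          {M | symp (M.mulVec v) w = -symp v (M.mulVec w)} := by
      ext M
      simp only [Set.mem_iInter]
      rfl
    rw [h]
    refine isClosed_iInter fun v => isClosed_iInter fun w => isClosed_eq ?_ ?_ <;>
    · simp only [symp, Matrix.mulVec, dotProduct]
      fun_prop
  have : CompactSpace (Matrix (Fin g ⊕ Fin g) (Fin g ⊕ Fin g) ℤ_[ℓ]) :=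
    inferInstanceAs (CompactSpace ((Fin g ⊕ Fin g) → (Fin g ⊕ Fin g) → ℤ_[ℓ]))
  exact isCompact_iff_compactSpace.1 hc.isCompact

instance (ℓ g : ℕ) [Fact ℓ.Prime] : MeasurableSpace (skewSymplectic ℓ g) := borel _

instance (ℓ g : ℕ) [Fact ℓ.Prime] : BorelSpace (skewSymplectic ℓ g) := ⟨rfl⟩

/-- The Haar probability measure on the compact group of skew-symplectic matrices. -/
def skewHaar (ℓ g : ℕ) [Fact ℓ.Prime] : Measure (skewSymplectic ℓ g) :=
  Measure.addHaarMeasure ⊤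

open Matrix in
/-- The triple `(G_M, ω_M, ψ_M)` attached to `M` is isomorphic to `X`. Here `G_M` is the cokernel of
`A = M + ℓ^n`, `ω_M` is the image of `∑ e_i ∧ f_i`, and `ψ_M` is defined as follows. Identify `G_M^∨`
with a group of vectors `v ∈ (ℚ_ℓ/ℤ_ℓ)^{2g}` by `γ = ⟨·, v⟩`; then `ψ_M(γ)` is the class of `A v'`
for any lift `v' ∈ ℚ_ℓ^{2g}` of `v`. If `γ` is `ℓ^n`-torsion, then `v' = w / ℓ^n` with `w` integral,
so `γ = ⟨·, w⟩ / ℓ^n mod ℤ_ℓ`, and `A v'` is the integral vector `u` such that `ℓ^n u = A w`.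
The isomorphism is given as the induced surjection `f : ℤ_ℓ^{2g} → X` with kernel `im A`. -/
def IsCokernelBEG {ℓ n g : ℕ} [Fact ℓ.Prime]
    (M : Matrix (Fin g ⊕ Fin g) (Fin g ⊕ Fin g) ℤ_[ℓ]) (X : BEG ℓ n) : Prop :=
  ∃ f : SympLattice ℓ g →+ X.carrier,
    Function.Surjective f ∧
    (∀ x : SympLattice ℓ g, f x = 0 ↔ ∃ y : SympLattice ℓ g, x = (M + (ℓ : ℤ_[ℓ]) ^ n • 1) *ᵥ y) ∧
    X.ω = ∑ i : Fin g,
      (f (Pi.single (Sum.inl i) 1) ⊗ₜ[ℤ] f (Pi.single (Sum.inr i) 1) -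
        f (Pi.single (Sum.inr i) 1) ⊗ₜ[ℤ] f (Pi.single (Sum.inl i) 1)) ∧
    ∀ (γ : Tors (DualGroup X.carrier) (ℓ ^ n)) (w u : SympLattice ℓ g),
      (∀ x : SympLattice ℓ g, (γ : DualGroup X.carrier) (f x) =
        zmodToCircle (ℓ ^ n) (PadicInt.toZModPow n (symp x w))) →
      (ℓ : ℤ_[ℓ]) ^ n • u = (M + (ℓ : ℤ_[ℓ]) ^ n • 1) *ᵥ w →
      (X.ψ γ : X.carrier) = f u

/-- The linear measure `μ_g`: the pushforward of Haar measure under `M ↦ (G_M, ω_M, ψ_M)`, which is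
defined for `det(M + ℓ^n) ≠ 0`, that is, almost everywhere. -/
def linearMeasure (ℓ n g : ℕ) [Fact ℓ.Prime] : Measure (BEGClass ℓ n) :=
  Measure.sum fun X : BEGClass ℓ n =>
    skewHaar ℓ g {M | IsCokernelBEG (M : Matrix (Fin g ⊕ Fin g) (Fin g ⊕ Fin g) ℤ_[ℓ]) X.rep} •
      Measure.dirac X

/-- `μ` is the universal measure: a probability measure on the discrete space `𝒞_{ℓ,n}` that is the
weak-* limit of the linear measures `μ_g` as `g → ∞`. -/
def IsUniversalMeasure (ℓ n : ℕ) [Fact ℓ.Prime] (μ : Measure (BEGClass ℓ n)) : Prop :=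
  IsProbabilityMeasure μ ∧
    ∀ X : BEGClass ℓ n, Tendsto (fun g : ℕ => linearMeasure ℓ n g {X}) atTop (𝓝 (μ {X}))

/-- `(x)_j = ∏_{i=1}^{j} (1 - x^i)`. -/
def qPochhammer (x : ℝ) (j : ℕ) : ℝ := ∏ i ∈ Finset.range j, (1 - x ^ (i + 1))

end

noncomputable section


set_option linter.unusedSectionVars false

/-! ### Characters with values in `ℤ/N` -/

/-! Write A = M + ℓ^n, x = 1/ℓ, and c_t(d) = ∏_{j<d} (1 - x^{t-j}), the probability that t random
elements generate a finite ℓ-group of rank d.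

The operation Q. A quotient of H by t random elements is X exactly when these elements generate the
kernel of some surjective morphism π : H → X. Averaging c_t over the quotients of ker π by one
random element gives c_{t+1} (`sum_surjWeight_quotient`), and |ker π|/|H| = 1/|X|. Hence Q^t ν(X) is
(|Aut X| |X|^t)⁻¹ times the ν-integral of ∑_π c_t(rk ker π) (`quotientMeasure_iterate_singleton`).
The same computation with weight 1 gives the statement on moments, for every measure ν
(`moment_iterate`).

One surjection. Surjective morphisms from coker A to X are surjections f from the lattice to X that
kill im A and carry ω and ψ correctly (`surjEquivPush`). Fix f with the right ω, a Smith basis b_i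
with ker f spanned by ℓ^{k_i} b_i and k increasing, and the symplectic dual basis x_i. The condition
on A becomes a set of congruences on the numbers ⟨x_i, A x_j⟩. The compatibility axiom of a BEG
matches the identity A + A* = 2ℓ^n, so the congruences indexed by i ≤ j imply the others, and those
are independent under Haar measure (`isPush_iff_forall_le`, `upperHom_surjective`). Their
probability is |Sym²X| / (|X|^{2g+1} |(Sym²X)[ℓ^n]|).

The kernel. The rank of ker π is the corank of the matrix of the digits ⟨x_i, A x_j⟩/ℓ^{k_i} modulo
ℓ (`genRank_eq_finrank`). After the indices with k_i = 0 are separated, this matrix has blocks S, 0,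
U, P, where S is uniform symmetric, U is uniform, and P is the matrix of ψ : X^∨[ℓ] → X[ℓ], of
corank s. The average of c_t(corank) is c_t(s) times the average of c_t(corank S)
(`expect_surjWeight_fromBlocks`). The latter average a(m,t) over symmetric matrices of size m
satisfies a(m+1,t) = a(m,t+1) - x^{t+1} a(m,t) (`symAverage_border`), and this forces a(m,t) →
∏_{i>t} (1 + x^i)⁻¹ as m → ∞, since 2x < 1 (`tendsto_of_recurrence`).

The limit. Character sums show that the number of surjections f with the right ω is asymptotic to
|X|^{2g}/|∧²X| (`tendsto_card_surjective_omegaSum`), and |∧²X| |X| = |Sym²X|. So the integrals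
against μ_g converge; t = 0 gives the limit masses. The sequence μ_g is tight, because the expected
number of vectors y modulo ℓ^N with ⟨y, A·⟩ ≡ 0 is at most N + 1 (`skewHaar_not_exists_le`). Hence
the limit is a probability measure, and since Q^t applied to a point mass gives X a mass of at most
1, the formula for Q^t also passes to the limit. -/

theorem zmodToCircle_intCast (N : ℕ) (a : ℤ) :
    zmodToCircle N (a : ZMod N) = (((a : ℚ) / (N : ℚ) : ℚ) : AddCircle (1 : ℚ)) := by
  have h : zmodToCircle N (a : ZMod N) = a • (((1 / (N : ℚ) : ℚ)) : AddCircle (1 : ℚ)) :=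
    ZMod.lift_coe N _ a
  rw [h, ← AddCircle.coe_zsmul]
  congr 1
  simp [div_eq_mul_inv]

theorem zmodToCircle_injective (N : ℕ) [NeZero N] : Function.Injective (zmodToCircle N) := by
  rw [injective_iff_map_eq_zero]
  intro a ha
  obtain ⟨b, rfl⟩ := ZMod.intCast_surjective a
  rw [zmodToCircle_intCast, AddCircle.coe_eq_zero_iff] at ha
  obtain ⟨k, hk⟩ := ha
  have hN : (N : ℚ) ≠ 0 := Nat.cast_ne_zero.2 (NeZero.ne N)
  have : b = k * N := by
    field_simp at hk
    have h2 : (b : ℚ) = ((k * N : ℤ) : ℚ) := by push_cast; simpa using hk.symm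
    exact_mod_cast h2
  rw [ZMod.intCast_zmod_eq_zero_iff_dvd]
  exact ⟨k, by rw [this, mul_comm]⟩

theorem exists_zmodToCircle_eq (N : ℕ) [NeZero N] {z : AddCircle (1 : ℚ)} (hz : N • z = 0) :
    ∃ a, zmodToCircle N a = z := by
  obtain ⟨q, rfl⟩ := QuotientAddGroup.mk_surjective z
  change N • ((q : ℚ) : AddCircle (1 : ℚ)) = 0 at hz
  rw [← AddCircle.coe_nsmul, AddCircle.coe_eq_zero_iff] at hz
  obtain ⟨k, hk⟩ := hz
  have hN : (N : ℚ) ≠ 0 := Nat.cast_ne_zero.2 (NeZero.ne N)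
  refine ⟨(k : ZMod N), ?_⟩
  rw [zmodToCircle_intCast]
  congr 1
  simp at hk
  field_simp
  linarith

theorem exists_toChar_eq {G : Type} [AddCommGroup G] (N : ℕ) [NeZero N] {γ : DualGroup G}
    (hγ : N • γ = 0) : ∃ α : G →+ ZMod N, toChar α = γ := by
  have h : ∀ x, ∃ a, zmodToCircle N a = γ x := fun x =>
    exists_zmodToCircle_eq N (DFunLike.congr_fun hγ x)
  choose a ha using h
  refine ⟨AddMonoidHom.mk' a fun x y => zmodToCircle_injective N ?_, ?_⟩
  · rw [map_add, ha, ha, ha, map_add]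
  · ext x; exact ha x

theorem nsmul_toChar {G : Type} [AddCommGroup G] {N : ℕ} (α : G →+ ZMod N) :
    N • toChar α = 0 := by
  ext x
  change N • zmodToCircle N (α x) = 0
  rw [← map_nsmul, ZModModule.char_nsmul_eq_zero, map_zero]

instance finite_dualGroup (G : Type) [AddCommGroup G] [Finite G] : Finite (DualGroup G) := by
  have : NeZero (Nat.card G) := ⟨Nat.card_pos.ne'⟩
  have : Finite (G →+ ZMod (Nat.card G)) := DFunLike.finite _
  refine Finite.of_surjective (toChar : (G →+ ZMod (Nat.card G)) → DualGroup G) fun γ => ?_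
  refine exists_toChar_eq _ ?_
  ext x
  change Nat.card G • γ x = 0
  rw [← map_nsmul, card_nsmul_eq_zero', map_zero]

instance finite_tensor (G H : Type) [AddCommGroup G] [AddCommGroup H] [Finite G] [Finite H] :
    Finite (G ⊗[ℤ] H) := by
  have : Module.Finite ℤ G := Module.Finite.of_finite
  have : Module.Finite ℤ H := Module.Finite.of_finite
  have : Module.Finite ℤ (G ⊗[ℤ] H) := by
    -- An abelian group has only one ℤ-module structure, so the one coming from the tensor product
    -- is the one coming from addition.
    convert Module.Finite.tensorProduct ℤ G H
    · rfl
    · exact Subsingleton.elim _ _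
  refine Module.finite_of_fg_torsion _ fun z => ?_
  refine ⟨⟨(Nat.card G : ℤ), mem_nonZeroDivisors_of_ne_zero (by
    exact_mod_cast Nat.card_pos.ne')⟩, ?_⟩
  change (Nat.card G : ℤ) • z = 0
  induction z with
  | zero => simp
  | tmul x y =>
    rw [TensorProduct.smul_tmul', natCast_zsmul, card_nsmul_eq_zero', TensorProduct.zero_tmul]
  | add a b ha hb => rw [smul_add, ha, hb, add_zero]

/-! ### Push-forward of BEGs and countability of the set of classes -/

theorem tensorPairing_mapTensorSq {G H : Type} [AddCommGroup G] [AddCommGroup H] {N : ℕ}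
    (f : G →+ H) (α β : H →+ ZMod N) (z : G ⊗[ℤ] G) :
    tensorPairing α β (mapTensorSq f z) = tensorPairing (α.comp f) (β.comp f) z := by
  induction z with
  | zero => simp only [map_zero]
  | tmul x y => rfl
  | add a b ha hb => simp only [map_add, ha, hb]

theorem mapTensorSq_mem_wedgeSq {G H : Type} [AddCommGroup G] [AddCommGroup H] (f : G →+ H)
    {z : G ⊗[ℤ] G} (hz : z ∈ wedgeSq G) : mapTensorSq f z ∈ wedgeSq H := by
  have h : wedgeSq G ≤ (wedgeSq H).comap (mapTensorSq f) := by
    refine (AddSubgroup.closure_le _).2 ?_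
    rintro _ ⟨x, y, rfl⟩
    exact AddSubgroup.subset_closure ⟨_, _, by rw [map_sub]; rfl⟩
  exact h hz

namespace BEG

variable {ℓ n : ℕ}

/-- The push-forward of a BEG along a homomorphism. -/
def pushforward (X : BEG ℓ n) {H : Type} [AddCommGroup H] [Finite H]
    (hH : ∀ x : H, ∃ k : ℕ, ℓ ^ k • x = 0) (f : X.carrier →+ H) : BEG ℓ n where
  carrier := H
  isPGroup := hH
  ω := mapTensorSq f X.ω
  ω_mem := mapTensorSq_mem_wedgeSq f X.ω_mem
  ω_torsion := by rw [← map_nsmul, X.ω_torsion, map_zero]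
  ψ := (mapTors f (ℓ ^ n)).comp (X.ψ.comp (dualTors f (ℓ ^ n)))
  compat := by
    intro r α β
    rw [tensorPairing_mapTensorSq]
    exact X.compat r (α.comp f) (β.comp f)

theorem isHom_pushforward (X : BEG ℓ n) {H : Type} [AddCommGroup H] [Finite H]
    (hH : ∀ x : H, ∃ k : ℕ, ℓ ^ k • x = 0) (f : X.carrier →+ H) :
    IsHom X (X.pushforward hH f) f := ⟨rfl, rfl⟩

theorem Iso.card_eq {X Y : BEG ℓ n} (h : Iso X Y) : Nat.card X.carrier = Nat.card Y.carrier := by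
  obtain ⟨e, -⟩ := h
  exact Nat.card_congr e.toEquiv

theorem iso_rep_cls (X : BEG ℓ n) : Iso X.cls.rep X := Quotient.mk_out X

theorem cls_rep (c : BEGClass ℓ n) : c.rep.cls = c := Quotient.out_eq c

theorem cls_eq_iff {X Y : BEG ℓ n} : X.cls = Y.cls ↔ Iso X Y := Quotient.eq (r := isoSetoid ℓ n)

/-- By transport of structure such a class has a representative with underlying set T, and T carries
only finitely many group laws, elements ω and maps ψ. This gives the countability on which the use
of discrete measures rests. -/
theorem finite_setOf_equiv (ℓ n : ℕ) (T : Type) [Finite T] :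
    {c : BEGClass ℓ n | Nonempty (c.rep.carrier ≃ T)}.Finite := by
  have hA : Finite (AddCommGroup (T)) := by
    refine Finite.of_injective (fun A : AddCommGroup (T) => fun x y : T => A.add x y) ?_
    intro A B h
    exact AddCommGroup.ext h
  have hfin : ∀ A : AddCommGroup (T), (⋃ (ω : T ⊗[ℤ] T)
      (ψ : Tors (DualGroup (T)) (ℓ ^ n) →+ Tors (T) (ℓ ^ n)),
      {c : BEGClass ℓ n | ∃ h₁ h₂ h₃ h₄, c = (BEG.mk (T) h₁ ω h₂ h₃ ψ h₄).cls}).Finite := by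
    intro A
    have : Finite (Tors (DualGroup (T)) (ℓ ^ n) →+ Tors (T) (ℓ ^ n)) :=
      DFunLike.finite _
    -- The remaining fields of a BEG are propositions, so the group law, ω and ψ leave room for at
    -- most one class.
    refine Set.finite_iUnion fun ω => Set.finite_iUnion fun ψ => Set.Subsingleton.finite ?_
    rintro _ ⟨_, _, _, _, rfl⟩ _ ⟨_, _, _, _, rfl⟩
    rfl
  refine (Set.finite_iUnion hfin).subset ?_
  intro c hc
  obtain ⟨e⟩ := hc
  let A : AddCommGroup (T) := e.symm.addCommGroup
  let E : c.rep.carrier ≃+ T := (e.symm.addEquiv).symm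
  have hH : ∀ x : T, ∃ k : ℕ, ℓ ^ k • x = 0 := fun x => by
    obtain ⟨k, hk⟩ := c.rep.isPGroup (E.symm x)
    exact ⟨k, E.symm.injective (by rw [map_nsmul, hk, map_zero])⟩
  refine Set.mem_iUnion.2 ⟨A, Set.mem_iUnion.2 ⟨mapTensorSq E.toAddMonoidHom c.rep.ω,
    Set.mem_iUnion.2 ⟨(mapTors E.toAddMonoidHom (ℓ ^ n)).comp
      (c.rep.ψ.comp (dualTors E.toAddMonoidHom (ℓ ^ n))), ?_⟩⟩⟩
  refine ⟨hH, mapTensorSq_mem_wedgeSq _ c.rep.ω_mem, by rw [← map_nsmul, c.rep.ω_torsion, map_zero],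
    (c.rep.pushforward hH E.toAddMonoidHom).compat, ?_⟩
  exact (cls_rep c).symm.trans (cls_eq_iff.2 ⟨E, c.rep.isHom_pushforward hH _⟩)

theorem finite_setOf_card_eq (ℓ n m : ℕ) :
    {c : BEGClass ℓ n | Nat.card c.rep.carrier = m}.Finite :=
  (finite_setOf_equiv ℓ n (Fin m)).subset fun _ hc => ⟨Finite.equivFinOfCardEq hc⟩

theorem finite_setOf_card_le (ℓ n B : ℕ) :
    {c : BEGClass ℓ n | Nat.card c.rep.carrier ≤ B}.Finite := by
  refine ((Set.finite_Iic B).biUnion fun m _ => finite_setOf_card_eq ℓ n m).subset ?_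
  intro c hc
  exact Set.mem_biUnion (Set.mem_Iic.2 hc) rfl

end BEG

instance countable_BEGClass (ℓ n : ℕ) : Countable (BEGClass ℓ n) := by
  rw [← Set.countable_univ_iff]
  refine (Set.countable_iUnion fun m => (BEG.finite_setOf_card_eq ℓ n m).countable).mono ?_
  intro c _
  exact Set.mem_iUnion.2 ⟨_, rfl⟩

instance (ℓ n : ℕ) : MeasurableSingletonClass (BEGClass ℓ n) := ⟨fun _ => trivial⟩

/-! ### The weights `c_t(d)` -/

/-- `(x)_t / (x)_{t-d} = ∏_{j < d} (1 - x^{t-j})`; for `x = 1/ℓ` it is the probability that `t` random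
elements generate an `𝔽_ℓ`-vector space of dimension `d`. -/
def surjWeight (x : ℝ) (t d : ℕ) : ℝ := ∏ j ∈ Finset.range d, (1 - x ^ (t - j))

theorem surjWeight_zero (x : ℝ) (t : ℕ) : surjWeight x t 0 = 1 := Finset.prod_range_zero _

theorem surjWeight_succ (x : ℝ) (t d : ℕ) :
    surjWeight x t (d + 1) = surjWeight x t d * (1 - x ^ (t - d)) := Finset.prod_range_succ _ _

theorem surjWeight_succ_succ (x : ℝ) (t d : ℕ) :
    surjWeight x (t + 1) (d + 1) = surjWeight x t d * (1 - x ^ (t + 1)) := by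
  simp only [surjWeight, Finset.prod_range_succ', Nat.add_sub_add_right, Nat.sub_zero]

/-- The factor with index j = t is 1 - x^0. The truncated subtraction in the later factors is
therefore harmless. -/
theorem surjWeight_eq_zero {x : ℝ} {t d : ℕ} (h : t < d) : surjWeight x t d = 0 :=
  Finset.prod_eq_zero (Finset.mem_range.2 h) (by simp)

theorem surjWeight_nonneg {x : ℝ} (h0 : 0 ≤ x) (h1 : x ≤ 1) (t d : ℕ) : 0 ≤ surjWeight x t d :=
  Finset.prod_nonneg fun _ _ => sub_nonneg.2 (pow_le_one₀ h0 h1)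

theorem surjWeight_mul_qPochhammer (x : ℝ) {t d : ℕ} (h : d ≤ t) :
    surjWeight x t d * qPochhammer x (t - d) = qPochhammer x t := by
  induction d with
  | zero => simp [surjWeight_zero]
  | succ d ih =>
    rw [← ih (by omega), surjWeight_succ, mul_assoc]
    congr 1
    have : t - d = (t - (d + 1)) + 1 := by omega
    rw [this, qPochhammer, qPochhammer, Finset.prod_range_succ, mul_comm]

/-- Adding one random element. -/
theorem surjWeight_step (x : ℝ) (t d : ℕ) :
    x ^ (d + 1) * surjWeight x t (d + 1) + (1 - x ^ (d + 1)) * surjWeight x t d =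
      surjWeight x (t + 1) (d + 1) := by
  rw [surjWeight_succ_succ, surjWeight_succ]
  rcases lt_or_ge t d with h | h
  · rw [surjWeight_eq_zero h]; ring
  · have : x ^ (t + 1) = x ^ (d + 1) * x ^ (t - d) := by
      rw [← pow_add]; congr 1; omega
    rw [this]; ring

/-! ### Generator ranks -/

/-- The generator rank of a subgroup `K`, that is, the dimension of `K/ℓK`. -/
def genRank (ℓ : ℕ) {H : Type} [AddCommGroup H] (K : AddSubgroup H) : ℕ :=
  Nat.log ℓ ((K.map (nsmulAddMonoidHom ℓ)).relIndex K)

theorem map_nsmul_le {ℓ : ℕ} {H : Type} [AddCommGroup H] (K : AddSubgroup H) : K.map (nsmulAddMonoidHom ℓ) ≤ K := by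
  rintro _ ⟨x, hx, rfl⟩
  exact K.nsmul_mem hx ℓ

theorem genRank_map_mk {ℓ : ℕ} {H : Type} [AddCommGroup H] (K : AddSubgroup H) {h : H} (hh : h ∈ K) :
    genRank ℓ (K.map (QuotientAddGroup.mk' (AddSubgroup.zmultiples h))) =
      Nat.log ℓ ((K.map (nsmulAddMonoidHom ℓ) ⊔ AddSubgroup.zmultiples h).relIndex K) := by
  have h1 : (K.map (QuotientAddGroup.mk' (AddSubgroup.zmultiples h))).map (nsmulAddMonoidHom ℓ) =
      (K.map (nsmulAddMonoidHom ℓ)).map (QuotientAddGroup.mk' (AddSubgroup.zmultiples h)) := by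
    rw [AddSubgroup.map_map, AddSubgroup.map_map]; rfl
  rw [genRank, h1, AddSubgroup.relIndex_map_map, QuotientAddGroup.ker_mk',
    sup_eq_left.2 (AddSubgroup.zmultiples_le_of_mem hh)]

/-- An element of ℓK is invisible in K/ℓK. -/
theorem genRank_map_mk_of_mem {ℓ : ℕ} {H : Type} [AddCommGroup H] {K : AddSubgroup H} {h : H}
    (hh : h ∈ K.map (nsmulAddMonoidHom ℓ)) :
    genRank ℓ (K.map (QuotientAddGroup.mk' (AddSubgroup.zmultiples h))) = genRank ℓ K := by
  rw [genRank_map_mk K (map_nsmul_le K hh), sup_eq_left.2 (AddSubgroup.zmultiples_le_of_mem hh),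
    genRank]

section genRank

variable {ℓ : ℕ} [hp : Fact ℓ.Prime] {H : Type} [AddCommGroup H] [Finite H]

theorem exists_card_eq_pow (hH : ∀ x : H, ∃ k : ℕ, ℓ ^ k • x = 0) (K : AddSubgroup H) :
    ∃ d : ℕ, Nat.card K = ℓ ^ d := by
  have h : IsPGroup ℓ (Multiplicative K) := by
    intro x
    obtain ⟨k, hk⟩ := hH (Multiplicative.toAdd x : K)
    exact ⟨k, Subtype.ext hk⟩
  exact (IsPGroup.iff_card (G := Multiplicative K)).1 h

theorem exists_relIndex_eq_pow (hH : ∀ x : H, ∃ k : ℕ, ℓ ^ k • x = 0) (J K : AddSubgroup H) :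
    ∃ d : ℕ, J.relIndex K = ℓ ^ d := by
  obtain ⟨d, hd⟩ := exists_card_eq_pow hH K
  have h : J.relIndex K ∣ ℓ ^ d := hd ▸ J.relIndex_dvd_card K
  obtain ⟨e, -, he⟩ := (Nat.dvd_prime_pow hp.out).1 h
  exact ⟨e, he⟩

theorem relIndex_eq_pow_genRank (hH : ∀ x : H, ∃ k : ℕ, ℓ ^ k • x = 0) (K : AddSubgroup H) :
    (K.map (nsmulAddMonoidHom ℓ)).relIndex K = ℓ ^ genRank ℓ K := by
  obtain ⟨d, hd⟩ := exists_relIndex_eq_pow (ℓ := ℓ) hH (K.map (nsmulAddMonoidHom ℓ)) K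
  rw [genRank, hd, Nat.log_pow hp.out.one_lt]

/-- Here h spans a line in the 𝔽_ℓ-vector space K/ℓK, so exactly one dimension is lost. -/
theorem genRank_map_mk_of_notMem (hH : ∀ x : H, ∃ k : ℕ, ℓ ^ k • x = 0) {K : AddSubgroup H} {h : H}
    (hK : h ∈ K) (hh : h ∉ K.map (nsmulAddMonoidHom ℓ)) :
    genRank ℓ K = genRank ℓ (K.map (QuotientAddGroup.mk' (AddSubgroup.zmultiples h))) + 1 := by
  set J := K.map (nsmulAddMonoidHom ℓ) with hJ
  have hz : AddSubgroup.zmultiples h ≤ K := AddSubgroup.zmultiples_le_of_mem hK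
  -- The index is the order of h in H/ℓK, which is ℓ because ℓh lies in ℓK and h does not.
  have h1 : J.relIndex (J ⊔ AddSubgroup.zmultiples h) = ℓ := by
    rw [sup_comm, AddSubgroup.relIndex_sup_right]
    have h2 := AddSubgroup.relIndex_ker (K := AddSubgroup.zmultiples h) (QuotientAddGroup.mk' J)
    rw [QuotientAddGroup.ker_mk', AddMonoidHom.map_zmultiples, Nat.card_zmultiples] at h2
    rw [h2]
    refine addOrderOf_eq_prime ?_ ?_
    · rw [← map_nsmul]
      exact (QuotientAddGroup.eq_zero_iff _).2 ⟨h, hK, rfl⟩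
    · intro h0
      exact hh ((QuotientAddGroup.eq_zero_iff _).1 h0)
  have h3 := AddSubgroup.relIndex_mul_relIndex J (J ⊔ AddSubgroup.zmultiples h) K le_sup_left
    (sup_le (map_nsmul_le K) hz)
  obtain ⟨d, hd⟩ := exists_relIndex_eq_pow (ℓ := ℓ) hH (J ⊔ AddSubgroup.zmultiples h) K
  rw [genRank_map_mk K hK, ← hJ, hd, Nat.log_pow hp.out.one_lt, genRank, ← hJ, ← h3, h1, hd,
    ← pow_succ', Nat.log_pow hp.out.one_lt]

/-- Averaging the weight over the quotients by one random element. -/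
theorem sum_surjWeight_quotient (hH : ∀ x : H, ∃ k : ℕ, ℓ ^ k • x = 0) (K : AddSubgroup H)
    (t : ℕ) :
    ∑ᶠ h : K, surjWeight (ℓ : ℝ)⁻¹ t
        (genRank ℓ (K.map (QuotientAddGroup.mk' (AddSubgroup.zmultiples (h : H))))) =
      Nat.card K * surjWeight (ℓ : ℝ)⁻¹ (t + 1) (genRank ℓ K) := by
  classical
  have := Fintype.ofFinite K
  set J := K.map (nsmulAddMonoidHom ℓ) with hJ
  set d := genRank ℓ K with hd
  have hl : (ℓ : ℝ) ≠ 0 := Nat.cast_ne_zero.2 hp.out.ne_zero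
  have hidx : J.relIndex K = ℓ ^ d := relIndex_eq_pow_genRank hH K
  have hcard : Nat.card (J.addSubgroupOf K) * ℓ ^ d = Nat.card K := by
    rw [← hidx]; exact AddSubgroup.card_mul_index _
  have hterm : ∀ h : K, surjWeight (ℓ : ℝ)⁻¹ t
        (genRank ℓ (K.map (QuotientAddGroup.mk' (AddSubgroup.zmultiples (h : H))))) =
      if h ∈ J.addSubgroupOf K then surjWeight (ℓ : ℝ)⁻¹ t d
      else surjWeight (ℓ : ℝ)⁻¹ t (d - 1) := by
    intro h
    split_ifs with hh
    · rw [genRank_map_mk_of_mem (AddSubgroup.mem_addSubgroupOf.1 hh)]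
    · have := genRank_map_mk_of_notMem hH h.2 (fun h' => hh (AddSubgroup.mem_addSubgroupOf.2 h'))
      rw [hd, this, Nat.add_sub_cancel]
  rw [finsum_eq_sum_of_fintype, Finset.sum_congr rfl fun h _ => hterm h, Finset.sum_ite]
  simp only [Finset.sum_const, nsmul_eq_mul]
  have hc1 : ((Finset.univ.filter fun h : K => h ∈ J.addSubgroupOf K).card : ℝ) =
      Nat.card (J.addSubgroupOf K) := by
    rw [Nat.card_eq_fintype_card, Fintype.card_subtype]
  have hc2 : ((Finset.univ.filter fun h : K => h ∉ J.addSubgroupOf K).card : ℝ) =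
      Nat.card K - Nat.card (J.addSubgroupOf K) := by
    have := Finset.card_filter_add_card_filter_not (s := (Finset.univ : Finset K))
      (fun h : K => h ∈ J.addSubgroupOf K)
    rw [← hc1, Nat.card_eq_fintype_card, ← Finset.card_univ, ← this]
    push_cast; ring
  rw [hc1, hc2]
  -- A random h lies in ℓK with probability ℓ^{-d}. In rank 0 this is certain, so the other branch,
  -- where d - 1 is truncated, has weight zero.
  have hcard' : (Nat.card (J.addSubgroupOf K) : ℝ) = Nat.card K * (ℓ : ℝ)⁻¹ ^ d := by
    rw [← hcard]; push_cast; rw [inv_pow, mul_assoc, mul_inv_cancel₀ (pow_ne_zero _ hl), mul_one]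
  rw [hcard']
  rcases Nat.eq_zero_or_pos d with h0 | h0
  · rw [h0]; simp [surjWeight_zero]
  · obtain ⟨e, he⟩ := Nat.exists_eq_succ_of_ne_zero h0.ne'
    rw [he, Nat.succ_eq_add_one, ← surjWeight_step, Nat.add_sub_cancel]
    ring

end genRank

/-! ### Homomorphisms from `ℤ_ℓ`-modules to finite `ℓ`-groups -/

section PadicHom

variable {ℓ : ℕ} [hp : Fact ℓ.Prime]

theorem exists_forall_pow_nsmul_eq_zero {H : Type} [AddCommGroup H] [Finite H]
    (hH : ∀ x : H, ∃ k : ℕ, ℓ ^ k • x = 0) : ∃ e : ℕ, ∀ x : H, ℓ ^ e • x = 0 := by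
  obtain ⟨d, hd⟩ := exists_card_eq_pow (ℓ := ℓ) hH ⊤
  refine ⟨d, fun x => ?_⟩
  rw [← hd, AddSubgroup.card_top]
  exact card_nsmul_eq_zero'

theorem PadicInt.exists_eq_natCast_add (c : ℤ_[ℓ]) (e : ℕ) :
    ∃ c' : ℤ_[ℓ], c = (c.appr e : ℤ_[ℓ]) + (ℓ : ℤ_[ℓ]) ^ e * c' := by
  obtain ⟨c', hc'⟩ := Ideal.mem_span_singleton.1 (PadicInt.appr_spec e c)
  exact ⟨c', by rw [← hc']; ring⟩

theorem map_padic_pow_smul {V : Type*} [AddCommGroup V] [Module ℤ_[ℓ] V] {H : Type}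
    [AddCommGroup H] {e : ℕ} (he : ∀ x : H, ℓ ^ e • x = 0) (f : V →+ H) (v : V) :
    f ((ℓ : ℤ_[ℓ]) ^ e • v) = 0 := by
  have : (ℓ : ℤ_[ℓ]) ^ e • v = (ℓ ^ e : ℕ) • v := by
    rw [← Nat.cast_pow, Nat.cast_smul_eq_nsmul]
  rw [this, map_nsmul, he]

/-- The scalar c differs from the integer `c.appr e` by a multiple of ℓ^e, and additivity alone
makes f kill ℓ^e V. So additive maps into finite ℓ-groups are automatically ℤ_ℓ-linear, with no
continuity assumption. -/
theorem map_padic_smul {V : Type*} [AddCommGroup V] [Module ℤ_[ℓ] V] {H : Type}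
    [AddCommGroup H] {e : ℕ} (he : ∀ x : H, ℓ ^ e • x = 0) (f : V →+ H) (c : ℤ_[ℓ]) (v : V) :
    f (c • v) = c.appr e • f v := by
  obtain ⟨c', hc'⟩ := PadicInt.exists_eq_natCast_add c e
  conv_lhs => rw [hc']
  rw [add_smul, mul_smul, map_add, map_padic_pow_smul he, add_zero, Nat.cast_smul_eq_nsmul,
    map_nsmul]

theorem padicHom_ext {H : Type} [AddCommGroup H] [Finite H]
    (hH : ∀ x : H, ∃ k : ℕ, ℓ ^ k • x = 0) {f g : ℤ_[ℓ] →+ H} (h : f 1 = g 1) : f = g := by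
  obtain ⟨e, he⟩ := exists_forall_pow_nsmul_eq_zero hH
  ext c
  have h1 := map_padic_smul he f c 1
  have h2 := map_padic_smul he g c 1
  rw [smul_eq_mul, mul_one] at h1 h2
  rw [h1, h2, h]

theorem exists_padicHom {H : Type} [AddCommGroup H] [Finite H]
    (hH : ∀ x : H, ∃ k : ℕ, ℓ ^ k • x = 0) (x : H) : ∃ f : ℤ_[ℓ] →+ H, f 1 = x := by
  obtain ⟨e, he⟩ := exists_forall_pow_nsmul_eq_zero hH
  refine ⟨(ZMod.lift (ℓ ^ e) ⟨zmultiplesHom H x, ?_⟩).comp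
    (PadicInt.toZModPow e).toAddMonoidHom, ?_⟩
  · change ((ℓ ^ e : ℕ) : ℤ) • x = 0
    rw [natCast_zsmul, he]
  · have h := ZMod.lift_coe (ℓ ^ e) ⟨zmultiplesHom H x, by
      change ((ℓ ^ e : ℕ) : ℤ) • x = 0
      rw [natCast_zsmul, he]⟩ 1
    simpa using h

/-- A homomorphism from `ℤ_ℓ` to a finite `ℓ`-group is given by the image of `1`. -/
def padicHomEquiv {H : Type} [AddCommGroup H] [Finite H]
    (hH : ∀ x : H, ∃ k : ℕ, ℓ ^ k • x = 0) : (ℤ_[ℓ] →+ H) ≃ H :=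
  Equiv.ofBijective (fun f => f 1) ⟨fun _ _ h => padicHom_ext hH h, exists_padicHom hH⟩

theorem range_padicHom {H : Type} [AddCommGroup H] [Finite H]
    (hH : ∀ x : H, ∃ k : ℕ, ℓ ^ k • x = 0) (f : ℤ_[ℓ] →+ H) :
    f.range = AddSubgroup.zmultiples (f 1) := by
  obtain ⟨e, he⟩ := exists_forall_pow_nsmul_eq_zero hH
  refine le_antisymm ?_ (AddSubgroup.zmultiples_le_of_mem ⟨1, rfl⟩)
  rintro _ ⟨c, rfl⟩
  have h1 := map_padic_smul he f c 1
  rw [smul_eq_mul, mul_one] at h1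
  rw [h1]
  exact AddSubgroup.nsmul_mem _ (AddSubgroup.mem_zmultiples _) _

end PadicHom

/-! ### The operation `Q` -/

theorem natCast_card_eq_tsum (S : Type*) [Finite S] : (Nat.card S : ℝ≥0∞) = ∑' _ : S, 1 := by
  have := Fintype.ofFinite S
  rw [tsum_fintype, Finset.sum_const, Finset.card_univ, Nat.card_eq_fintype_card, nsmul_eq_mul,
    mul_one]

theorem tsum_card_fiber_mul {S T : Type*} [Finite S] (g : S → T) (F : T → ℝ≥0∞) :
    ∑' y, (Nat.card {s // g s = y} : ℝ≥0∞) * F y = ∑' s, F (g s) := by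
  rw [← (Equiv.sigmaFiberEquiv g).tsum_eq, ENNReal.tsum_sigma']
  refine tsum_congr fun y => ?_
  rw [natCast_card_eq_tsum, ← ENNReal.tsum_mul_right]
  refine tsum_congr fun s => ?_
  rw [one_mul]
  exact congrArg F s.2.symm

section Quotient

variable {ℓ n : ℕ} [hp : Fact ℓ.Prime]

/-- The sum over target classes only groups the homomorphisms ℤ_ℓ → H by their quotient. Such a
homomorphism amounts to the element h = f(1), and its image is the subgroup generated by h. -/
theorem lintegral_quotientMeasure (ν : Measure (BEGClass ℓ n)) (F : BEGClass ℓ n → ℝ≥0∞) :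
    ∫⁻ c, F c ∂(quotientMeasure ℓ n ν) =
      ∫⁻ H, (∑' h : H.rep.carrier, F (H.rep.quotient (AddSubgroup.zmultiples h)).cls) /
        (Nat.card H.rep.carrier : ℝ≥0∞) ∂ν := by
  rw [quotientMeasure, lintegral_sum_measure]
  simp_rw [lintegral_smul_measure, lintegral_dirac, smul_eq_mul]
  simp_rw [← lintegral_mul_const _ (measurable_of_countable _)]
  rw [← lintegral_tsum fun _ => (measurable_of_countable _).aemeasurable]
  refine lintegral_congr fun H => ?_
  have hfin : Finite (ℤ_[ℓ] →+ H.rep.carrier) :=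
    Finite.of_equiv _ (padicHomEquiv H.rep.isPGroup).symm
  simp_rw [div_eq_mul_inv, mul_right_comm _ (Nat.card H.rep.carrier : ℝ≥0∞)⁻¹]
  rw [ENNReal.tsum_mul_right, tsum_card_fiber_mul (fun f : ℤ_[ℓ] →+ H.rep.carrier =>
    (H.rep.quotient f.range).cls) F]
  congr 1
  rw [← (padicHomEquiv H.rep.isPGroup).tsum_eq]
  refine tsum_congr fun f => ?_
  rw [range_padicHom H.rep.isPGroup]
  rfl

theorem quotientMeasure_univ (ν : Measure (BEGClass ℓ n)) :
    quotientMeasure ℓ n ν Set.univ = ν Set.univ := by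
  rw [← lintegral_one, lintegral_quotientMeasure, ← lintegral_one]
  refine lintegral_congr fun H => ?_
  rw [← natCast_card_eq_tsum]
  exact ENNReal.div_self (by simp [Nat.card_eq_zero, Finite.not_infinite]) (by simp)

/-- The sum of `φ(rk ker π)` over all surjective morphisms `π : H → X`. -/
def surjSum (φ : ℕ → ℝ≥0∞) (H X : BEG ℓ n) : ℝ≥0∞ :=
  ∑' π : BEG.Surj H X, φ (genRank ℓ π.1.ker)

instance (H X : BEG ℓ n) : Finite (BEG.Surj H X) := by
  have : Finite (H.carrier →+ X.carrier) := DFunLike.finite _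
  exact Subtype.finite

instance (X : BEG ℓ n) : Finite (BEG.Aut X) := by
  have : Finite (X.carrier ≃+ X.carrier) := DFunLike.finite _
  exact Subtype.finite

theorem genRank_ker_comp_equiv {H H' X : Type} [AddCommGroup H] [AddCommGroup H'] [AddCommGroup X]
    (ℓ : ℕ) (f : H' →+ X) (e : H ≃+ H') :
    genRank ℓ (f.comp e.toAddMonoidHom).ker = genRank ℓ f.ker := by
  have h1 : f.ker = (f.comp e.toAddMonoidHom).ker.map e.toAddMonoidHom := by
    ext y
    constructor
    · intro hy
      exact ⟨e.symm y, by simpa [AddMonoidHom.mem_ker] using hy, e.apply_symm_apply y⟩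
    · rintro ⟨x, hx, rfl⟩
      exact hx
  have h2 : f.ker.map (nsmulAddMonoidHom ℓ) =
      ((f.comp e.toAddMonoidHom).ker.map (nsmulAddMonoidHom ℓ)).map e.toAddMonoidHom := by
    rw [h1, AddSubgroup.map_map, AddSubgroup.map_map]
    congr 1
    ext x
    exact (map_nsmul e ℓ x).symm
  rw [genRank, genRank, h2]
  conv_rhs => rw [h1]
  rw [AddSubgroup.relIndex_map_map_of_injective _ _ e.injective]

theorem surjSum_congr (φ : ℕ → ℝ≥0∞) {H H' : BEG ℓ n} (h : BEG.Iso H H') (X : BEG ℓ n) :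
    surjSum φ H X = surjSum φ H' X := by
  obtain ⟨e, he⟩ := h
  let E : BEG.Surj H' X ≃ BEG.Surj H X :=
    { toFun := fun π => ⟨π.1.comp e.toAddMonoidHom, π.2.1.comp he,
        π.2.2.comp e.surjective⟩
      invFun := fun π => ⟨π.1.comp e.symm.toAddMonoidHom, π.2.1.comp he.symm,
        π.2.2.comp e.symm.surjective⟩
      left_inv := fun π => Subtype.ext (by ext x; simp)
      right_inv := fun π => Subtype.ext (by ext x; simp) }
  rw [surjSum, ← E.tsum_eq, surjSum]
  refine tsum_congr fun π => ?_
  exact congrArg φ (genRank_ker_comp_equiv ℓ π.1 e)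

theorem surjSum_rep (φ : ℕ → ℝ≥0∞) (H X : BEG ℓ n) :
    surjSum φ H.cls.rep X = surjSum φ H X :=
  surjSum_congr φ H.iso_rep_cls X

/-- Morphisms from a quotient. -/
def surjQuotientEquiv (H X : BEG ℓ n) (N : AddSubgroup H.carrier) :
    {π : BEG.Surj H X // N ≤ π.1.ker} ≃ BEG.Surj (H.quotient N) X where
  toFun π := ⟨QuotientAddGroup.lift N π.1.1 π.2, by
      have hc : (QuotientAddGroup.lift N π.1.1 π.2).comp (QuotientAddGroup.mk' N) = π.1.1 := by
        ext x; rfl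
      have h := π.1.2.1
      refine ⟨?_, ?_⟩
      · rw [← h.1]
        conv_rhs => rw [← hc]
        exact (DFunLike.congr_fun (TensorProduct.map_comp (R := ℤ)
          (QuotientAddGroup.lift N π.1.1 π.2).toIntLinearMap
          (QuotientAddGroup.lift N π.1.1 π.2).toIntLinearMap
          (QuotientAddGroup.mk' N).toIntLinearMap
          (QuotientAddGroup.mk' N).toIntLinearMap) H.ω).symm
      · rw [← h.2]; rfl, fun y => by
      obtain ⟨x, hx⟩ := π.1.2.2 y
      exact ⟨QuotientAddGroup.mk' N x, hx⟩⟩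
  invFun π := ⟨⟨π.1.comp (QuotientAddGroup.mk' N), π.2.1.comp ⟨rfl, rfl⟩,
      π.2.2.comp (QuotientAddGroup.mk'_surjective N)⟩, fun x hx => by
      have h0 : QuotientAddGroup.mk' N x = 0 := (QuotientAddGroup.eq_zero_iff x).2 hx
      change π.1 (QuotientAddGroup.mk' N x) = 0
      rw [h0]
      exact map_zero π.1⟩
  left_inv π := Subtype.ext (Subtype.ext (by ext x; rfl))
  right_inv π := Subtype.ext (by
    refine QuotientAddGroup.addMonoidHom_ext _ ?_
    ext x; rfl)

theorem ker_surjQuotientEquiv (H X : BEG ℓ n) (N : AddSubgroup H.carrier)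
    (π : {π : BEG.Surj H X // N ≤ π.1.ker}) :
    (surjQuotientEquiv H X N π).1.ker = π.1.1.ker.map (QuotientAddGroup.mk' N) := by
  ext y
  obtain ⟨x, rfl⟩ := QuotientAddGroup.mk'_surjective N y
  constructor
  · intro h
    exact ⟨x, h, rfl⟩
  · rintro ⟨x', hx', h⟩
    rw [← h]
    exact hx'

/-- A surjection from H/⟨h⟩ is a surjection π from H with h ∈ ker π; exchanging the two sums lets h
run over ker π. -/
theorem tsum_surjSum_quotient (φ : ℕ → ℝ≥0∞) (H X : BEG ℓ n) :
    ∑' h : H.carrier, surjSum φ (H.quotient (AddSubgroup.zmultiples h)) X =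
      ∑' π : BEG.Surj H X, ∑' h : π.1.ker,
        φ (genRank ℓ (π.1.ker.map (QuotientAddGroup.mk' (AddSubgroup.zmultiples (h : H.carrier))))) := by
  classical
  have h1 : ∀ h : H.carrier, surjSum φ (H.quotient (AddSubgroup.zmultiples h)) X =
      ∑' π : BEG.Surj H X, ({h | h ∈ π.1.ker} : Set H.carrier).indicator (fun h =>
        φ (genRank ℓ (π.1.ker.map (QuotientAddGroup.mk' (AddSubgroup.zmultiples h))))) h := by
    intro h
    rw [surjSum, ← (surjQuotientEquiv H X _).tsum_eq]
    simp_rw [ker_surjQuotientEquiv]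
    have := tsum_subtype {π : BEG.Surj H X | AddSubgroup.zmultiples h ≤ π.1.ker} (fun π =>
      φ (genRank ℓ (π.1.ker.map (QuotientAddGroup.mk' (AddSubgroup.zmultiples h)))))
    refine this.trans (tsum_congr fun π => ?_)
    simp only [Set.indicator_apply, Set.mem_ofPred_eq, AddSubgroup.zmultiples_le]
  simp_rw [h1]
  rw [ENNReal.tsum_comm]
  refine tsum_congr fun π => ?_
  exact (tsum_subtype {h : H.carrier | h ∈ π.1.ker} _).symm

theorem card_ker_mul_card (H X : BEG ℓ n) (π : BEG.Surj H X) :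
    Nat.card π.1.ker * Nat.card X.carrier = Nat.card H.carrier := by
  rw [← AddSubgroup.card_mul_index π.1.ker, AddSubgroup.index_ker,
    AddMonoidHom.range_eq_top.2 π.2.2, AddSubgroup.card_top]

/-- The division by |H| in Q meets the factor |ker π| produced by the averaging rule, and |ker
π|/|H| = 1/|X| does not depend on H. -/
theorem lintegral_surjSum_quotientMeasure {φ φ' : ℕ → ℝ≥0∞} (X : BEG ℓ n)
    (hφ : ∀ (H : BEG ℓ n) (K : AddSubgroup H.carrier),
      ∑' h : K, φ (genRank ℓ (K.map (QuotientAddGroup.mk' (AddSubgroup.zmultiples (h : H.carrier))))) =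
        Nat.card K * φ' (genRank ℓ K)) (ν : Measure (BEGClass ℓ n)) :
    ∫⁻ c, surjSum φ c.rep X ∂(quotientMeasure ℓ n ν) =
      (Nat.card X.carrier : ℝ≥0∞)⁻¹ * ∫⁻ c, surjSum φ' c.rep X ∂ν := by
  rw [lintegral_quotientMeasure, ← lintegral_const_mul _ (measurable_of_countable _)]
  refine lintegral_congr fun c => ?_
  simp_rw [surjSum_rep, tsum_surjSum_quotient, hφ]
  rw [surjSum, ← ENNReal.tsum_mul_left, ENNReal.div_eq_inv_mul, ← ENNReal.tsum_mul_left]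
  refine tsum_congr fun π => ?_
  rw [← mul_assoc]
  congr 1
  rw [← card_ker_mul_card c.rep X π]
  have h0 : (Nat.card π.1.ker : ℝ≥0∞) ≠ 0 := Nat.cast_ne_zero.2 Nat.card_pos.ne'
  push_cast
  rw [ENNReal.mul_inv (Or.inl h0) (Or.inl (by simp)), mul_comm, ← mul_assoc,
    ENNReal.mul_inv_cancel h0 (by simp), one_mul]

/-- The averaging rule in the hypothesis holds for two families of weights: the c_t, which lead to
point masses, and the constant 1, which leads to moments. -/
theorem lintegral_surjSum_iterate (X : BEG ℓ n) (φ : ℕ → ℕ → ℝ≥0∞)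
    (hφ : ∀ (t : ℕ) (H : BEG ℓ n) (K : AddSubgroup H.carrier),
      ∑' h : K, φ t (genRank ℓ (K.map (QuotientAddGroup.mk' (AddSubgroup.zmultiples (h : H.carrier))))) =
        Nat.card K * φ (t + 1) (genRank ℓ K)) (t : ℕ) (ν : Measure (BEGClass ℓ n)) :
    ∫⁻ c, surjSum (φ 0) c.rep X ∂((quotientMeasure ℓ n)^[t] ν) =
      ((Nat.card X.carrier : ℝ≥0∞) ^ t)⁻¹ * ∫⁻ c, surjSum (φ t) c.rep X ∂ν := by
  induction t generalizing ν with
  | zero => simp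
  | succ t ih =>
    rw [Function.iterate_succ_apply, ih, lintegral_surjSum_quotientMeasure X (hφ t), ← mul_assoc,
      pow_succ, ENNReal.mul_inv (Or.inr (by simp)) (Or.inr (by
        simp [Nat.card_eq_zero, Finite.not_infinite]))]

theorem moment_eq_surjSum (ν : Measure (BEGClass ℓ n)) (X : BEG ℓ n) :
    moment ν X = ∫⁻ c, surjSum (fun _ => 1) c.rep X ∂ν :=
  lintegral_congr fun _ => natCast_card_eq_tsum _

theorem moment_iterate (t : ℕ) (ν : Measure (BEGClass ℓ n)) (X : BEG ℓ n) :
    moment ((quotientMeasure ℓ n)^[t] ν) X =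
      ((Nat.card X.carrier : ℝ≥0∞) ^ t)⁻¹ * moment ν X := by
  simp_rw [moment_eq_surjSum]
  exact lintegral_surjSum_iterate X (fun _ _ => 1)
    (fun _ H K => by rw [mul_one, ← natCast_card_eq_tsum]) t ν

/-- The weights `c_t` as extended nonnegative reals. -/
def surjWeightENN (ℓ t d : ℕ) : ℝ≥0∞ := ENNReal.ofReal (surjWeight (ℓ : ℝ)⁻¹ t d)

theorem surjWeight_inv_nonneg (t d : ℕ) : 0 ≤ surjWeight (ℓ : ℝ)⁻¹ t d :=
  surjWeight_nonneg (by positivity) (inv_le_one_of_one_le₀ (by exact_mod_cast hp.out.one_lt.le)) t d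

theorem surjWeightENN_zero (d : ℕ) : surjWeightENN ℓ 0 d = if d = 0 then 1 else 0 := by
  rw [surjWeightENN]
  rcases Nat.eq_zero_or_pos d with h | h
  · simp [h, surjWeight_zero]
  · rw [surjWeight_eq_zero h, if_neg h.ne', ENNReal.ofReal_zero]

/-- Nakayama: if K = ℓK, then K = ℓ^e K for all e, and a large power of ℓ kills H. -/
theorem genRank_ker_eq_zero_iff {H X : BEG ℓ n} (π : BEG.Surj H X) :
    genRank ℓ π.1.ker = 0 ↔ Function.Injective π.1 := by
  rw [← AddMonoidHom.ker_eq_bot_iff]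
  constructor
  · intro h
    have h1 := relIndex_eq_pow_genRank H.isPGroup π.1.ker
    rw [h, pow_zero, AddSubgroup.relIndex_eq_one] at h1
    obtain ⟨e, he⟩ := exists_forall_pow_nsmul_eq_zero H.isPGroup
    have h2 : ∀ (k : ℕ) (x), x ∈ π.1.ker → ∃ y ∈ π.1.ker, x = ℓ ^ k • y := by
      intro k
      induction k with
      | zero => exact fun x hx => ⟨x, hx, by simp⟩
      | succ k ih =>
        intro x hx
        obtain ⟨y, hy, rfl⟩ := h1 hx
        obtain ⟨z, hz, rfl⟩ := ih y hy
        exact ⟨z, hz, by rw [pow_succ', mul_nsmul']; rfl⟩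
    rw [eq_bot_iff]
    intro x hx
    obtain ⟨y, -, rfl⟩ := h2 e x hx
    exact he y
  · intro h
    rw [h, genRank, AddSubgroup.relIndex_bot_right]
    simp

theorem surjSum_zero_of_iso {H X : BEG ℓ n} (h : BEG.Iso H X) :
    surjSum (surjWeightENN ℓ 0) H X = Nat.card X.Aut := by
  rw [surjSum_congr _ h]
  let E : BEG.Aut X ≃ BEG.Surj X X :=
    Equiv.ofBijective (fun e => ⟨e.1.toAddMonoidHom, e.2, e.1.surjective⟩) ⟨fun e e' hee => by
      refine Subtype.ext (AddEquiv.ext fun x => ?_)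
      exact DFunLike.congr_fun (congrArg Subtype.val hee) x, fun π => by
      refine ⟨⟨AddEquiv.ofBijective π.1 ⟨Finite.injective_iff_surjective.2 π.2.2, π.2.2⟩, π.2.1⟩, ?_⟩
      rfl⟩
  rw [natCast_card_eq_tsum, surjSum, ← E.tsum_eq]
  refine tsum_congr fun e => ?_
  rw [surjWeightENN_zero, if_pos]
  exact (genRank_ker_eq_zero_iff _).2 e.1.injective

theorem surjSum_zero_of_not_iso {H X : BEG ℓ n} (h : ¬ BEG.Iso H X) :
    surjSum (surjWeightENN ℓ 0) H X = 0 := by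
  rw [surjSum, ENNReal.tsum_eq_zero]
  intro π
  rw [surjWeightENN_zero, if_neg]
  intro h0
  exact h ⟨AddEquiv.ofBijective π.1 ⟨(genRank_ker_eq_zero_iff π).1 h0, π.2.2⟩, π.2.1⟩

theorem card_aut_ne_zero (X : BEG ℓ n) : Nat.card X.Aut ≠ 0 := by
  have : Nonempty X.Aut := ⟨⟨AddEquiv.refl _, BEG.IsHom.id X⟩⟩
  exact Nat.card_pos.ne'

theorem card_carrier_ne_zero (X : BEG ℓ n) : Nat.card X.carrier ≠ 0 := Nat.card_pos.ne'

/-- The weight c_0 is the indicator of rank 0, so only isomorphisms are counted, and the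
isomorphisms to X from a group of its class are as many as the automorphisms of X. -/
theorem lintegral_surjSum_zero (ν : Measure (BEGClass ℓ n)) (X : BEG ℓ n) :
    ∫⁻ c, surjSum (surjWeightENN ℓ 0) c.rep X ∂ν = Nat.card X.Aut * ν {X.cls} := by
  rw [← lintegral_indicator_const (MeasurableSet.singleton _)]
  refine lintegral_congr fun c => ?_
  by_cases h : c = X.cls
  · rw [h, Set.indicator_of_mem (Set.mem_singleton _), surjSum_zero_of_iso X.iso_rep_cls]
  · rw [Set.indicator_of_notMem (by exact h), surjSum_zero_of_not_iso]
    intro hiso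
    exact h (by rw [← BEG.cls_rep c]; exact BEG.cls_eq_iff.2 hiso)

theorem tsum_surjWeightENN_quotient (t : ℕ) (H : BEG ℓ n) (K : AddSubgroup H.carrier) :
    ∑' h : K, surjWeightENN ℓ t
        (genRank ℓ (K.map (QuotientAddGroup.mk' (AddSubgroup.zmultiples (h : H.carrier))))) =
      Nat.card K * surjWeightENN ℓ (t + 1) (genRank ℓ K) := by
  have := Fintype.ofFinite K
  rw [surjWeightENN, ← ENNReal.ofReal_natCast, ← ENNReal.ofReal_mul (Nat.cast_nonneg _),
    ← sum_surjWeight_quotient H.isPGroup, finsum_eq_sum_of_fintype, tsum_fintype,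
    ENNReal.ofReal_sum_of_nonneg fun _ _ => surjWeight_inv_nonneg _ _]
  rfl

/-- The mass of `X` under `Q^t ν` as an integral over `ν`. -/
theorem quotientMeasure_iterate_singleton (t : ℕ) (ν : Measure (BEGClass ℓ n)) (X : BEG ℓ n) :
    ((quotientMeasure ℓ n)^[t] ν) {X.cls} =
      ((Nat.card X.Aut : ℝ≥0∞) * (Nat.card X.carrier : ℝ≥0∞) ^ t)⁻¹ *
        ∫⁻ c, surjSum (surjWeightENN ℓ t) c.rep X ∂ν := by
  have h := lintegral_surjSum_iterate X (surjWeightENN ℓ) tsum_surjWeightENN_quotient t ν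
  rw [lintegral_surjSum_zero] at h
  have h0 : (Nat.card X.Aut : ℝ≥0∞) ≠ 0 := Nat.cast_ne_zero.2 (card_aut_ne_zero X)
  rw [ENNReal.mul_inv (Or.inl h0) (Or.inl (by simp)), mul_assoc, ← h, ← mul_assoc,
    ENNReal.inv_mul_cancel h0 (by simp), one_mul]

theorem quotientMeasure_iterate_univ (t : ℕ) (ν : Measure (BEGClass ℓ n)) :
    ((quotientMeasure ℓ n)^[t] ν) Set.univ = ν Set.univ := by
  induction t generalizing ν with
  | zero => rfl
  | succ t ih => rw [Function.iterate_succ_apply, ih, quotientMeasure_univ]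

/-- The mass of `X` under `Q^t` of the Dirac measure at a class `c`. -/
def iterateKernel (t : ℕ) (X : BEG ℓ n) (c : BEGClass ℓ n) : ℝ≥0∞ :=
  ((Nat.card X.Aut : ℝ≥0∞) * (Nat.card X.carrier : ℝ≥0∞) ^ t)⁻¹ *
    surjSum (surjWeightENN ℓ t) c.rep X

/-- The value is the mass of one point under Q^t of a Dirac measure, and Q preserves total mass.
Boundedness is what allows this kernel to be integrated against a weak-* limit. -/
theorem iterateKernel_le_one (t : ℕ) (X : BEG ℓ n) (c : BEGClass ℓ n) :
    iterateKernel t X c ≤ 1 := by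
  have h := quotientMeasure_iterate_singleton t (Measure.dirac c) X
  rw [lintegral_dirac] at h
  rw [iterateKernel, ← h]
  refine (measure_mono (Set.subset_univ _)).trans ?_
  rw [quotientMeasure_iterate_univ, measure_univ]

theorem quotientMeasure_iterate_singleton' (t : ℕ) (ν : Measure (BEGClass ℓ n)) (X : BEG ℓ n) :
    ((quotientMeasure ℓ n)^[t] ν) {X.cls} = ∫⁻ c, iterateKernel t X c ∂ν := by
  rw [quotientMeasure_iterate_singleton, ← lintegral_const_mul _ (measurable_of_countable _)]
  rfl

end Quotient

/-! ### The symplectic lattice -/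

section Lattice

variable {ℓ g : ℕ} [hp : Fact ℓ.Prime]

theorem symp_smul_left (c : ℤ_[ℓ]) (x y : SympLattice ℓ g) : symp (c • x) y = c * symp x y := by
  simp only [symp, Pi.smul_apply, smul_eq_mul, Finset.mul_sum]
  exact Finset.sum_congr rfl fun i _ => by ring

theorem symp_swap (x y : SympLattice ℓ g) : symp x y = -symp y x := by
  simp only [symp, ← Finset.sum_neg_distrib]
  exact Finset.sum_congr rfl fun i _ => by ring

theorem symp_smul_right (c : ℤ_[ℓ]) (x y : SympLattice ℓ g) : symp x (c • y) = c * symp x y := by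
  rw [symp_swap, symp_smul_left, symp_swap y x]; ring

/-- The symplectic pairing as a bilinear form. -/
def sympForm (ℓ g : ℕ) [Fact ℓ.Prime] : LinearMap.BilinForm ℤ_[ℓ] (SympLattice ℓ g) :=
  LinearMap.mk₂ _ symp symp_add_left symp_smul_left symp_add_right symp_smul_right

theorem sympForm_apply (x y : SympLattice ℓ g) : sympForm ℓ g x y = symp x y := rfl

theorem symp_zero_right (y : SympLattice ℓ g) : symp y 0 = 0 :=
  map_zero (sympForm ℓ g y)

theorem symp_sub_right (x y y' : SympLattice ℓ g) : symp x (y - y') = symp x y - symp x y' :=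
  map_sub (sympForm ℓ g x) y y'

theorem symp_sum_left {ι : Type*} (s : Finset ι) (x : ι → SympLattice ℓ g) (y : SympLattice ℓ g) :
    symp (∑ i ∈ s, x i) y = ∑ i ∈ s, symp (x i) y :=
  LinearMap.map_sum₂ (sympForm ℓ g) s x y

theorem symp_sum_right {ι : Type*} (s : Finset ι) (x : ι → SympLattice ℓ g) (y : SympLattice ℓ g) :
    symp y (∑ i ∈ s, x i) = ∑ i ∈ s, symp y (x i) :=
  map_sum (sympForm ℓ g y) x s

theorem symp_single_inl (i : Fin g) (w : SympLattice ℓ g) :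
    symp (Pi.single (Sum.inl i) 1) w = w (Sum.inr i) := by
  rw [symp, Finset.sum_eq_single i]
  · simp
  · intro j _ hj; simp [hj]
  · simp

theorem symp_single_inr (i : Fin g) (w : SympLattice ℓ g) :
    symp (Pi.single (Sum.inr i) 1) w = -w (Sum.inl i) := by
  rw [symp, Finset.sum_eq_single i]
  · simp
  · intro j _ hj; simp [hj]
  · simp

theorem symp_right_ext {w w' : SympLattice ℓ g} (h : ∀ v, symp v w = symp v w') : w = w' := by
  ext i
  rcases i with i | i
  · have := h (Pi.single (Sum.inr i) 1)
    rw [symp_single_inr, symp_single_inr] at this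
    exact neg_injective this
  · have := h (Pi.single (Sum.inl i) 1)
    rwa [symp_single_inl, symp_single_inl] at this

theorem symp_left_ext {w w' : SympLattice ℓ g} (h : ∀ v, symp w v = symp w' v) : w = w' :=
  symp_right_ext fun v => by rw [symp_swap, h, ← symp_swap]

theorem exists_symp_right_eq (φ : SympLattice ℓ g →ₗ[ℤ_[ℓ]] ℤ_[ℓ]) :
    ∃ w, ∀ v, symp v w = φ v := by
  let w : SympLattice ℓ g := Sum.elim (fun i => -φ (Pi.single (Sum.inr i) 1))
    fun i => φ (Pi.single (Sum.inl i) 1)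
  refine ⟨w, fun v => ?_⟩
  have h : (sympForm ℓ g).flip w = φ := by
    refine LinearMap.pi_ext' fun i => LinearMap.ext_ring ?_
    change symp (Pi.single i 1) w = φ (Pi.single i 1)
    rcases i with i | i
    · rw [symp_single_inl]; rfl
    · rw [symp_single_inr]; exact neg_neg _
  exact DFunLike.congr_fun h v

theorem exists_symp_left_eq (φ : SympLattice ℓ g →ₗ[ℤ_[ℓ]] ℤ_[ℓ]) :
    ∃ w, ∀ v, symp w v = φ v := by
  obtain ⟨w, hw⟩ := exists_symp_right_eq φ
  refine ⟨-w, fun v => ?_⟩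
  rw [symp_neg_left, ← symp_swap, hw]

section Dual

variable {κ : Type} [Fintype κ]

/-- The symplectic dual of a basis. -/
def sympDual (b : Module.Basis κ ℤ_[ℓ] (SympLattice ℓ g)) (i : κ) : SympLattice ℓ g :=
  (exists_symp_left_eq (b.coord i)).choose

theorem symp_sympDual (b : Module.Basis κ ℤ_[ℓ] (SympLattice ℓ g)) (i : κ) (v : SympLattice ℓ g) :
    symp (sympDual b i) v = b.repr v i :=
  (exists_symp_left_eq (b.coord i)).choose_spec v

theorem symp_sympDual_basis [DecidableEq κ] (b : Module.Basis κ ℤ_[ℓ] (SympLattice ℓ g)) (i j : κ) :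
    symp (sympDual b i) (b j) = if i = j then 1 else 0 := by
  rw [symp_sympDual, Module.Basis.repr_self, Finsupp.single_apply]
  simp only [eq_comm]

theorem eq_sum_sympDual (b : Module.Basis κ ℤ_[ℓ] (SympLattice ℓ g)) (w : SympLattice ℓ g) :
    w = ∑ j, symp w (b j) • sympDual b j := by
  classical
  have h : sympForm ℓ g w = sympForm ℓ g (∑ j, symp w (b j) • sympDual b j) := by
    refine b.ext fun i => ?_
    rw [sympForm_apply, sympForm_apply, symp_sum_left]
    simp [symp_smul_left, symp_sympDual_basis]
  exact symp_left_ext fun v => DFunLike.congr_fun h v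

theorem eq_sum_basis (b : Module.Basis κ ℤ_[ℓ] (SympLattice ℓ g)) (v : SympLattice ℓ g) :
    v = ∑ i, symp (sympDual b i) v • b i := by
  simp_rw [symp_sympDual]
  exact (b.sum_repr v).symm

end Dual

/-! ### Reduction modulo powers of `ℓ` -/

theorem toZModPow_eq_zero_iff (N : ℕ) (c : ℤ_[ℓ]) :
    PadicInt.toZModPow N c = 0 ↔ (ℓ : ℤ_[ℓ]) ^ N ∣ c := by
  rw [← RingHom.mem_ker, PadicInt.ker_toZModPow, Ideal.mem_span_singleton]

theorem toZModPow_eq_iff (N : ℕ) (c c' : ℤ_[ℓ]) :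
    PadicInt.toZModPow N c = PadicInt.toZModPow N c' ↔ (ℓ : ℤ_[ℓ]) ^ N ∣ c - c' := by
  rw [← sub_eq_zero, ← map_sub, toZModPow_eq_zero_iff]

theorem toZModPow_surjective (N : ℕ) :
    Function.Surjective (PadicInt.toZModPow N : ℤ_[ℓ] →+* ZMod (ℓ ^ N)) := fun a =>
  ⟨(ZMod.cast a : ℤ), by rw [map_intCast, ZMod.intCast_cast, ZMod.cast_id]⟩

theorem padic_prime_ne_zero : (ℓ : ℤ_[ℓ]) ≠ 0 := Nat.cast_ne_zero.2 hp.out.ne_zero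

theorem pow_dvd_smul_iff {κ : Type*} (v : κ → ℤ_[ℓ]) (N : ℕ) :
    (∃ u : κ → ℤ_[ℓ], (ℓ : ℤ_[ℓ]) ^ N • u = v) ↔ ∀ i, (ℓ : ℤ_[ℓ]) ^ N ∣ v i := by
  constructor
  · rintro ⟨u, rfl⟩ i
    exact ⟨u i, rfl⟩
  · intro h
    choose u hu using h
    exact ⟨u, funext fun i => (hu i).symm⟩

theorem exists_pow_smul_eq_iff (v : SympLattice ℓ g) (N : ℕ) :
    (∃ u, (ℓ : ℤ_[ℓ]) ^ N • u = v) ↔ ∀ x, (ℓ : ℤ_[ℓ]) ^ N ∣ symp x v := by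
  constructor
  · rintro ⟨u, rfl⟩ x
    exact ⟨symp x u, by rw [symp_smul_right]⟩
  · intro h
    rw [pow_dvd_smul_iff]
    rintro (i | i)
    · have := h (Pi.single (Sum.inr i) 1)
      rwa [symp_single_inr, dvd_neg] at this
    · have := h (Pi.single (Sum.inl i) 1)
      rwa [symp_single_inl] at this

theorem pow_smul_cancel {N : ℕ} {u u' : SympLattice ℓ g}
    (h : (ℓ : ℤ_[ℓ]) ^ N • u = (ℓ : ℤ_[ℓ]) ^ N • u') : u = u' :=
  smul_right_injective _ (pow_ne_zero N padic_prime_ne_zero) h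

/-- Every character of the lattice is given by the symplectic pairing. -/
theorem exists_symp_char (N : ℕ) (χ : SympLattice ℓ g →+ ZMod (ℓ ^ N)) :
    ∃ w, ∀ v, χ v = PadicInt.toZModPow N (symp v w) := by
  choose c hc using fun i => toZModPow_surjective N (χ (Pi.single i 1))
  obtain ⟨w, hw⟩ := exists_symp_right_eq ((Pi.basisFun ℤ_[ℓ] (Fin g ⊕ Fin g)).constr ℤ_[ℓ] c)
  refine ⟨w, fun v => ?_⟩
  have he : ∀ x : ZMod (ℓ ^ N), ℓ ^ N • x = 0 := fun x => ZModModule.char_nsmul_eq_zero _ x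
  have hv : v = ∑ i, v i • (Pi.single i 1 : SympLattice ℓ g) := by
    ext j; simp [Finset.sum_apply, Pi.single_apply]
  conv_lhs => rw [hv]
  rw [map_sum]
  simp_rw [map_padic_smul he]
  rw [hw, Module.Basis.constr_apply_fintype, map_sum]
  refine Finset.sum_congr rfl fun i _ => ?_
  rw [← hc]
  simp only [smul_eq_mul, map_mul, nsmul_eq_mul, Pi.basisFun_equivFun, LinearEquiv.refl_apply]
  have h := (toZModPow_eq_iff N (v i) ((v i).appr N : ℤ_[ℓ])).2 (by
    rw [← Ideal.mem_span_singleton]; exact PadicInt.appr_spec N (v i))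
  rw [h, map_natCast]

/-! ### Homomorphisms from the lattice to a finite `ℓ`-group -/

theorem exists_latticeHom {H : Type} [AddCommGroup H] [Finite H]
    (hH : ∀ x : H, ∃ k : ℕ, ℓ ^ k • x = 0) {κ : Type} [Fintype κ] [DecidableEq κ] (h : κ → H) :
    ∃ f : (κ → ℤ_[ℓ]) →+ H, ∀ i, f (Pi.single i 1) = h i := by
  choose F hF using fun i => exists_padicHom hH (h i)
  refine ⟨∑ i, (F i).comp (Pi.evalAddMonoidHom _ i), fun i => ?_⟩
  rw [AddMonoidHom.finsetSum_apply, Finset.sum_eq_single i]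
  · simp [hF]
  · intro j _ hj
    simp [hj]
  · simp

theorem latticeHom_ext {H : Type} [AddCommGroup H] [Finite H]
    (hH : ∀ x : H, ∃ k : ℕ, ℓ ^ k • x = 0) {κ : Type} [Fintype κ] [DecidableEq κ]
    {f f' : (κ → ℤ_[ℓ]) →+ H} (h : ∀ i, f (Pi.single i 1) = f' (Pi.single i 1)) : f = f' := by
  obtain ⟨e, he⟩ := exists_forall_pow_nsmul_eq_zero hH
  refine AddMonoidHom.ext fun v => ?_
  have hv : v = ∑ i, v i • (Pi.single i 1 : κ → ℤ_[ℓ]) := by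
    ext j; simp [Finset.sum_apply, Pi.single_apply]
  rw [hv, map_sum, map_sum]
  simp_rw [map_padic_smul he, h]

/-- A homomorphism from `ℤ_ℓ^κ` to a finite `ℓ`-group is given by the images of the basis. -/
def latticeHomEquiv {H : Type} [AddCommGroup H] [Finite H]
    (hH : ∀ x : H, ∃ k : ℕ, ℓ ^ k • x = 0) (κ : Type) [Fintype κ] [DecidableEq κ] :
    ((κ → ℤ_[ℓ]) →+ H) ≃ (κ → H) :=
  Equiv.ofBijective (fun f i => f (Pi.single i 1)) ⟨fun _ _ h => latticeHom_ext hH fun i =>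
    congrFun h i, fun h => by
    obtain ⟨f, hf⟩ := exists_latticeHom hH h
    exact ⟨f, funext hf⟩⟩

/-! ### Adapted bases -/

/-- Smith normal form for an arbitrary submodule. -/
theorem exists_basis_mem_iff {κ : Type} [Fintype κ]
    (b₀ : Module.Basis κ ℤ_[ℓ] (SympLattice ℓ g)) (N : Submodule ℤ_[ℓ] (SympLattice ℓ g)) :
    ∃ (b : Module.Basis κ ℤ_[ℓ] (SympLattice ℓ g)) (a : κ → ℤ_[ℓ]),
      ∀ v, v ∈ N ↔ ∀ i, a i ∣ b.repr v i := by
  classical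
  obtain ⟨m, bM, bN, φ, a, snf⟩ := N.smithNormalForm b₀
  -- Coordinates that do not occur in the submodule get the coefficient 0: divisibility by 0 forces
  -- them to vanish.
  obtain ⟨a', ha, ha0⟩ : ∃ a' : κ → ℤ_[ℓ], (∀ j, a' (φ j) = a j) ∧ ∀ i, (¬ ∃ j, φ j = i) → a' i = 0 :=
    ⟨Function.extend φ a (fun _ => 0), fun j => φ.injective.extend_apply a _ j,
      fun i hi => Function.extend_apply' a _ i hi⟩
  refine ⟨bM, a', fun v => ?_⟩
  constructor
  · intro hv i
    by_cases h : ∃ j, φ j = i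
    · obtain ⟨j, rfl⟩ := h
      rw [ha]
      have := Module.Basis.SmithNormalForm.repr_apply_embedding_eq_repr_smul
        (snf := ⟨bM, bN, φ, a, snf⟩) (m := ⟨v, hv⟩) (i := j)
      exact ⟨bN.repr ⟨v, hv⟩ j, by rw [map_smul] at this; exact this⟩
    · have := Module.Basis.SmithNormalForm.repr_eq_zero_of_notMem_range
        (snf := ⟨bM, bN, φ, a, snf⟩) (m := ⟨v, hv⟩) (i := i) (by rintro ⟨j, hj⟩; exact h ⟨j, hj⟩)
      rw [ha0 i h]
      exact ⟨0, by simpa using this⟩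
  · intro h
    rw [← bM.sum_repr v]
    refine Submodule.sum_mem _ fun i _ => ?_
    obtain ⟨c, hc⟩ := h i
    rw [hc]
    by_cases h' : ∃ j, φ j = i
    · obtain ⟨j, rfl⟩ := h'
      rw [ha, mul_comm, mul_smul, ← snf]
      exact N.smul_mem _ (bN j).2
    · rw [ha0 i h', zero_mul, zero_smul]
      exact N.zero_mem

theorem exists_dvd_iff_pow_dvd {a : ℤ_[ℓ]} (ha : a ≠ 0) :
    ∃ k : ℕ, ∀ c : ℤ_[ℓ], a ∣ c ↔ (ℓ : ℤ_[ℓ]) ^ k ∣ c := by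
  refine ⟨a.valuation, fun c => ?_⟩
  conv_lhs => rw [PadicInt.unitCoeff_spec ha]
  rw [IsUnit.mul_left_dvd (Units.isUnit _)]

/-- The kernel of a homomorphism to a finite `ℓ`-group, as a submodule. -/
def kerSubmodule {V : Type*} [AddCommGroup V] [Module ℤ_[ℓ] V] {H : Type} [AddCommGroup H] {e : ℕ}
    (he : ∀ x : H, ℓ ^ e • x = 0) (f : V →+ H) : Submodule ℤ_[ℓ] V where
  carrier := {v | f v = 0}
  add_mem' := fun {a b} ha hb => by
    change f (a + b) = 0
    rw [map_add, show f a = 0 from ha, show f b = 0 from hb, add_zero]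
  zero_mem' := map_zero f
  smul_mem' := fun c v hv => by
    change f (c • v) = 0
    rw [map_padic_smul he, show f v = 0 from hv, smul_zero]

/-- A basis `b` of the lattice such that the kernel of `f` has the basis `ℓ^{k_i} b_i`, with
increasing exponents. -/
structure AdaptedBasis {H : Type} [AddCommGroup H] (f : SympLattice ℓ g →+ H) where
  b : Module.Basis (Fin (g + g)) ℤ_[ℓ] (SympLattice ℓ g)
  k : Fin (g + g) → ℕ
  mono : Monotone k
  map_eq_zero_iff : ∀ v, f v = 0 ↔ ∀ i, (ℓ : ℤ_[ℓ]) ^ k i ∣ symp (sympDual b i) v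

/-- Smith normal form of ker f. No elementary divisor vanishes because ker f contains ℓ^e times the
lattice, so each may be replaced by a power of ℓ; sorting the exponents makes them monotone. -/
theorem nonempty_adaptedBasis {H : Type} [AddCommGroup H] [Finite H]
    (hH : ∀ x : H, ∃ k : ℕ, ℓ ^ k • x = 0) (f : SympLattice ℓ g →+ H) :
    Nonempty (AdaptedBasis f) := by
  obtain ⟨e, he⟩ := exists_forall_pow_nsmul_eq_zero hH
  obtain ⟨b, a, hba⟩ := exists_basis_mem_iff
    ((Pi.basisFun ℤ_[ℓ] (Fin g ⊕ Fin g)).reindex finSumFinEquiv) (kerSubmodule he f)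
  have ha : ∀ i, a i ≠ 0 := by
    intro i h0
    have h1 : (ℓ : ℤ_[ℓ]) ^ e • b i ∈ kerSubmodule he f := map_padic_pow_smul he f _
    have h2 := (hba _).1 h1 i
    rw [h0, zero_dvd_iff] at h2
    rw [map_smul, Module.Basis.repr_self, Finsupp.smul_single, Finsupp.single_eq_same, smul_eq_mul,
      mul_one] at h2
    exact pow_ne_zero e padic_prime_ne_zero h2
  choose k hk using fun i => exists_dvd_iff_pow_dvd (ha i)
  refine ⟨⟨b.reindex (Tuple.sort k).symm, k ∘ Tuple.sort k, Tuple.monotone_sort k, fun v => ?_⟩⟩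
  have h := hba v
  simp_rw [hk] at h
  refine h.trans ?_
  rw [← (Tuple.sort k).forall_congr_right]
  simp only [symp_sympDual, Module.Basis.repr_reindex_apply, Equiv.symm_symm, Function.comp]

end Lattice

/-! ### The class of `c/ℓ^N` in `ℚ/ℤ` -/

section PadicCircle

variable {ℓ : ℕ} [hp : Fact ℓ.Prime]

/-- The class of `c/ℓ^N` in `ℚ_ℓ/ℤ_ℓ ⊆ ℚ/ℤ`. -/
def padicCircle (ℓ : ℕ) [Fact ℓ.Prime] (N : ℕ) : ℤ_[ℓ] →+ AddCircle (1 : ℚ) :=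
  (zmodToCircle (ℓ ^ N)).comp (PadicInt.toZModPow N).toAddMonoidHom

theorem padicCircle_apply (N : ℕ) (c : ℤ_[ℓ]) :
    padicCircle ℓ N c = zmodToCircle (ℓ ^ N) (PadicInt.toZModPow N c) := rfl

theorem padicCircle_eq_zero_iff (N : ℕ) (c : ℤ_[ℓ]) :
    padicCircle ℓ N c = 0 ↔ (ℓ : ℤ_[ℓ]) ^ N ∣ c := by
  have : NeZero (ℓ ^ N) := ⟨pow_ne_zero _ hp.out.ne_zero⟩
  rw [padicCircle_apply, ← toZModPow_eq_zero_iff]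
  exact (injective_iff_map_eq_zero' _).1 (zmodToCircle_injective _) _

theorem padicCircle_eq_iff (N : ℕ) (c c' : ℤ_[ℓ]) :
    padicCircle ℓ N c = padicCircle ℓ N c' ↔ (ℓ : ℤ_[ℓ]) ^ N ∣ c - c' := by
  rw [← sub_eq_zero, ← map_sub, padicCircle_eq_zero_iff]

theorem padicCircle_natCast (N a : ℕ) :
    padicCircle ℓ N (a : ℤ_[ℓ]) = (((a : ℚ) / (ℓ : ℚ) ^ N : ℚ) : AddCircle (1 : ℚ)) := by
  have h := zmodToCircle_intCast (ℓ ^ N) (a : ℤ)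
  rw [padicCircle_apply, map_natCast]
  push_cast at h
  exact h

theorem padicCircle_add_mul (N r : ℕ) (c : ℤ_[ℓ]) :
    padicCircle ℓ (N + r) ((ℓ : ℤ_[ℓ]) ^ r * c) = padicCircle ℓ N c := by
  obtain ⟨c', hc'⟩ := PadicInt.exists_eq_natCast_add c N
  generalize c.appr N = a at hc'
  have h1 : padicCircle ℓ N c = padicCircle ℓ N (a : ℤ_[ℓ]) := by
    rw [padicCircle_eq_iff]
    exact ⟨c', by rw [hc']; ring⟩
  have h2 : padicCircle ℓ (N + r) ((ℓ : ℤ_[ℓ]) ^ r * c) =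
      padicCircle ℓ (N + r) ((ℓ ^ r * a : ℕ) : ℤ_[ℓ]) := by
    rw [padicCircle_eq_iff]
    refine ⟨c', ?_⟩
    rw [hc']
    push_cast
    ring
  rw [h1, h2, padicCircle_natCast, padicCircle_natCast]
  congr 1
  have : (ℓ : ℚ) ≠ 0 := Nat.cast_ne_zero.2 hp.out.ne_zero
  push_cast
  field_simp
  ring

theorem nsmul_padicCircle (N a : ℕ) (c : ℤ_[ℓ]) :
    a • padicCircle ℓ N c = padicCircle ℓ N ((a : ℤ_[ℓ]) * c) := by
  rw [← map_nsmul, nsmul_eq_mul]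

theorem pow_nsmul_padicCircle (N r : ℕ) (c : ℤ_[ℓ]) :
    ℓ ^ r • padicCircle ℓ (N + r) c = padicCircle ℓ N c := by
  rw [nsmul_padicCircle, Nat.cast_pow, padicCircle_add_mul]

end PadicCircle

/-! ### Cokernels -/

section Cokernel

variable {ℓ n g : ℕ} [hp : Fact ℓ.Prime]

open Matrix in
/-- The endomorphism `A = M + ℓ^n` of the lattice. -/
def shifted (n : ℕ) (M : Matrix (Fin g ⊕ Fin g) (Fin g ⊕ Fin g) ℤ_[ℓ]) :
    SympLattice ℓ g →ₗ[ℤ_[ℓ]] SympLattice ℓ g :=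
  (M + (ℓ : ℤ_[ℓ]) ^ n • 1).mulVecLin

theorem shifted_apply (M : Matrix (Fin g ⊕ Fin g) (Fin g ⊕ Fin g) ℤ_[ℓ]) (v : SympLattice ℓ g) :
    shifted n M v = M.mulVec v + (ℓ : ℤ_[ℓ]) ^ n • v := by
  rw [shifted, Matrix.mulVecLin_apply, Matrix.add_mulVec, Matrix.smul_mulVec, Matrix.one_mulVec]

/-- M is anti-self-adjoint and cancels, while ℓ^n is self-adjoint and counts twice. This identity A
+ A* = 2ℓ^n is the source of the term 2ω in the definition of a BEG. -/
theorem symp_shifted_add (M : skewSymplectic ℓ g) (v w : SympLattice ℓ g) :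
    symp (shifted n M.1 v) w + symp v (shifted n M.1 w) = 2 * (ℓ : ℤ_[ℓ]) ^ n * symp v w := by
  have h := M.2 v w
  rw [shifted_apply, shifted_apply, symp_add_left, symp_add_right, h, symp_smul_left,
    symp_smul_right]
  ring

/-- The image of `∑ e_i ∧ f_i` under `f`. -/
def omegaSum {H : Type} [AddCommGroup H] (f : SympLattice ℓ g →+ H) : H ⊗[ℤ] H :=
  ∑ i : Fin g, (f (Pi.single (Sum.inl i) 1) ⊗ₜ[ℤ] f (Pi.single (Sum.inr i) 1) -
    f (Pi.single (Sum.inr i) 1) ⊗ₜ[ℤ] f (Pi.single (Sum.inl i) 1))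

theorem omegaSum_mem {H : Type} [AddCommGroup H] (f : SympLattice ℓ g →+ H) :
    omegaSum f ∈ wedgeSq H :=
  AddSubgroup.sum_mem _ fun _ _ => AddSubgroup.subset_closure ⟨_, _, rfl⟩

theorem mapTensorSq_omegaSum {H H' : Type} [AddCommGroup H] [AddCommGroup H']
    (f : SympLattice ℓ g →+ H) (π : H →+ H') :
    mapTensorSq π (omegaSum f) = omegaSum (π.comp f) := by
  rw [omegaSum, omegaSum, map_sum]
  exact Finset.sum_congr rfl fun i _ => by rw [map_sub]; rfl

/-- ∑ e_i ∧ f_i is the bivector inverse to the symplectic form, so evaluating it on the functionals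
⟨·, a⟩ and ⟨·, b⟩ returns ⟨a, b⟩. -/
theorem tensorPairing_omegaSum {H : Type} [AddCommGroup H] (f : SympLattice ℓ g →+ H) (N : ℕ)
    (α β : H →+ ZMod (ℓ ^ N)) {a b : SympLattice ℓ g}
    (ha : ∀ v, α (f v) = PadicInt.toZModPow N (symp v a))
    (hb : ∀ v, β (f v) = PadicInt.toZModPow N (symp v b)) :
    tensorPairing α β (omegaSum f) = PadicInt.toZModPow N (symp a b) := by
  have h : ∀ x y : H, tensorPairing α β (x ⊗ₜ[ℤ] y) = α x * β y := fun _ _ => rfl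
  rw [omegaSum, map_sum, symp, map_sum]
  refine Finset.sum_congr rfl fun i _ => ?_
  rw [map_sub, h, h, ha, ha, hb, hb, symp_single_inl, symp_single_inr, symp_single_inl,
    symp_single_inr, ← map_mul, ← map_mul, ← map_sub]
  congr 1
  ring

theorem tmul_map_smul {H : Type} [AddCommGroup H] {e : ℕ} (he : ∀ x : H, ℓ ^ e • x = 0)
    (f : SympLattice ℓ g →+ H) (c : ℤ_[ℓ]) (v w : SympLattice ℓ g) :
    f (c • v) ⊗ₜ[ℤ] f w = f v ⊗ₜ[ℤ] f (c • w) := by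
  rw [map_padic_smul he, map_padic_smul he]
  exact TensorProduct.smul_tmul (R := ℤ) (c.appr e) (f v) (f w)

/-- For ω = ∑ E_j ⊗ E'_j with dual bases E and E', the identity A + A* = 2ℓ^n yields (A ⊗ 1 + 1 ⊗ A)
ω = 2ℓ^n ω. The map f kills the image of A, and 2 is invertible because ℓ is odd. -/
theorem pow_smul_omegaSum (hℓ : ℓ ≠ 2) {H : Type} [AddCommGroup H] {e : ℕ}
    (he : ∀ x : H, ℓ ^ e • x = 0) (M : skewSymplectic ℓ g) (f : SympLattice ℓ g →+ H)
    (hf : ∀ y, f (shifted n M.1 y) = 0) : ℓ ^ n • omegaSum f = 0 := by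
  let E : Fin g ⊕ Fin g → SympLattice ℓ g := fun j => Pi.single j 1
  -- The signs are chosen so that ⟨v, E'_j⟩ is the j-th coordinate of v.
  let E' : Fin g ⊕ Fin g → SympLattice ℓ g :=
    Sum.elim (fun i => Pi.single (Sum.inr i) 1) fun i => -Pi.single (Sum.inl i) 1
  have hE : ∀ v, v = ∑ j, symp v (E' j) • E j := by
    intro v
    have : ∀ j, symp v (E' j) = v j := by
      rintro (i | i)
      · rw [symp_swap]
        change -symp (Pi.single (Sum.inr i) 1) v = _
        rw [symp_single_inr, neg_neg]
      · change symp v (-Pi.single (Sum.inl i) 1) = _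
        rw [symp_neg_right, ← symp_swap, symp_single_inl]
    ext j
    simp only [this]
    simp [E, Finset.sum_apply, Pi.single_apply]
  have hE' : ∀ v, v = ∑ j, symp (E j) v • E' j := by
    intro v
    refine symp_right_ext fun w => ?_
    conv_lhs => rw [hE w]
    rw [symp_sum_left, symp_sum_right]
    refine Finset.sum_congr rfl fun j _ => ?_
    rw [symp_smul_left, symp_smul_right, mul_comm]
  have hω : omegaSum f = ∑ j, f (E j) ⊗ₜ[ℤ] f (E' j) := by
    rw [Fintype.sum_sum_type, ← Finset.sum_add_distrib]
    refine Finset.sum_congr rfl fun i _ => ?_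
    change _ = f (Pi.single (Sum.inl i) 1) ⊗ₜ[ℤ] f (Pi.single (Sum.inr i) 1) +
      f (Pi.single (Sum.inr i) 1) ⊗ₜ[ℤ] f (-Pi.single (Sum.inl i) 1)
    rw [map_neg, TensorProduct.tmul_neg, sub_eq_add_neg]
  have h2 : (2 * ℓ ^ n) • omegaSum f = 0 := by
    calc (2 * ℓ ^ n) • omegaSum f
        = ∑ i, f (E i) ⊗ₜ[ℤ] f ((2 * (ℓ : ℤ_[ℓ]) ^ n) • E' i - shifted n M.1 (E' i)) := by
          rw [hω, Finset.smul_sum]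
          refine Finset.sum_congr rfl fun i _ => ?_
          rw [map_sub, hf, sub_zero, ← TensorProduct.tmul_smul, ← map_nsmul,
            ← Nat.cast_smul_eq_nsmul ℤ_[ℓ]]
          push_cast
          rfl
      _ = ∑ i, ∑ j, f (E i) ⊗ₜ[ℤ] f (symp (shifted n M.1 (E j)) (E' i) • E' j) := by
          refine Finset.sum_congr rfl fun i _ => ?_
          rw [← TensorProduct.tmul_sum, ← map_sum]
          congr 2
          rw [hE' ((2 * (ℓ : ℤ_[ℓ]) ^ n) • E' i - shifted n M.1 (E' i))]
          refine Finset.sum_congr rfl fun j _ => ?_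
          rw [symp_sub_right, symp_smul_right, ← symp_shifted_add M, add_sub_cancel_right]
      _ = ∑ j, ∑ i, f (symp (shifted n M.1 (E j)) (E' i) • E i) ⊗ₜ[ℤ] f (E' j) := by
          rw [Finset.sum_comm]
          simp_rw [tmul_map_smul he]
      _ = 0 := by
          refine Finset.sum_eq_zero fun j _ => ?_
          rw [← TensorProduct.sum_tmul, ← map_sum, ← hE, hf, TensorProduct.zero_tmul]
  have h3 : ℓ ^ e • omegaSum f = 0 := by
    generalize omegaSum f = z
    induction z with
    | zero => simp
    | tmul x y =>
      rw [TensorProduct.smul_tmul', he, TensorProduct.zero_tmul]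
    | add a b ha hb => rw [smul_add, ha, hb, add_zero]
  have hc : Nat.Coprime 2 (ℓ ^ e) := by
    refine Nat.Coprime.pow_right e ?_
    rw [Nat.coprime_primes Nat.prime_two hp.out]
    exact fun h => hℓ h.symm
  have h4 : addOrderOf (ℓ ^ n • omegaSum f) ∣ Nat.gcd 2 (ℓ ^ e) := by
    refine Nat.dvd_gcd ?_ ?_
    · rw [addOrderOf_dvd_iff_nsmul_eq_zero, smul_smul, h2]
    · rw [addOrderOf_dvd_iff_nsmul_eq_zero, smul_comm, h3, smul_zero]
  rw [hc.gcd_eq_one, Nat.dvd_one, AddMonoid.addOrderOf_eq_one_iff] at h4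
  exact h4

/-- `f : ℤ_ℓ^{2g} → X` induces a morphism of BEGs from the cokernel of `M + ℓ^n`. -/
structure IsPush (M : Matrix (Fin g ⊕ Fin g) (Fin g ⊕ Fin g) ℤ_[ℓ]) (X : BEG ℓ n)
    (f : SympLattice ℓ g →+ X.carrier) : Prop where
  map_shifted : ∀ y, f (shifted n M y) = 0
  omega_eq : X.ω = omegaSum f
  psi_eq : ∀ (γ : Tors (DualGroup X.carrier) (ℓ ^ n)) (w u : SympLattice ℓ g),
    (∀ x, (γ : DualGroup X.carrier) (f x) = padicCircle ℓ n (symp x w)) →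
    (ℓ : ℤ_[ℓ]) ^ n • u = shifted n M w → (X.ψ γ : X.carrier) = f u

theorem isCokernelBEG_iff (M : Matrix (Fin g ⊕ Fin g) (Fin g ⊕ Fin g) ℤ_[ℓ]) (X : BEG ℓ n) :
    IsCokernelBEG M X ↔ ∃ f : SympLattice ℓ g →+ X.carrier, Function.Surjective f ∧
      IsPush M X f ∧ ∀ x, f x = 0 → ∃ y, x = shifted n M y := by
  constructor
  · rintro ⟨f, h1, h2, h3, h4⟩
    exact ⟨f, h1, ⟨fun y => (h2 _).2 ⟨y, rfl⟩, h3, h4⟩, fun x hx => (h2 x).1 hx⟩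
  · rintro ⟨f, h1, h2, h3⟩
    exact ⟨f, h1, fun x => ⟨fun hx => h3 x hx, by rintro ⟨y, rfl⟩; exact h2.map_shifted y⟩,
      h2.omega_eq, h2.psi_eq⟩

theorem exists_char_lift {H : Type} [AddCommGroup H] (f : SympLattice ℓ g →+ H) {N : ℕ}
    {γ : DualGroup H} (hγ : ℓ ^ N • γ = 0) :
    ∃ w, ∀ x, γ (f x) = padicCircle ℓ N (symp x w) := by
  have : NeZero (ℓ ^ N) := ⟨pow_ne_zero _ hp.out.ne_zero⟩
  obtain ⟨α, rfl⟩ := exists_toChar_eq (ℓ ^ N) hγ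
  obtain ⟨w, hw⟩ := exists_symp_char N (α.comp f)
  exact ⟨w, fun x => congrArg (zmodToCircle (ℓ ^ N)) (hw x)⟩

/-- Modulo ℓ^n the adjoint of A is -A, so Aw is divisible by ℓ^n as soon as the functional ⟨A·, w⟩
is. This makes ψ_M(⟨·, w⟩/ℓ^n) = Aw/ℓ^n an integral class. -/
theorem exists_shifted_div (M : skewSymplectic ℓ g) {w : SympLattice ℓ g}
    (hw : ∀ y, (ℓ : ℤ_[ℓ]) ^ n ∣ symp (shifted n M.1 y) w) :
    ∃ u, (ℓ : ℤ_[ℓ]) ^ n • u = shifted n M.1 w := by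
  rw [exists_pow_smul_eq_iff]
  intro x
  have h := symp_shifted_add (n := n) M x w
  rw [← eq_sub_iff_add_eq'] at h
  rw [h]
  exact dvd_sub ⟨2 * symp x w, by ring⟩ (hw x)

theorem exists_shifted_div_of_char (M : skewSymplectic ℓ g) {H : Type} [AddCommGroup H]
    {f : SympLattice ℓ g →+ H} (hf : ∀ y, f (shifted n M.1 y) = 0) {γ : DualGroup H}
    {w : SympLattice ℓ g} (hw : ∀ x, γ (f x) = padicCircle ℓ n (symp x w)) :
    ∃ u, (ℓ : ℤ_[ℓ]) ^ n • u = shifted n M.1 w := by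
  refine exists_shifted_div M fun y => ?_
  rw [← padicCircle_eq_zero_iff, ← hw, hf, map_zero]

theorem IsPush.comp {M : Matrix (Fin g ⊕ Fin g) (Fin g ⊕ Fin g) ℤ_[ℓ]} {H X : BEG ℓ n}
    {f : SympLattice ℓ g →+ H.carrier} (hf : IsPush M H f) {π : H.carrier →+ X.carrier}
    (hπ : BEG.IsHom H X π) : IsPush M X (π.comp f) where
  map_shifted y := by rw [AddMonoidHom.comp_apply, hf.map_shifted, map_zero]
  omega_eq := by rw [← hπ.1, hf.omega_eq, mapTensorSq_omegaSum]
  psi_eq γ w u hw hu := by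
    rw [← hπ.2]
    exact congrArg π (hf.psi_eq (dualTors π (ℓ ^ n) γ) w u hw hu)

/-- Every ℓ^n-torsion character of X lifts to a vector w for which Aw/ℓ^n is integral, so the
push-forward conditions determine ψ completely. -/
theorem IsPush.isHom {M : skewSymplectic ℓ g} {H X : BEG ℓ n}
    {f : SympLattice ℓ g →+ H.carrier} (hf : IsPush M.1 H f) {π : H.carrier →+ X.carrier}
    (hπ : IsPush M.1 X (π.comp f)) : BEG.IsHom H X π := by
  refine ⟨?_, ?_⟩
  · rw [hf.omega_eq, hπ.omega_eq, mapTensorSq_omegaSum]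
  · ext γ
    obtain ⟨w, hw⟩ := exists_char_lift (π.comp f) (mem_Tors.1 γ.2)
    obtain ⟨u, hu⟩ := exists_shifted_div_of_char M hπ.map_shifted hw
    rw [hπ.psi_eq γ w u hw hu]
    exact congrArg π (hf.psi_eq (dualTors π (ℓ ^ n) γ) w u hw hu)

/-- Surjective morphisms from the cokernel of `M + ℓ^n`. -/
def surjEquivPush {M : skewSymplectic ℓ g} {H : BEG ℓ n} {f : SympLattice ℓ g →+ H.carrier}
    (hs : Function.Surjective f) (hf : IsPush M.1 H f)
    (hker : ∀ x, f x = 0 → ∃ y, x = shifted n M.1 y) (X : BEG ℓ n) :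
    BEG.Surj H X ≃
      {f' : SympLattice ℓ g →+ X.carrier // Function.Surjective f' ∧ IsPush M.1 X f'} :=
  Equiv.ofBijective (fun π => ⟨π.1.comp f, π.2.2.comp hs, hf.comp π.2.1⟩) ⟨fun π π' h => by
    refine Subtype.ext (AddMonoidHom.ext fun x => ?_)
    obtain ⟨v, rfl⟩ := hs x
    exact DFunLike.congr_fun (congrArg Subtype.val h) v, fun f' => by
    have hle : f.ker ≤ f'.1.ker := fun x hx => by
      obtain ⟨y, rfl⟩ := hker x hx
      exact f'.2.2.map_shifted y
    have hcomp : (f.liftOfSurjective hs ⟨f'.1, hle⟩).comp f = f'.1 :=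
      AddMonoidHom.liftOfRightInverse_comp f _ (Function.rightInverse_surjInv hs) ⟨f'.1, hle⟩
    refine ⟨⟨f.liftOfSurjective hs ⟨f'.1, hle⟩, hf.isHom (by rw [hcomp]; exact f'.2.2), ?_⟩,
      Subtype.ext hcomp⟩
    intro y
    obtain ⟨v, hv⟩ := f'.2.1 y
    exact ⟨f v, (DFunLike.congr_fun hcomp v).trans hv⟩⟩

/-- Both surjections from the lattice have kernel im A, so the induced morphism is injective.
Consequently a matrix has at most one cokernel class. -/
theorem IsCokernelBEG.iso {M : skewSymplectic ℓ g} {X Y : BEG ℓ n}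
    (hX : IsCokernelBEG M.1 X) (hY : IsCokernelBEG M.1 Y) : BEG.Iso X Y := by
  obtain ⟨f, hf1, hf2, hf3⟩ := (isCokernelBEG_iff _ _).1 hX
  obtain ⟨f', hf1', hf2', hf3'⟩ := (isCokernelBEG_iff _ _).1 hY
  obtain ⟨π, hπ⟩ := (surjEquivPush hf1 hf2 hf3 Y).surjective ⟨f', hf1', hf2'⟩
  have hc : ∀ v, π.1 (f v) = f' v := fun v => DFunLike.congr_fun (congrArg Subtype.val hπ) v
  have hinj : Function.Injective π.1 := by
    rw [injective_iff_map_eq_zero]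
    intro x hx
    obtain ⟨v, rfl⟩ := hf1 x
    rw [hc] at hx
    obtain ⟨y, rfl⟩ := hf3' v hx
    exact hf2.map_shifted y
  exact ⟨AddEquiv.ofBijective π.1 ⟨hinj, π.2.2⟩, π.2.1⟩

theorem IsCokernelBEG.of_iso {M : Matrix (Fin g ⊕ Fin g) (Fin g ⊕ Fin g) ℤ_[ℓ]} {X Y : BEG ℓ n}
    (hX : IsCokernelBEG M X) (h : BEG.Iso X Y) : IsCokernelBEG M Y := by
  obtain ⟨f, hf1, hf2, hf3⟩ := (isCokernelBEG_iff _ _).1 hX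
  obtain ⟨e, he⟩ := h
  refine (isCokernelBEG_iff _ _).2 ⟨e.toAddMonoidHom.comp f, e.surjective.comp hf1, hf2.comp he, ?_⟩
  intro x hx
  exact hf3 x (e.injective (hx.trans (map_zero e).symm))

/-- The cokernel of `M + ℓ^n` as a BEG, when it is finite. -/
theorem exists_cokernelBEG (hℓ : ℓ ≠ 2) (M : skewSymplectic ℓ g) {K : ℕ}
    (hK : ∀ v, ∃ y, (ℓ : ℤ_[ℓ]) ^ K • v = shifted n M.1 y) :
    ∃ X : BEG ℓ n, IsCokernelBEG M.1 X := by
  let N : AddSubgroup (SympLattice ℓ g) := (shifted n M.1).toAddMonoidHom.range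
  let f : SympLattice ℓ g →+ SympLattice ℓ g ⧸ N := QuotientAddGroup.mk' N
  have hfs : Function.Surjective f := QuotientAddGroup.mk'_surjective N
  have hf0 : ∀ x, f x = 0 ↔ ∃ y, x = shifted n M.1 y := fun x =>
    (QuotientAddGroup.eq_zero_iff x).trans ⟨fun ⟨y, hy⟩ => ⟨y, hy.symm⟩, fun ⟨y, hy⟩ => ⟨y, hy.symm⟩⟩
  have hfA : ∀ y, f (shifted n M.1 y) = 0 := fun y => (hf0 _).2 ⟨y, rfl⟩
  have he : ∀ x : SympLattice ℓ g ⧸ N, ℓ ^ K • x = 0 := by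
    intro x
    obtain ⟨v, rfl⟩ := hfs x
    obtain ⟨y, hy⟩ := hK v
    rw [← map_nsmul, hf0]
    exact ⟨y, by rw [← hy, ← Nat.cast_pow, Nat.cast_smul_eq_nsmul]⟩
  have hfin : Finite (SympLattice ℓ g ⧸ N) := by
    have : NeZero (ℓ ^ K) := ⟨pow_ne_zero _ hp.out.ne_zero⟩
    refine Finite.of_surjective (fun a : Fin g ⊕ Fin g → ZMod (ℓ ^ K) =>
      f fun i => ((a i).val : ℤ_[ℓ])) fun x => ?_
    obtain ⟨v, rfl⟩ := hfs x
    refine ⟨fun i => PadicInt.toZModPow K (v i), ?_⟩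
    have h : ∀ i, (ℓ : ℤ_[ℓ]) ^ K ∣ (((PadicInt.toZModPow K (v i)).val : ℤ_[ℓ]) - v i) := fun i => by
      rw [← toZModPow_eq_iff, map_natCast, ZMod.natCast_zmod_val]
    obtain ⟨u, hu⟩ := (pow_dvd_smul_iff _ K).2 h
    rw [← sub_eq_zero, ← map_sub]
    have : (fun i => ((PadicInt.toZModPow K (v i)).val : ℤ_[ℓ])) - v = (ℓ : ℤ_[ℓ]) ^ K • u := by
      rw [hu]; rfl
    rw [this, map_padic_pow_smul he]
  choose W hW using fun γ : Tors (DualGroup (SympLattice ℓ g ⧸ N)) (ℓ ^ n) =>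
    exists_char_lift f (mem_Tors.1 γ.2)
  choose U hU using fun γ => exists_shifted_div_of_char M hfA (hW γ)
  -- The value of ψ does not depend on the lift: two lifts w of γ differ by ℓ^n z, and then the
  -- vectors Aw/ℓ^n differ by Az.
  have hwd : ∀ (γ : Tors (DualGroup (SympLattice ℓ g ⧸ N)) (ℓ ^ n)) (w u : SympLattice ℓ g),
      (∀ x, (γ : DualGroup _) (f x) = padicCircle ℓ n (symp x w)) →
      (ℓ : ℤ_[ℓ]) ^ n • u = shifted n M.1 w → f (U γ) = f u := by
    intro γ w u hw hu
    have h1 : ∀ x, (ℓ : ℤ_[ℓ]) ^ n ∣ symp x (W γ - w) := fun x => by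
      rw [symp_sub_right, ← padicCircle_eq_iff, ← hW, hw]
    obtain ⟨z, hz⟩ := (exists_pow_smul_eq_iff _ n).2 h1
    rw [← sub_eq_zero, ← map_sub, hf0]
    refine ⟨z, pow_smul_cancel (N := n) ?_⟩
    rw [smul_sub, hU, hu, ← map_sub, ← hz, map_smul]
  have hmem : ∀ γ, f (U γ) ∈ Tors (SympLattice ℓ g ⧸ N) (ℓ ^ n) := fun γ => by
    rw [mem_Tors, ← map_nsmul, hf0]
    exact ⟨W γ, by rw [← hU, ← Nat.cast_pow, Nat.cast_smul_eq_nsmul]⟩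
  let ψ : Tors (DualGroup (SympLattice ℓ g ⧸ N)) (ℓ ^ n) →+ Tors (SympLattice ℓ g ⧸ N) (ℓ ^ n) :=
    AddMonoidHom.mk' (fun γ => ⟨f (U γ), hmem γ⟩) fun γ γ' => Subtype.ext (by
      change f (U (γ + γ')) = f (U γ) + f (U γ')
      rw [← map_add]
      refine hwd _ (W γ + W γ') _ (fun x => ?_) ?_
      · rw [symp_add_right, map_add, ← hW, ← hW]; rfl
      · rw [smul_add, hU, hU, map_add])
  have hψ : ∀ (γ : Tors (DualGroup (SympLattice ℓ g ⧸ N)) (ℓ ^ n)) (w u : SympLattice ℓ g),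
      (∀ x, (γ : DualGroup _) (f x) = padicCircle ℓ n (symp x w)) →
      (ℓ : ℤ_[ℓ]) ^ n • u = shifted n M.1 w → (ψ γ : SympLattice ℓ g ⧸ N) = f u := hwd
  let X : BEG ℓ n :=
    { carrier := SympLattice ℓ g ⧸ N
      isPGroup := fun x => ⟨K, he x⟩
      ω := omegaSum f
      ω_mem := omegaSum_mem f
      ω_torsion := pow_smul_omegaSum hℓ he M f hfA
      ψ := ψ
      compat := by
        intro r α β
        obtain ⟨a, ha⟩ := exists_symp_char (n + r) (α.comp f)
        obtain ⟨b, hb⟩ := exists_symp_char (n + r) (β.comp f)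
        have ha' : ∀ x, (smulToChar α : DualGroup _) (f x) = padicCircle ℓ n (symp x a) := fun x => by
          rw [← pow_nsmul_padicCircle n r, padicCircle_apply, ← ha]; rfl
        have hb' : ∀ x, (smulToChar β : DualGroup _) (f x) = padicCircle ℓ n (symp x b) := fun x => by
          rw [← pow_nsmul_padicCircle n r, padicCircle_apply, ← hb]; rfl
        obtain ⟨u, hu⟩ := exists_shifted_div_of_char M hfA ha'
        obtain ⟨u', hu'⟩ := exists_shifted_div_of_char M hfA hb'
        rw [hψ _ _ _ ha' hu, hψ _ _ _ hb' hu', tensorPairing_omegaSum f (n + r) α β ha hb]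
        change zmodToCircle _ ((β.comp f) u) = zmodToCircle _ ((α.comp f) u') + _
        rw [ha, hb, ← padicCircle_apply, ← padicCircle_apply, ← padicCircle_apply, ← map_nsmul,
          ← map_add]
        congr 1
        -- After multiplication by ℓ^n the compatibility axiom reads ⟨Aa, b⟩ = -⟨a, Ab⟩ + 2ℓ^n ⟨a,
        -- b⟩.
        have h1 : (ℓ : ℤ_[ℓ]) ^ n * symp u b = symp (shifted n M.1 a) b := by
          rw [← symp_smul_left, hu]
        have h2 : (ℓ : ℤ_[ℓ]) ^ n * symp u' a = -symp a (shifted n M.1 b) := by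
          rw [← symp_smul_left, hu', symp_swap]
        refine mul_left_cancel₀ (pow_ne_zero n padic_prime_ne_zero) ?_
        rw [h1, mul_add, h2, eq_neg_add_iff_add_eq, add_comm, symp_shifted_add, nsmul_eq_mul]
        push_cast
        ring }
  exact ⟨X, (isCokernelBEG_iff _ _).2 ⟨f, hfs, ⟨hfA, rfl, hψ⟩, fun x hx => (hf0 x).1 hx⟩⟩

end Cokernel

/-! ### Coordinates with respect to an adapted basis -/

section Coordinates

variable {ℓ g : ℕ} [hp : Fact ℓ.Prime] {H : Type} [AddCommGroup H] {f : SympLattice ℓ g →+ H}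

instance neZero_prime_pow (N : ℕ) : NeZero (ℓ ^ N) := ⟨pow_ne_zero _ hp.out.ne_zero⟩

namespace AdaptedBasis

variable (B : AdaptedBasis f)

/-- The dual basis. -/
abbrev x (i : Fin (g + g)) : SympLattice ℓ g := sympDual B.b i

theorem symp_x_b (i j : Fin (g + g)) : symp (B.x i) (B.b j) = if i = j then 1 else 0 :=
  symp_sympDual_basis B.b i j

/-- The coordinates of the lattice modulo the kernel. -/
def latticeCoord : SympLattice ℓ g →+ (∀ i, ZMod (ℓ ^ B.k i)) :=
  AddMonoidHom.mk' (fun v i => PadicInt.toZModPow (B.k i) (symp (B.x i) v)) fun v w => by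
    ext i
    simp [symp_add_right]

theorem ker_le_ker_latticeCoord : f.ker ≤ B.latticeCoord.ker := fun v hv => by
  ext i
  exact (toZModPow_eq_zero_iff _ _).2 ((B.map_eq_zero_iff v).1 hv i)

theorem exists_coordEquiv (hs : Function.Surjective f) :
    ∃ e : H ≃+ (∀ i, ZMod (ℓ ^ B.k i)),
      ∀ v i, e (f v) i = PadicInt.toZModPow (B.k i) (symp (B.x i) v) := by
  let F := f.liftOfSurjective hs ⟨B.latticeCoord, B.ker_le_ker_latticeCoord⟩
  have hF : ∀ v, F (f v) = B.latticeCoord v := fun v => DFunLike.congr_fun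
    (AddMonoidHom.liftOfRightInverse_comp f _ (Function.rightInverse_surjInv hs)
      ⟨B.latticeCoord, B.ker_le_ker_latticeCoord⟩) v
  refine ⟨AddEquiv.ofBijective F ⟨?_, fun z => ?_⟩, fun v i => congrFun (hF v) i⟩
  · rw [injective_iff_map_eq_zero]
    intro y hy
    obtain ⟨v, rfl⟩ := hs y
    rw [hF] at hy
    exact (B.map_eq_zero_iff v).2 fun i => (toZModPow_eq_zero_iff _ _).1 (congrFun hy i)
  · choose c hc using fun i => toZModPow_surjective (B.k i) (z i)
    refine ⟨f (∑ j, c j • B.b j), ?_⟩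
    rw [hF]
    ext i
    change PadicInt.toZModPow (B.k i) (symp (B.x i) (∑ j, c j • B.b j)) = z i
    rw [symp_sum_right, Finset.sum_eq_single i]
    · rw [symp_smul_right, symp_x_b, if_pos rfl, mul_one, hc]
    · intro j _ hj
      rw [symp_smul_right, symp_x_b, if_neg hj.symm, mul_zero]
    · simp

/-- The isomorphism `H ≅ ∏ ℤ/ℓ^{k_i}`. -/
def coordEquiv (hs : Function.Surjective f) : H ≃+ (∀ i, ZMod (ℓ ^ B.k i)) :=
  (B.exists_coordEquiv hs).choose

theorem card_eq (hs : Function.Surjective f) : Nat.card H = ∏ i, ℓ ^ B.k i := by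
  rw [Nat.card_congr (B.coordEquiv hs).toEquiv, Nat.card_pi]
  exact Finset.prod_congr rfl fun i _ => Nat.card_zmod _

theorem k_le {e : ℕ} (he : ∀ x : H, ℓ ^ e • x = 0) (i : Fin (g + g)) : B.k i ≤ e := by
  have h := (B.map_eq_zero_iff ((ℓ : ℤ_[ℓ]) ^ e • B.b i)).1 (map_padic_pow_smul he f _) i
  rw [symp_smul_right, B.symp_x_b, if_pos rfl, mul_one] at h
  exact (pow_dvd_pow_iff padic_prime_ne_zero PadicInt.prime_p.not_isUnit).1 h

end AdaptedBasis

end Coordinates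

/-! ### Haar measure -/

section Haar

variable {ℓ g : ℕ} [hp : Fact ℓ.Prime]

instance : IsTopologicalAddGroup (Matrix (Fin g ⊕ Fin g) (Fin g ⊕ Fin g) ℤ_[ℓ]) :=
  inferInstanceAs (IsTopologicalAddGroup ((Fin g ⊕ Fin g) → (Fin g ⊕ Fin g) → ℤ_[ℓ]))

instance : (skewHaar ℓ g).IsAddLeftInvariant :=
  inferInstanceAs (Measure.addHaarMeasure ⊤).IsAddLeftInvariant

instance : IsProbabilityMeasure (skewHaar ℓ g) := ⟨by
  have h := Measure.addHaarMeasure_self (G := skewSymplectic ℓ g) (K₀ := ⊤)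
  exact h⟩

/-- The fibres of a surjective homomorphism are translates of its kernel, so by invariance they
share the total mass 1 equally. -/
theorem skewHaar_fiber {B : Type*} [AddCommGroup B] [Finite B] (φ : skewSymplectic ℓ g →+ B)
    (hφ : Function.Surjective φ) (hm : MeasurableSet (φ ⁻¹' {0})) (b : B) :
    MeasurableSet (φ ⁻¹' {b}) ∧ skewHaar ℓ g (φ ⁻¹' {b}) = (Nat.card B : ℝ≥0∞)⁻¹ := by
  have key : ∀ b : B, MeasurableSet (φ ⁻¹' {b}) ∧
      skewHaar ℓ g (φ ⁻¹' {b}) = skewHaar ℓ g (φ ⁻¹' {0}) := by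
    intro b
    obtain ⟨M, rfl⟩ := hφ b
    have h : φ ⁻¹' {φ M} = (fun M' => -M + M') ⁻¹' (φ ⁻¹' {0}) := by
      ext M'
      simp only [Set.mem_preimage, Set.mem_singleton_iff, map_add, map_neg]
      rw [neg_add_eq_zero, eq_comm]
    rw [h]
    exact ⟨(measurable_const_add (-M)) hm, measure_preimage_add _ _ _⟩
  refine ⟨(key b).1, ?_⟩
  have := Fintype.ofFinite B
  have hu : (⋃ b : B, φ ⁻¹' {b}) = Set.univ := by
    ext M; simp
  have h1 : skewHaar ℓ g (⋃ b : B, φ ⁻¹' {b}) = ∑' b, skewHaar ℓ g (φ ⁻¹' {b}) := by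
    refine measure_iUnion (fun b b' hb => ?_) fun b => (key b).1
    exact Disjoint.preimage _ (Set.disjoint_singleton.2 hb)
  rw [hu, measure_univ] at h1
  simp_rw [(key _).2] at h1
  rw [tsum_fintype, Finset.sum_const, Finset.card_univ, nsmul_eq_mul, ← Nat.card_eq_fintype_card] at h1
  rw [(key b).2]
  exact ENNReal.eq_inv_of_mul_eq_one_left (by rw [mul_comm]; exact h1.symm)

theorem isClosed_setOf_pow_dvd (N : ℕ) : IsClosed {c : ℤ_[ℓ] | (ℓ : ℤ_[ℓ]) ^ N ∣ c} := by
  have : {c : ℤ_[ℓ] | (ℓ : ℤ_[ℓ]) ^ N ∣ c} = {c | ‖c‖ ≤ (ℓ : ℝ) ^ (-N : ℤ)} := by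
    ext c
    change (ℓ : ℤ_[ℓ]) ^ N ∣ c ↔ ‖c‖ ≤ _
    rw [PadicInt.norm_le_pow_iff_mem_span_pow, Ideal.mem_span_singleton]
  rw [this]
  exact isClosed_le continuous_norm continuous_const

theorem continuous_symp_mulVec (x y : SympLattice ℓ g) :
    Continuous fun M : skewSymplectic ℓ g => symp x (M.1.mulVec y) := by
  have h : Continuous fun M : Matrix (Fin g ⊕ Fin g) (Fin g ⊕ Fin g) ℤ_[ℓ] => symp x (M.mulVec y) := by
    simp only [symp, Matrix.mulVec, dotProduct]
    fun_prop
  exact h.comp continuous_subtype_val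

theorem measurableSet_pow_dvd_symp (N : ℕ) (x y : SympLattice ℓ g) :
    MeasurableSet {M : skewSymplectic ℓ g | (ℓ : ℤ_[ℓ]) ^ N ∣ symp x (M.1.mulVec y)} :=
  ((isClosed_setOf_pow_dvd N).preimage (continuous_symp_mulVec x y)).measurableSet

/-- Every symmetric bilinear form is given by a skew-symplectic matrix. -/
theorem exists_skewSymplectic (S : LinearMap.BilinForm ℤ_[ℓ] (SympLattice ℓ g))
    (hS : ∀ x y, S x y = S y x) :
    ∃ M : skewSymplectic ℓ g, ∀ x y, symp x (M.1.mulVec y) = S x y := by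
  choose m hm using fun y => exists_symp_right_eq (S y)
  let L : SympLattice ℓ g →ₗ[ℤ_[ℓ]] SympLattice ℓ g :=
    { toFun := m
      map_add' := fun y y' => symp_right_ext fun v => by
        rw [hm, symp_add_right, hm, hm, map_add]; rfl
      map_smul' := fun c y => symp_right_ext fun v => by
        rw [hm, symp_smul_right, hm, map_smul]; rfl }
  have hL : ∀ x y, symp x ((LinearMap.toMatrix' L).mulVec y) = S x y := fun x y => by
    rw [LinearMap.toMatrix'_mulVec]
    exact (hm y x).trans (hS y x)
  refine ⟨⟨LinearMap.toMatrix' L, fun v w => ?_⟩, hL⟩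
  rw [symp_swap, hL, hL, hS]

/-- The matrices `M` for which `y` kills `M + ℓ^n` modulo `ℓ^N`. -/
def killSet (n N : ℕ) (y : SympLattice ℓ g) : Set (skewSymplectic ℓ g) :=
  {M | ∀ v, (ℓ : ℤ_[ℓ]) ^ N ∣ symp y (shifted n M.1 v)}

theorem killSet_smul (n N : ℕ) (y : SympLattice ℓ g) :
    killSet n (N + 1) ((ℓ : ℤ_[ℓ]) • y) = killSet n N y := by
  ext M
  refine forall_congr' fun v => ?_
  rw [symp_smul_left, pow_succ', mul_dvd_mul_iff_left padic_prime_ne_zero]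

/-- For primitive y the functional ⟨y, M·⟩ modulo ℓ^N is uniformly distributed, and y kills M + ℓ^n
for exactly one of its values. -/
theorem skewHaar_killSet (n N : ℕ) {y w : SympLattice ℓ g} (hw : symp w y = 1) :
    MeasurableSet (killSet n N y) ∧
      skewHaar ℓ g (killSet n N y) = (Nat.card (Fin g ⊕ Fin g → ZMod (ℓ ^ N)) : ℝ≥0∞)⁻¹ := by
  let φ : skewSymplectic ℓ g →+ (Fin g ⊕ Fin g → ZMod (ℓ ^ N)) :=
    AddMonoidHom.mk' (fun M j => PadicInt.toZModPow N (symp y (M.1.mulVec (Pi.single j 1))))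
      fun M M' => by
        ext j
        change PadicInt.toZModPow N (symp y ((M.1 + M'.1).mulVec _)) = _ + _
        rw [Matrix.add_mulVec, symp_add_right, map_add]
  have hφ : ∀ M j, φ M j = PadicInt.toZModPow N (symp y (M.1.mulVec (Pi.single j 1))) :=
    fun _ _ => rfl
  have hsurj : Function.Surjective φ := by
    intro t
    choose c hc using fun j => toZModPow_surjective N (t j)
    let T : SympLattice ℓ g →ₗ[ℤ_[ℓ]] ℤ_[ℓ] := (Pi.basisFun ℤ_[ℓ] (Fin g ⊕ Fin g)).constr ℤ_[ℓ] c
    have hT : ∀ j, T (Pi.single j 1) = c j := fun j => by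
      rw [← Pi.basisFun_apply]; exact Module.Basis.constr_basis _ _ _ _
    let η : SympLattice ℓ g →ₗ[ℤ_[ℓ]] ℤ_[ℓ] := sympForm ℓ g w
    have hη : η y = 1 := hw
    -- With η(y) = 1, the form η⊗T + T⊗η - T(y) η⊗η is symmetric and restricts to T when its first
    -- argument is y.
    obtain ⟨M, hM⟩ := exists_skewSymplectic
      (LinearMap.BilinForm.linMulLin η T + LinearMap.BilinForm.linMulLin T η -
        T y • LinearMap.BilinForm.linMulLin η η) (fun u v => by
          simp only [LinearMap.sub_apply, LinearMap.add_apply, LinearMap.smul_apply,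
            LinearMap.BilinForm.linMulLin_apply, smul_eq_mul]
          ring)
    refine ⟨M, ?_⟩
    ext j
    rw [hφ, hM, ← hc, ← hT]
    congr 1
    simp only [LinearMap.sub_apply, LinearMap.add_apply, LinearMap.smul_apply,
      LinearMap.BilinForm.linMulLin_apply, smul_eq_mul, hη]
    ring
  have hmeas : MeasurableSet (φ ⁻¹' {0}) := by
    have : φ ⁻¹' {0} = ⋂ j, {M : skewSymplectic ℓ g |
        (ℓ : ℤ_[ℓ]) ^ N ∣ symp y (M.1.mulVec (Pi.single j 1))} := by
      ext M
      simp only [Set.mem_preimage, Set.mem_singleton_iff, Set.mem_iInter, funext_iff, hφ,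
        Pi.zero_apply, toZModPow_eq_zero_iff]
      rfl
    rw [this]
    exact MeasurableSet.iInter fun j => measurableSet_pow_dvd_symp N _ _
  have hset : killSet n N y = φ ⁻¹' {fun j =>
      -PadicInt.toZModPow N ((ℓ : ℤ_[ℓ]) ^ n * symp y (Pi.single j 1))} := by
    ext M
    simp only [Set.mem_preimage, Set.mem_singleton_iff, funext_iff, hφ]
    simp only [eq_neg_iff_add_eq_zero, ← map_add, toZModPow_eq_zero_iff, ← symp_smul_right,
      ← symp_add_right, ← shifted_apply]
    constructor
    · exact fun h j => h _
    · intro h v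
      have hv : v = ∑ i, v i • (Pi.single i 1 : SympLattice ℓ g) := by
        ext j; simp [Finset.sum_apply, Pi.single_apply]
      rw [hv, map_sum, symp_sum_right]
      refine Finset.dvd_sum fun j _ => ?_
      rw [map_smul, symp_smul_right]
      exact Dvd.dvd.mul_left (h j) _
  rw [hset]
  exact skewHaar_fiber φ hsurj hmeas _

/-- Representatives of the vectors modulo `ℓ^N`. -/
def vectorBox (ℓ g N : ℕ) : Finset (Fin g ⊕ Fin g → ℕ) :=
  Fintype.piFinset fun _ => Finset.range (ℓ ^ N)

/-- The vector with natural coordinates `y`. -/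
def natVector (ℓ : ℕ) {g : ℕ} [Fact ℓ.Prime] (y : Fin g ⊕ Fin g → ℕ) : SympLattice ℓ g :=
  fun i => (y i : ℤ_[ℓ])

theorem exists_symp_natVector_eq_one {y : Fin g ⊕ Fin g → ℕ} (hy : ∃ i, ¬ ℓ ∣ y i) :
    ∃ w, symp w (natVector ℓ y) = 1 := by
  obtain ⟨i, hi⟩ := hy
  have hu : IsUnit (natVector ℓ y i) := by
    by_contra hu
    rw [PadicInt.not_isUnit_iff, PadicInt.norm_lt_one_iff_dvd] at hu
    have h := (toZModPow_eq_zero_iff 1 (natVector ℓ y i)).2 (by rwa [pow_one])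
    rw [natVector, map_natCast, ZMod.natCast_eq_zero_iff, pow_one] at h
    exact hi h
  obtain ⟨w, hw⟩ := exists_symp_left_eq
    ((hu.unit⁻¹ : ℤ_[ℓ]ˣ).1 • (LinearMap.proj i : SympLattice ℓ g →ₗ[ℤ_[ℓ]] ℤ_[ℓ]))
  refine ⟨w, ?_⟩
  rw [hw]
  exact hu.val_inv_mul

/-- A first moment bound. At each level the primitive vectors contribute at most 1, since each has
probability the inverse of the number of all vectors. A vector ℓz at level N + 1 has the same kill
set as z at level N, so induction adds 1 per level. -/
theorem measurableSet_killSet_and_sum_le (n N : ℕ) :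
    (∀ y ∈ vectorBox ℓ g N, MeasurableSet (killSet n N (natVector ℓ y))) ∧
      ∑ y ∈ vectorBox ℓ g N, skewHaar ℓ g (killSet n N (natVector ℓ y)) ≤ N + 1 := by
  classical
  induction N with
  | zero =>
    have h : ∀ y : SympLattice ℓ g, killSet n 0 y = Set.univ := fun y => by
      ext M; simp [killSet]
    refine ⟨fun y _ => by rw [h]; exact MeasurableSet.univ, ?_⟩
    have hc : (vectorBox ℓ g 0).card = 1 := by simp [vectorBox]
    simp [h, hc]
  | succ N ih =>
    have hdvd : (vectorBox ℓ g (N + 1)).filter (fun y => ¬ ∃ i, ¬ ℓ ∣ y i) =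
        (vectorBox ℓ g N).image fun y i => ℓ * y i := by
      ext y
      simp only [Finset.mem_filter, Finset.mem_image, vectorBox, Fintype.mem_piFinset,
        Finset.mem_range, not_exists, not_not]
      constructor
      · rintro ⟨h1, h2⟩
        choose z hz using h2
        refine ⟨z, fun i => ?_, funext fun i => (hz i).symm⟩
        have := h1 i
        rw [hz, pow_succ'] at this
        exact lt_of_mul_lt_mul_left this (Nat.zero_le _)
      · rintro ⟨z, hz, rfl⟩
        refine ⟨fun i => ?_, fun i => Dvd.intro _ rfl⟩
        rw [pow_succ']
        exact Nat.mul_lt_mul_of_pos_left (hz i) hp.out.pos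
    have hnat : ∀ y : Fin g ⊕ Fin g → ℕ,
        natVector ℓ (fun i => ℓ * y i) = (ℓ : ℤ_[ℓ]) • natVector ℓ y := fun y => by
      ext i; simp [natVector]
    refine ⟨fun y hy => ?_, ?_⟩
    · by_cases h : ∃ i, ¬ ℓ ∣ y i
      · obtain ⟨w, hw⟩ := exists_symp_natVector_eq_one h
        exact (skewHaar_killSet n (N + 1) hw).1
      · have hy' : y ∈ (vectorBox ℓ g (N + 1)).filter (fun y => ¬ ∃ i, ¬ ℓ ∣ y i) :=
          Finset.mem_filter.2 ⟨hy, h⟩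
        rw [hdvd, Finset.mem_image] at hy'
        obtain ⟨z, hz, rfl⟩ := hy'
        rw [hnat, killSet_smul]
        exact ih.1 z hz
    · rw [← Finset.sum_filter_add_sum_filter_not (vectorBox ℓ g (N + 1)) (fun y => ∃ i, ¬ ℓ ∣ y i),
        hdvd, Finset.sum_image]
      · simp_rw [hnat, killSet_smul]
        rw [add_comm]
        push_cast
        refine add_le_add ih.2 ?_
        have hcard : (vectorBox ℓ g (N + 1)).card = Nat.card (Fin g ⊕ Fin g → ZMod (ℓ ^ (N + 1))) := by
          rw [vectorBox, Fintype.card_piFinset, Nat.card_pi]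
          simp
        calc _ ≤ ∑ _y ∈ (vectorBox ℓ g (N + 1)).filter (fun y => ∃ i, ¬ ℓ ∣ y i),
              (Nat.card (Fin g ⊕ Fin g → ZMod (ℓ ^ (N + 1))) : ℝ≥0∞)⁻¹ := by
                refine Finset.sum_le_sum fun y hy => ?_
                obtain ⟨w, hw⟩ := exists_symp_natVector_eq_one (Finset.mem_filter.1 hy).2
                exact (skewHaar_killSet n (N + 1) hw).2.le
          _ ≤ ∑ _y ∈ vectorBox ℓ g (N + 1),
              (Nat.card (Fin g ⊕ Fin g → ZMod (ℓ ^ (N + 1))) : ℝ≥0∞)⁻¹ :=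
                Finset.sum_le_sum_of_subset (Finset.filter_subset _ _)
          _ = 1 := by
                rw [Finset.sum_const, hcard, nsmul_eq_mul]
                exact ENNReal.mul_inv_cancel (Nat.cast_ne_zero.2 Nat.card_pos.ne') (by simp)
      · intro y _ y' _ h
        ext i
        exact Nat.eq_of_mul_eq_mul_left hp.out.pos (congrFun h i)

open Classical in
/-- The number of vectors modulo `ℓ^N` that kill `M + ℓ^n`. -/
def killCount (n N : ℕ) (M : skewSymplectic ℓ g) : ℕ :=
  ((vectorBox ℓ g N).filter fun y => M ∈ killSet n N (natVector ℓ y)).card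

/-- Markov's inequality for the first moment bound N + 1. -/
theorem skewHaar_le_killCount (n N : ℕ) :
    skewHaar ℓ g {M | ℓ ^ N ≤ killCount n N M} ≤ (N + 1) / (ℓ ^ N : ℝ≥0∞) := by
  classical
  have h := measurableSet_killSet_and_sum_le (ℓ := ℓ) (g := g) n N
  have hcount : ∀ M : skewSymplectic ℓ g, (killCount n N M : ℝ≥0∞) =
      ∑ y ∈ vectorBox ℓ g N, (killSet n N (natVector ℓ y)).indicator 1 M := by
    intro M
    rw [killCount, Finset.card_filter]
    push_cast
    refine Finset.sum_congr rfl fun y _ => ?_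
    rw [Set.indicator_apply, Pi.one_apply]
  have hint : ∫⁻ M, (killCount n N M : ℝ≥0∞) ∂(skewHaar ℓ g) ≤ N + 1 := by
    simp_rw [hcount]
    rw [lintegral_finsetSum' _ fun y hy => (measurable_one.indicator (h.1 y hy)).aemeasurable]
    refine le_trans (le_of_eq (Finset.sum_congr rfl fun y hy => ?_)) h.2
    rw [lintegral_indicator_one (h.1 y hy)]
  have hmeas : AEMeasurable (fun M : skewSymplectic ℓ g => (killCount n N M : ℝ≥0∞))
      (skewHaar ℓ g) := by
    simp_rw [hcount]
    exact Finset.aemeasurable_fun_sum _ fun y hy => (measurable_one.indicator (h.1 y hy)).aemeasurable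
  have h0 : (ℓ ^ N : ℝ≥0∞) ≠ 0 := pow_ne_zero _ (Nat.cast_ne_zero.2 hp.out.ne_zero)
  have hm := meas_ge_le_lintegral_div hmeas h0 (by finiteness)
  refine le_trans (le_of_eq ?_) (hm.trans (ENNReal.div_le_div_right hint _))
  congr 1
  ext M
  change ℓ ^ N ≤ killCount n N M ↔ (ℓ ^ N : ℝ≥0∞) ≤ killCount n N M
  exact_mod_cast Iff.rfl

theorem card_le_killCount {n N : ℕ} {M : skewSymplectic ℓ g} {T : Type} [Finite T]
    (Y : T → SympLattice ℓ g) (hY : ∀ t, M ∈ killSet n N (Y t))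
    (hinj : ∀ t t', (∀ v, (ℓ : ℤ_[ℓ]) ^ N ∣ symp (Y t - Y t') v) → t = t') :
    Nat.card T ≤ killCount n N M := by
  classical
  have := Fintype.ofFinite T
  let red : T → Fin g ⊕ Fin g → ℕ := fun t i => (PadicInt.toZModPow N (Y t i)).val
  have hred : ∀ t, ∃ u, natVector ℓ (red t) = Y t + (ℓ : ℤ_[ℓ]) ^ N • u := by
    intro t
    have h : ∀ i, (ℓ : ℤ_[ℓ]) ^ N ∣ (natVector ℓ (red t) - Y t) i := fun i => by
      rw [Pi.sub_apply, ← toZModPow_eq_iff, natVector, map_natCast, ZMod.natCast_zmod_val]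
    obtain ⟨u, hu⟩ := (pow_dvd_smul_iff _ N).2 h
    exact ⟨u, by rw [hu]; abel⟩
  rw [Nat.card_eq_fintype_card, ← Finset.card_univ, killCount]
  refine Finset.card_le_card_of_injOn red (fun t _ => ?_) fun t _ t' _ h => hinj t t' fun v => ?_
  · refine Finset.mem_coe.2 (Finset.mem_filter.2 ⟨?_, fun v => ?_⟩)
    · exact Fintype.mem_piFinset.2 fun i => Finset.mem_range.2 (ZMod.val_lt _)
    · obtain ⟨u, hu⟩ := hred t
      rw [hu, symp_add_left, symp_smul_left]
      exact dvd_add (hY t v) (Dvd.intro _ rfl)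
  · obtain ⟨u, hu⟩ := hred t
    obtain ⟨u', hu'⟩ := hred t'
    rw [h, hu'] at hu
    have : Y t - Y t' = (ℓ : ℤ_[ℓ]) ^ N • (u' - u) := by
      rw [smul_sub, sub_eq_sub_iff_add_eq_add, ← hu, add_comm]
    rw [this, symp_smul_left]
    exact Dvd.intro _ rfl

theorem eq_of_pow_dvd_natCast_sub {k a b : ℕ} (ha : a < ℓ ^ k) (hb : b < ℓ ^ k)
    (h : (ℓ : ℤ_[ℓ]) ^ k ∣ (a : ℤ_[ℓ]) - b) : a = b := by
  rw [← toZModPow_eq_iff, map_natCast, map_natCast, ZMod.natCast_eq_natCast_iff'] at h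
  rwa [Nat.mod_eq_of_lt ha, Nat.mod_eq_of_lt hb] at h

/-- The vectors modulo ℓ^N that kill A form the dual of coker A modulo ℓ^N. Fewer than ℓ^N of them
rules out a cyclic factor of order at least ℓ^N, so coker A is finite and killed by ℓ^N; then their
number bounds its order. -/
theorem exists_isCokernelBEG_of_killCount_lt (hℓ : ℓ ≠ 2) {n N : ℕ} {M : skewSymplectic ℓ g}
    (h : killCount n N M < ℓ ^ N) :
    ∃ X : BEG ℓ n, IsCokernelBEG M.1 X ∧ Nat.card X.carrier ≤ ℓ ^ N := by
  obtain ⟨b, a, hba⟩ := exists_basis_mem_iff (Pi.basisFun ℤ_[ℓ] (Fin g ⊕ Fin g))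
    (LinearMap.range (shifted n M.1))
  have hb : ∀ i, symp (sympDual b i) (b i) = 1 := fun i => by
    classical
    rw [symp_sympDual_basis, if_pos rfl]
  have ha : ∀ i, ¬ (ℓ : ℤ_[ℓ]) ^ N ∣ a i := by
    intro i hi
    refine absurd h (not_lt.2 ?_)
    -- If ℓ^N divides the i-th elementary divisor, all ℓ^N multiples of the i-th dual vector kill A.
    have hc := card_le_killCount (n := n) (N := N) (M := M) (T := Fin (ℓ ^ N))
      (fun t => ((t : ℕ) : ℤ_[ℓ]) • sympDual b i) (fun t v => by
        rw [symp_smul_left, symp_sympDual]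
        exact Dvd.dvd.mul_left (hi.trans ((hba _).1 ⟨v, rfl⟩ i)) _) (fun t t' ht => by
        have := ht (b i)
        rw [← sub_smul, symp_smul_left, hb, mul_one] at this
        exact Fin.ext (eq_of_pow_dvd_natCast_sub t.2 t'.2 this))
    simpa using hc
  have hdvd : ∀ i, a i ∣ (ℓ : ℤ_[ℓ]) ^ N := by
    intro i
    have h0 : a i ≠ 0 := fun h0 => ha i (h0 ▸ dvd_zero _)
    obtain ⟨k, hk⟩ := exists_dvd_iff_pow_dvd h0
    rw [hk]
    refine pow_dvd_pow _ (le_of_not_gt fun hlt => ha i ?_)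
    exact (pow_dvd_pow _ hlt.le).trans ((hk _).1 dvd_rfl)
  obtain ⟨X, hX⟩ := exists_cokernelBEG hℓ (n := n) (K := N) M fun v => by
    have : (ℓ : ℤ_[ℓ]) ^ N • v ∈ LinearMap.range (shifted n M.1) := by
      rw [hba]
      intro i
      rw [map_smul]
      exact Dvd.dvd.mul_right (hdvd i) _
    obtain ⟨y, hy⟩ := this
    exact ⟨y, hy.symm⟩
  refine ⟨X, hX, ?_⟩
  obtain ⟨f, hf1, hf2, hf3⟩ := (isCokernelBEG_iff _ _).1 hX
  obtain ⟨B⟩ := nonempty_adaptedBasis X.isPGroup f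
  have he : ∀ x : X.carrier, ℓ ^ N • x = 0 := by
    intro x
    obtain ⟨v, rfl⟩ := hf1 x
    have : (ℓ : ℤ_[ℓ]) ^ N • v ∈ LinearMap.range (shifted n M.1) := by
      rw [hba]
      intro i
      rw [map_smul]
      exact Dvd.dvd.mul_right (hdvd i) _
    obtain ⟨y, hy⟩ := this
    rw [← map_nsmul, ← Nat.cast_smul_eq_nsmul ℤ_[ℓ], Nat.cast_pow, ← hy, hf2.map_shifted]
  refine le_trans (le_of_eq ?_) (le_trans (card_le_killCount (n := n) (N := N) (M := M)
    (T := ∀ i, Fin (ℓ ^ B.k i))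
    -- These vectors, divided by ℓ^N, are the characters ∑ t_i x_i/ℓ^{k_i} of the cokernel.
    (fun t => ∑ i, (((t i : ℕ) : ℤ_[ℓ]) * (ℓ : ℤ_[ℓ]) ^ (N - B.k i)) • B.x i) (fun t v => ?_)
    fun t t' ht => ?_) h.le)
  · rw [B.card_eq hf1, Nat.card_pi]
    simp
  · rw [symp_sum_left]
    refine Finset.dvd_sum fun i _ => ?_
    have hi := (B.map_eq_zero_iff _).1 (hf2.map_shifted v) i
    rw [symp_smul_left, mul_assoc]
    refine Dvd.dvd.mul_left ?_ _
    calc (ℓ : ℤ_[ℓ]) ^ N = (ℓ : ℤ_[ℓ]) ^ (N - B.k i) * (ℓ : ℤ_[ℓ]) ^ B.k i := by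
          rw [← pow_add, Nat.sub_add_cancel (B.k_le he i)]
      _ ∣ _ := mul_dvd_mul_left _ hi
  · ext i
    refine eq_of_pow_dvd_natCast_sub (t i).2 (t' i).2 ?_
    have h1 := ht (B.b i)
    rw [← Finset.sum_sub_distrib, symp_sum_left, Finset.sum_eq_single i] at h1
    · rw [← sub_smul, symp_smul_left, B.symp_x_b, if_pos rfl, mul_one, ← sub_mul] at h1
      have h2 : (ℓ : ℤ_[ℓ]) ^ N = (ℓ : ℤ_[ℓ]) ^ B.k i * (ℓ : ℤ_[ℓ]) ^ (N - B.k i) := by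
        rw [← pow_add, Nat.add_sub_cancel' (B.k_le he i)]
      rw [h2] at h1
      exact (mul_dvd_mul_iff_right (pow_ne_zero _ padic_prime_ne_zero)).1 h1
    · intro j _ hj
      rw [← sub_smul, symp_smul_left, B.symp_x_b, if_neg hj, mul_zero]
    · simp

/-- Tightness: with probability close to `1`, the cokernel of `M + ℓ^n` is small. -/
theorem skewHaar_not_exists_le (hℓ : ℓ ≠ 2) (n N : ℕ) :
    skewHaar ℓ g {M | ¬ ∃ X : BEG ℓ n, IsCokernelBEG M.1 X ∧ Nat.card X.carrier ≤ ℓ ^ N} ≤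
      (N + 1) / (ℓ ^ N : ℝ≥0∞) := by
  refine le_trans (measure_mono fun M hM => ?_) (skewHaar_le_killCount n N)
  by_contra h
  exact hM (exists_isCokernelBEG_of_killCount_lt hℓ (not_le.1 h))

end Haar

/-! ### Push-forward conditions in coordinates -/

section PushCoordinates

variable {ℓ n g : ℕ} [hp : Fact ℓ.Prime] {X : BEG ℓ n} {f : SympLattice ℓ g →+ X.carrier}

theorem padicCircle_mul_appr {N e : ℕ} (hNe : N ≤ e) (t c : ℤ_[ℓ]) :
    padicCircle ℓ N (t * c) = t.appr e • padicCircle ℓ N c := by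
  obtain ⟨t', ht'⟩ := PadicInt.exists_eq_natCast_add t e
  rw [nsmul_padicCircle, padicCircle_eq_iff, ← sub_mul]
  refine Dvd.dvd.mul_right ((pow_dvd_pow _ hNe).trans ⟨t', ?_⟩) _
  rw [sub_eq_iff_eq_add']
  exact ht'

theorem exists_zmodChar {H : Type} [AddCommGroup H] {f : SympLattice ℓ g →+ H}
    (hs : Function.Surjective f) {N : ℕ} {w : SympLattice ℓ g}
    (hw : ∀ v, f v = 0 → (ℓ : ℤ_[ℓ]) ^ N ∣ symp v w) :
    ∃ α : H →+ ZMod (ℓ ^ N), ∀ v, α (f v) = PadicInt.toZModPow N (symp v w) := by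
  let χ : SympLattice ℓ g →+ ZMod (ℓ ^ N) :=
    AddMonoidHom.mk' (fun v => PadicInt.toZModPow N (symp v w)) fun v v' => by
      rw [symp_add_left, map_add]
  have hχ : f.ker ≤ χ.ker := fun v hv => (toZModPow_eq_zero_iff _ _).2 (hw v hv)
  exact ⟨f.liftOfSurjective hs ⟨χ, hχ⟩, fun v => DFunLike.congr_fun
    (AddMonoidHom.liftOfRightInverse_comp f _ (Function.rightInverse_surjInv hs) ⟨χ, hχ⟩) v⟩

namespace AdaptedBasis

variable (B : AdaptedBasis f)

/-- The exponent of the `i`-th cyclic factor of `X[ℓ^n]`. -/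
def m (i : Fin (g + g)) : ℕ := min (B.k i) n

theorem m_le_k (i : Fin (g + g)) : B.m i ≤ B.k i := min_le_left _ _

theorem m_le (i : Fin (g + g)) : B.m i ≤ n := min_le_right _ _

theorem dvd_symp_x {v : SympLattice ℓ g} (hv : f v = 0) (i : Fin (g + g)) :
    (ℓ : ℤ_[ℓ]) ^ B.k i ∣ symp v (B.x i) := by
  rw [symp_swap, dvd_neg]
  exact (B.map_eq_zero_iff v).1 hv i

/-- This is ⟨·, x_j⟩/ℓ^{m_j}, the generator of the j-th cyclic factor of X^∨[ℓ^n], rewritten with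
denominator ℓ^n. -/
theorem exists_char (hs : Function.Surjective f) (j : Fin (g + g)) :
    ∃ γ : Tors (DualGroup X.carrier) (ℓ ^ n), ∀ v, (γ : DualGroup X.carrier) (f v) =
      padicCircle ℓ n (symp v ((ℓ : ℤ_[ℓ]) ^ (n - B.m j) • B.x j)) := by
  obtain ⟨α, hα⟩ := exists_zmodChar hs (N := n) (w := (ℓ : ℤ_[ℓ]) ^ (n - B.m j) • B.x j)
    fun v hv => by
      rw [symp_smul_right]
      refine dvd_trans ?_ (mul_dvd_mul_left _ (B.dvd_symp_x hv j))
      rw [← pow_add]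
      refine pow_dvd_pow _ ?_
      have := B.m_le j
      have := B.m_le_k j
      omega
  exact ⟨⟨toChar α, mem_Tors.2 (nsmul_toChar α)⟩, fun v => congrArg (zmodToCircle _) (hα v)⟩

end AdaptedBasis

theorem torsChar_ext (hs : Function.Surjective f) {γ γ' : Tors (DualGroup X.carrier) (ℓ ^ n)}
    (h : ∀ v, (γ : DualGroup X.carrier) (f v) = (γ' : DualGroup X.carrier) (f v)) : γ = γ' := by
  refine Subtype.ext (AddMonoidHom.ext fun y => ?_)
  obtain ⟨v, rfl⟩ := hs y
  exact h v

/-- Lifts `q_j` of the images under `ψ` of the generators of `X^∨[ℓ^n]`. -/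
structure PsiLift (B : AdaptedBasis f) where
  q : Fin (g + g) → SympLattice ℓ g
  spec : ∀ (j : Fin (g + g)) (γ : Tors (DualGroup X.carrier) (ℓ ^ n)),
    (∀ v, (γ : DualGroup X.carrier) (f v) =
      padicCircle ℓ n (symp v ((ℓ : ℤ_[ℓ]) ^ (n - B.m j) • B.x j))) → (X.ψ γ : X.carrier) = f (q j)
  q_eq_zero : ∀ j, B.k j = 0 → q j = 0

theorem nonempty_psiLift (hs : Function.Surjective f) (B : AdaptedBasis f) :
    Nonempty (PsiLift B) := by
  have h : ∀ j, ∃ q : SympLattice ℓ g, (∀ γ : Tors (DualGroup X.carrier) (ℓ ^ n),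
      (∀ v, (γ : DualGroup X.carrier) (f v) =
        padicCircle ℓ n (symp v ((ℓ : ℤ_[ℓ]) ^ (n - B.m j) • B.x j))) →
        (X.ψ γ : X.carrier) = f q) ∧ (B.k j = 0 → q = 0) := by
    intro j
    by_cases hj : B.k j = 0
    -- When k_j = 0 the j-th generator is trivial. Choosing the lift 0, and not merely an element of
    -- ker f, removes this index from the later formulas.
    · refine ⟨0, fun γ hγ => ?_, fun _ => rfl⟩
      have : γ = 0 := torsChar_ext hs fun v => by
        rw [hγ, AdaptedBasis.m, hj, Nat.zero_min, Nat.sub_zero, symp_smul_right]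
        exact (padicCircle_eq_zero_iff _ _).2 (Dvd.intro _ rfl)
      rw [this, map_zero, map_zero]
      rfl
    · obtain ⟨γ₀, hγ₀⟩ := B.exists_char hs j
      obtain ⟨q, hq⟩ := hs (X.ψ γ₀)
      refine ⟨q, fun γ hγ => ?_, fun h => absurd h hj⟩
      rw [hq, torsChar_ext hs (γ := γ) (γ' := γ₀) fun v => by rw [hγ, hγ₀]]
  choose q h1 h2 using h
  exact ⟨⟨q, h1, h2⟩⟩

namespace PsiLift

variable {B : AdaptedBasis f} (Q : PsiLift B)

theorem pow_smul_eq_zero (hs : Function.Surjective f) (j : Fin (g + g)) :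
    ℓ ^ B.m j • f (Q.q j) = 0 := by
  obtain ⟨γ, hγ⟩ := B.exists_char hs j
  rw [← Q.spec j γ hγ, ← AddSubgroup.coe_nsmul, ← map_nsmul]
  have : ℓ ^ B.m j • γ = 0 := torsChar_ext hs fun v => by
    change ℓ ^ B.m j • (γ : DualGroup X.carrier) (f v) = 0
    rw [hγ, nsmul_padicCircle, symp_smul_right, ← mul_assoc, Nat.cast_pow, ← pow_add,
      Nat.add_sub_cancel' (B.m_le j), padicCircle_eq_zero_iff]
    exact Dvd.intro _ rfl
  rw [this, map_zero]
  rfl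

theorem dvd (hs : Function.Surjective f) (i j : Fin (g + g)) :
    (ℓ : ℤ_[ℓ]) ^ B.k i ∣ (ℓ : ℤ_[ℓ]) ^ B.m j * symp (B.x i) (Q.q j) := by
  rw [← symp_smul_right]
  refine (B.map_eq_zero_iff _).1 ?_ i
  rw [← Q.pow_smul_eq_zero hs j, ← map_nsmul, ← Nat.cast_smul_eq_nsmul ℤ_[ℓ], Nat.cast_pow]

end PsiLift

/-- `⟨x_i, A x_j⟩`. -/
def pairEntry (B : AdaptedBasis f) (M : skewSymplectic ℓ g) (i j : Fin (g + g)) : ℤ_[ℓ] :=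
  symp (B.x i) (shifted n M.1 (B.x j))

theorem pairEntry_swap (B : AdaptedBasis f) (M : skewSymplectic ℓ g) (i j : Fin (g + g)) :
    pairEntry B M i j = pairEntry B M j i + 2 * (ℓ : ℤ_[ℓ]) ^ n * symp (B.x i) (B.x j) := by
  rw [← symp_shifted_add M, pairEntry, pairEntry, symp_swap (B.x j)]
  ring

/-- The characters x_j/ℓ^{m_j} generate X^∨[ℓ^n], so only they need testing: the condition is that A
x_j = ℓ^{m_j} u_j with f(u_j) = f(q_j). Pairing with x_i expresses both divisibility and equality as
one congruence modulo ℓ^{k_i + m_j}. -/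
theorem isPush_iff_forall (hs : Function.Surjective f) (hω : X.ω = omegaSum f)
    (B : AdaptedBasis f) (Q : PsiLift B) (M : skewSymplectic ℓ g) :
    IsPush M.1 X f ↔ ∀ i j, (ℓ : ℤ_[ℓ]) ^ (B.k i + B.m j) ∣
      pairEntry B M i j - (ℓ : ℤ_[ℓ]) ^ B.m j * symp (B.x i) (Q.q j) := by
  constructor
  · intro h i j
    obtain ⟨γ, hγ⟩ := B.exists_char hs j
    obtain ⟨u, hu⟩ := exists_shifted_div_of_char M h.map_shifted hγ
    have h1 := h.psi_eq γ _ u hγ hu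
    have hu' : (ℓ : ℤ_[ℓ]) ^ B.m j • u = shifted n M.1 (B.x j) := by
      refine pow_smul_cancel (N := n - B.m j) ?_
      rw [smul_smul, ← pow_add, Nat.sub_add_cancel (B.m_le j), hu, map_smul]
    rw [Q.spec j γ hγ, eq_comm, ← sub_eq_zero, ← map_sub] at h1
    have h2 := (B.map_eq_zero_iff _).1 h1 i
    rw [pairEntry, ← hu', symp_smul_right, ← mul_sub, ← symp_sub_right, pow_add, mul_comm]
    exact mul_dvd_mul_left _ h2
  · intro h
    have hu : ∀ j, ∃ u, (ℓ : ℤ_[ℓ]) ^ B.m j • u = shifted n M.1 (B.x j) ∧ f u = f (Q.q j) := by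
      intro j
      have hd : ∀ i, (ℓ : ℤ_[ℓ]) ^ B.m j ∣ pairEntry B M i j := fun i => by
        have h1 : (ℓ : ℤ_[ℓ]) ^ B.m j ∣
            pairEntry B M i j - (ℓ : ℤ_[ℓ]) ^ B.m j * symp (B.x i) (Q.q j) :=
          (pow_dvd_pow _ (Nat.le_add_left _ _)).trans (h i j)
        exact (dvd_sub_left (Dvd.intro _ rfl)).1 h1
      choose c hc using hd
      have hu : (ℓ : ℤ_[ℓ]) ^ B.m j • (∑ i, c i • B.b i) = shifted n M.1 (B.x j) := by
        rw [eq_sum_basis B.b (shifted n M.1 (B.x j)), Finset.smul_sum]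
        refine Finset.sum_congr rfl fun i _ => ?_
        rw [smul_smul, ← hc]; rfl
      refine ⟨∑ i, c i • B.b i, hu, ?_⟩
      rw [← sub_eq_zero, ← map_sub, B.map_eq_zero_iff]
      intro i
      have h2 := h i j
      rw [pairEntry, ← hu, symp_smul_right, ← mul_sub, ← symp_sub_right, pow_add, mul_comm] at h2
      exact (mul_dvd_mul_iff_left (pow_ne_zero _ padic_prime_ne_zero)).1 h2
    choose u hu1 hu2 using hu
    obtain ⟨e₀, he₀⟩ := exists_forall_pow_nsmul_eq_zero X.isPGroup
    have he : ∀ x : X.carrier, ℓ ^ (e₀ + n) • x = 0 := fun x => by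
      rw [pow_add, mul_comm, mul_smul, he₀, smul_zero]
    refine ⟨fun y => ?_, hω, fun γ w u' hw hu' => ?_⟩
    · have h3 : shifted n M.1 y ∈ kerSubmodule he f := by
        rw [eq_sum_sympDual B.b y, map_sum]
        refine Submodule.sum_mem _ fun j _ => ?_
        rw [map_smul]
        refine Submodule.smul_mem _ _ ?_
        rw [← hu1]
        change f _ = 0
        rw [← Nat.cast_pow, Nat.cast_smul_eq_nsmul, map_nsmul, hu2, Q.pow_smul_eq_zero hs]
      exact h3
    -- The character ⟨·, w⟩/ℓ^n vanishes on ℓ^{k_j} b_j ∈ ker f, which bounds the denominator of the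
    -- j-th coordinate of w/ℓ^n. So w is a combination of the generators.
    · have ht : ∀ j, (ℓ : ℤ_[ℓ]) ^ (n - B.m j) ∣ symp w (B.b j) := by
        intro j
        have h0 : f ((ℓ : ℤ_[ℓ]) ^ B.k j • B.b j) = 0 := by
          rw [B.map_eq_zero_iff]
          intro i
          rw [symp_smul_right, B.symp_x_b]
          split_ifs with hij
          · rw [hij, mul_one]
          · rw [mul_zero]; exact dvd_zero _
        have h1 := hw ((ℓ : ℤ_[ℓ]) ^ B.k j • B.b j)
        rw [h0, map_zero, eq_comm, padicCircle_eq_zero_iff, symp_smul_left] at h1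
        rw [symp_swap, dvd_neg]
        rcases le_total (B.k j) n with hk | hk
        · rw [AdaptedBasis.m, min_eq_left hk]
          have h2 : (ℓ : ℤ_[ℓ]) ^ n = (ℓ : ℤ_[ℓ]) ^ B.k j * (ℓ : ℤ_[ℓ]) ^ (n - B.k j) := by
            rw [← pow_add, Nat.add_sub_cancel' hk]
          rw [h2] at h1
          exact (mul_dvd_mul_iff_left (pow_ne_zero _ padic_prime_ne_zero)).1 h1
        · rw [AdaptedBasis.m, min_eq_right hk, Nat.sub_self, pow_zero]
          exact one_dvd _
      choose t ht using ht
      have hw' : w = ∑ j, t j • ((ℓ : ℤ_[ℓ]) ^ (n - B.m j) • B.x j) := by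
        conv_lhs => rw [eq_sum_sympDual B.b w]
        refine Finset.sum_congr rfl fun j _ => ?_
        rw [ht, smul_smul, mul_comm]
      have hu'' : u' = ∑ j, t j • u j := by
        refine pow_smul_cancel (N := n) ?_
        rw [hu', hw', map_sum, Finset.smul_sum]
        refine Finset.sum_congr rfl fun j _ => ?_
        rw [map_smul, map_smul, ← hu1, smul_smul ((ℓ : ℤ_[ℓ]) ^ (n - B.m j)), ← pow_add,
          Nat.sub_add_cancel (B.m_le j), smul_comm]
      choose γ' hγ' using fun j => B.exists_char hs j
      have hγ : γ = ∑ j, (t j).appr (e₀ + n) • γ' j := by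
        refine torsChar_ext hs fun v => ?_
        rw [hw, hw', symp_sum_right, map_sum, AddSubgroup.val_finsetSum, AddMonoidHom.finsetSum_apply]
        refine Finset.sum_congr rfl fun j _ => ?_
        rw [symp_smul_right, padicCircle_mul_appr (Nat.le_add_left n e₀), ← hγ']
        rfl
      rw [hγ, hu'', map_sum, map_sum, AddSubgroup.val_finsetSum]
      refine Finset.sum_congr rfl fun j _ => ?_
      rw [map_padic_smul he, hu2, ← Q.spec j (γ' j) (hγ' j), map_nsmul]
      rfl

/-- The compatibility of `ψ` and `ω` in coordinates. -/
theorem PsiLift.compat (hs : Function.Surjective f) (hω : X.ω = omegaSum f)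
    {B : AdaptedBasis f} (Q : PsiLift B) {i j : Fin (g + g)} (hij : B.k j ≤ B.k i) :
    (ℓ : ℤ_[ℓ]) ^ (B.k j + B.m i) ∣ (ℓ : ℤ_[ℓ]) ^ B.m i * symp (B.x j) (Q.q i) -
      (ℓ : ℤ_[ℓ]) ^ B.m j * symp (B.x i) (Q.q j) +
        2 * (ℓ : ℤ_[ℓ]) ^ n * symp (B.x i) (B.x j) := by
  -- The axiom is applied to α = x_i/ℓ^{k_i} and β = x_j/ℓ^{k_j}. With this r, ℓ^r α is the i-th
  -- generator of X^∨[ℓ^n] and ℓ^r β is ℓ^d times the j-th, where d ≥ 0 because k_j ≤ k_i.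
  obtain ⟨r, hr⟩ : ∃ r, B.k i = B.m i + r := ⟨_, (Nat.add_sub_cancel' (B.m_le_k i)).symm⟩
  have hin := B.m_le i
  have hjn := B.m_le j
  have hki : B.k i ≤ n + r := by omega
  have hkj : B.k j ≤ n + r := by omega
  obtain ⟨d, hd⟩ : ∃ d, B.m j + r = B.k j + d := by
    have : B.k j - B.m j ≤ B.k i - B.m i := by
      simp only [AdaptedBasis.m]; omega
    have := B.m_le_k j
    exact ⟨B.m j + r - B.k j, by omega⟩
  have hα := exists_zmodChar hs (N := n + r) (w := (ℓ : ℤ_[ℓ]) ^ (n + r - B.k i) • B.x i)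
    fun v hv => by
      rw [symp_smul_right]
      refine dvd_trans ?_ (mul_dvd_mul_left _ (B.dvd_symp_x hv i))
      rw [← pow_add, Nat.sub_add_cancel hki]
  have hβ := exists_zmodChar hs (N := n + r) (w := (ℓ : ℤ_[ℓ]) ^ (n + r - B.k j) • B.x j)
    fun v hv => by
      rw [symp_smul_right]
      refine dvd_trans ?_ (mul_dvd_mul_left _ (B.dvd_symp_x hv j))
      rw [← pow_add, Nat.sub_add_cancel hkj]
  obtain ⟨α, hα⟩ := hα
  obtain ⟨β, hβ⟩ := hβ
  have hψα : (X.ψ (smulToChar α) : X.carrier) = f (Q.q i) := by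
    refine Q.spec i _ fun v => ?_
    change ℓ ^ r • zmodToCircle _ (α (f v)) = _
    rw [hα, ← padicCircle_apply, pow_nsmul_padicCircle]
    congr 4
    omega
  have hψβ : (X.ψ (smulToChar β) : X.carrier) = ℓ ^ d • f (Q.q j) := by
    obtain ⟨γ, hγ⟩ := B.exists_char hs j
    have : smulToChar β = ℓ ^ d • γ := by
      refine torsChar_ext hs fun v => ?_
      change ℓ ^ r • zmodToCircle _ (β (f v)) = ℓ ^ d • (γ : DualGroup X.carrier) (f v)
      rw [hβ, ← padicCircle_apply, pow_nsmul_padicCircle, hγ, nsmul_padicCircle]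
      congr 1
      rw [symp_smul_right, symp_smul_right, ← mul_assoc, Nat.cast_pow, ← pow_add]
      congr 2
      omega
    rw [this, map_nsmul, ← Q.spec j γ hγ]
    rfl
  have hc := X.compat r α β
  rw [hψα, hψβ, hω, tensorPairing_omegaSum f (n + r) α β hα hβ] at hc
  have e1 : toChar β (f (Q.q i)) =
      padicCircle ℓ (n + r) (symp (Q.q i) ((ℓ : ℤ_[ℓ]) ^ (n + r - B.k j) • B.x j)) :=
    congrArg (zmodToCircle _) (hβ _)
  have e2 : toChar α (ℓ ^ d • f (Q.q j)) = padicCircle ℓ (n + r)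
      ((ℓ : ℤ_[ℓ]) ^ d * symp (Q.q j) ((ℓ : ℤ_[ℓ]) ^ (n + r - B.k i) • B.x i)) := by
    rw [map_nsmul, ← Nat.cast_pow, ← nsmul_padicCircle]
    exact congrArg (fun z => ℓ ^ d • zmodToCircle _ z) (hα _)
  rw [e1, e2, ← padicCircle_apply, ← map_nsmul, ← map_add, padicCircle_eq_iff] at hc
  simp only [symp_smul_left, symp_smul_right, nsmul_eq_mul] at hc
  rw [symp_swap (Q.q i), symp_swap (Q.q j)] at hc
  set E := n + r - B.k j with hE
  have h1 : (ℓ : ℤ_[ℓ]) ^ E * (ℓ : ℤ_[ℓ]) ^ (B.k j + B.m i) =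
      (ℓ : ℤ_[ℓ]) ^ B.m i * (ℓ : ℤ_[ℓ]) ^ (n + r) := by
    rw [← pow_add, ← pow_add]; congr 1; omega
  refine (mul_dvd_mul_iff_left (pow_ne_zero E (padic_prime_ne_zero (ℓ := ℓ)))).1 ?_
  rw [h1]
  have h2 := mul_dvd_mul_left ((ℓ : ℤ_[ℓ]) ^ B.m i) hc
  rw [← dvd_neg] at h2
  refine h2.trans (dvd_of_eq ?_)
  have h3 : (ℓ : ℤ_[ℓ]) ^ B.m i * ((ℓ : ℤ_[ℓ]) ^ d * (ℓ : ℤ_[ℓ]) ^ (n + r - B.k i)) =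
      (ℓ : ℤ_[ℓ]) ^ E * (ℓ : ℤ_[ℓ]) ^ B.m j := by
    rw [← pow_add, ← pow_add, ← pow_add]; congr 1; omega
  have h4 : (ℓ : ℤ_[ℓ]) ^ B.m i * (ℓ : ℤ_[ℓ]) ^ (n + r - B.k i) = (ℓ : ℤ_[ℓ]) ^ n := by
    rw [← pow_add]; congr 1; omega
  push_cast
  linear_combination (-symp (B.x i) (Q.q j)) * h3 +
    (2 * (ℓ : ℤ_[ℓ]) ^ E * symp (B.x i) (B.x j)) * h4

/-- Exchanging i and j changes the entry of A and the prescribed value by the same 2ℓ^n ⟨x_i, x_j⟩,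
the former by A + A* = 2ℓ^n and the latter by the BEG axiom. Since k is increasing, the congruence
that is kept has the larger modulus. -/
theorem isPush_iff_forall_le (hs : Function.Surjective f) (hω : X.ω = omegaSum f)
    (B : AdaptedBasis f) (Q : PsiLift B) (M : skewSymplectic ℓ g) :
    IsPush M.1 X f ↔ ∀ i j, i ≤ j → (ℓ : ℤ_[ℓ]) ^ (B.k j + B.m i) ∣
      pairEntry B M j i - (ℓ : ℤ_[ℓ]) ^ B.m i * symp (B.x j) (Q.q i) := by
  rw [isPush_iff_forall hs hω B Q M]
  refine ⟨fun h i j _ => h j i, fun h i j => ?_⟩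
  rcases le_total j i with hij | hij
  · exact h j i hij
  · have h1 := Q.compat hs hω (i := j) (j := i) (B.mono hij)
    have h2 : B.k i + B.m j ≤ B.k j + B.m i := by
      have := B.mono hij
      simp only [AdaptedBasis.m]; omega
    have h3 := dvd_sub ((pow_dvd_pow _ h2).trans (h i j hij)) h1
    refine h3.trans (dvd_of_eq ?_)
    rw [pairEntry_swap B M i j, symp_swap (B.x j) (B.x i)]
    ring

end PushCoordinates

/-! ### Averages over matrices over a finite field -/

section FiniteFieldAverages

open scoped BigOperators

theorem expect_comp_of_surjective {A B : Type*} [AddGroup A] [AddGroup B] [Fintype A] [Fintype B]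
    (φ : A →+ B) (hφ : Function.Surjective φ) (f : B → ℝ) : 𝔼 a, f (φ a) = 𝔼 b, f b := by
  classical
  have hfib : ∀ b, (Finset.univ.filter fun a => φ a = b).card =
      (Finset.univ.filter fun a => φ a = 0).card := fun b =>
    AddMonoidHom.card_fiber_eq_of_mem_range φ (hφ b) (hφ 0)
  have hsum : ∀ h : B → ℝ, ∑ a, h (φ a) =
      ((Finset.univ.filter fun a => φ a = 0).card : ℝ) * ∑ b, h b := by
    intro h
    rw [← Finset.sum_fiberwise (s := Finset.univ) (g := φ), Finset.mul_sum]
    refine Finset.sum_congr rfl fun b _ => ?_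
    rw [Finset.sum_congr rfl (g := fun _ => h b) (fun a ha => by rw [(Finset.mem_filter.1 ha).2]),
      Finset.sum_const, nsmul_eq_mul, hfib]
  have hcard := hsum fun _ => 1
  simp only [Finset.sum_const, nsmul_eq_mul, mul_one, Finset.card_univ] at hcard
  rw [Fintype.expect_eq_sum_div_card, Fintype.expect_eq_sum_div_card, hsum, hcard]
  refine mul_div_mul_left _ _ (Nat.cast_ne_zero.2 (Finset.card_pos.2 ⟨0, ?_⟩).ne')
  simp

variable {F : Type} [Field F] [Fintype F] {κ : Type} [Fintype κ] [DecidableEq κ]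

/-- The vectors of `W` that are orthogonal to all `θ i`. -/
def perp {ι : Type} (W : Submodule F (κ → F)) (θ : ι → κ → F) : Submodule F (κ → F) :=
  W ⊓ LinearMap.ker (Matrix.mulVecLin (Matrix.of θ))

theorem mem_perp {ι : Type} {W : Submodule F (κ → F)} {θ : ι → κ → F} {w : κ → F} :
    w ∈ perp W θ ↔ w ∈ W ∧ ∀ i, θ i ⬝ᵥ w = 0 := by
  rw [perp, Submodule.mem_inf, LinearMap.mem_ker, funext_iff]
  rfl

/-- The dimension of `perp W θ`. -/
def perpDim {ι : Type} (W : Submodule F (κ → F)) (θ : ι → κ → F) : ℕ :=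
  Module.finrank F (perp W θ)

theorem perp_cons (W : Submodule F (κ → F)) {s : ℕ} (u : κ → F) (θ : Fin s → κ → F) :
    perp W (Fin.cons u θ : Fin (s + 1) → κ → F) = perp (perp W θ) fun _ : Unit => u := by
  ext w
  simp only [mem_perp, Fin.forall_fin_succ, Fin.cons_zero, Fin.cons_succ]
  tauto

/-- Evaluation of functionals on `W`. -/
def dotDual (W : Submodule F (κ → F)) : (κ → F) →+ Module.Dual F W :=
  AddMonoidHom.mk' (fun u => (dotProductBilin F F u).comp W.subtype) fun u v => by
    ext w
    exact add_dotProduct _ _ _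

theorem dotDual_apply (W : Submodule F (κ → F)) (u : κ → F) (w : W) :
    dotDual W u w = u ⬝ᵥ (w : κ → F) := rfl

theorem dotDual_surjective (W : Submodule F (κ → F)) : Function.Surjective (dotDual W) := by
  classical
  intro η
  obtain ⟨η', h⟩ := LinearMap.exists_extend η
  refine ⟨fun i => η' (Pi.single i 1), LinearMap.ext fun w => ?_⟩
  rw [dotDual_apply, ← h, LinearMap.comp_apply, Submodule.subtype_apply,
    LinearMap.pi_apply_eq_sum_univ η' (w : κ → F)]
  refine Finset.sum_congr rfl fun i _ => ?_
  have h1 : (Pi.single i 1 : κ → F) = fun j => if i = j then 1 else 0 := by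
    ext j
    simp [Pi.single_apply, eq_comm]
  rw [smul_eq_mul, mul_comm]
  exact congrArg (fun z => (w : κ → F) i * η' z) h1

theorem finrank_perp_unit (W : Submodule F (κ → F)) (u : κ → F) :
    perpDim W (fun _ : Unit => u) =
      Module.finrank F (LinearMap.ker (dotDual W u)) := by
  have : perp W (fun _ : Unit => u) = Submodule.map W.subtype (LinearMap.ker (dotDual W u)) := by
    ext w
    rw [mem_perp, Submodule.mem_map]
    constructor
    · rintro ⟨hw, h⟩
      exact ⟨⟨w, hw⟩, h (), rfl⟩
    · rintro ⟨w', h, rfl⟩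
      exact ⟨w'.2, fun _ => h⟩
  rw [perpDim, this, Submodule.finrank_map_subtype_eq]

/-- A uniform u restricts to a uniform functional on W: it is zero with probability q^{-dim W}, and
otherwise its kernel is a hyperplane. -/
theorem expect_finrank_perp_unit (W : Submodule F (κ → F)) (ψ : ℕ → ℝ) :
    𝔼 u : κ → F, ψ (perpDim W fun _ : Unit => u) =
      (Fintype.card F : ℝ)⁻¹ ^ Module.finrank F W * ψ (Module.finrank F W) +
        (1 - (Fintype.card F : ℝ)⁻¹ ^ Module.finrank F W) * ψ (Module.finrank F W - 1) := by
  classical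
  have : Finite (Module.Dual F W) := Module.finite_of_finite F
  have := Fintype.ofFinite (Module.Dual F W)
  simp_rw [finrank_perp_unit]
  rw [expect_comp_of_surjective (dotDual W) (dotDual_surjective W)
    fun η => ψ (Module.finrank F (LinearMap.ker η)), Fintype.expect_eq_sum_div_card]
  have hcard : (Fintype.card (Module.Dual F W) : ℝ) =
      (Fintype.card F : ℝ) ^ Module.finrank F W := by
    rw [← Nat.card_eq_fintype_card, Module.natCard_eq_pow_finrank (K := F),
      Subspace.dual_finrank_eq, Nat.card_eq_fintype_card, Nat.cast_pow]
  have hq : (Fintype.card F : ℝ) ≠ 0 := Nat.cast_ne_zero.2 Fintype.card_ne_zero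
  rw [← Finset.add_sum_erase _ _ (Finset.mem_univ (0 : Module.Dual F W))]
  have h1 : ∀ η ∈ Finset.univ.erase (0 : Module.Dual F W),
      ψ (Module.finrank F (LinearMap.ker η)) = ψ (Module.finrank F W - 1) := by
    intro η hη
    rw [← Module.Dual.finrank_ker_add_one_of_ne_zero (Finset.ne_of_mem_erase hη),
      Nat.add_sub_cancel]
  rw [Finset.sum_congr rfl h1, Finset.sum_const, Finset.card_erase_of_mem (Finset.mem_univ _),
    Finset.card_univ, LinearMap.ker_zero, finrank_top, nsmul_eq_mul,
    Nat.cast_sub (Nat.one_le_iff_ne_zero.2 Fintype.card_ne_zero), hcard, inv_pow]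
  field_simp
  push_cast
  ring

theorem expect_perp_succ (W : Submodule F (κ → F)) (s : ℕ) (ψ : ℕ → ℝ) :
    𝔼 θ : Fin (s + 1) → κ → F, ψ (perpDim W θ) =
      𝔼 θ : Fin s → κ → F,
        ((Fintype.card F : ℝ)⁻¹ ^ perpDim W θ * ψ (perpDim W θ) +
          (1 - (Fintype.card F : ℝ)⁻¹ ^ perpDim W θ) *
            ψ (perpDim W θ - 1)) := by
  let e : (κ → F) × (Fin s → κ → F) ≃ (Fin (s + 1) → κ → F) :=
    Fin.consEquiv fun _ => κ → F
  have h1 := Fintype.expect_equiv e (fun p => ψ (perpDim (perp W p.2) fun _ : Unit => p.1))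
    (fun θ => ψ (perpDim W θ)) fun p => by
      rw [perpDim, ← perp_cons]; rfl
  rw [← h1]
  refine (Finset.expect_product (Finset.univ : Finset (κ → F))
    (Finset.univ : Finset (Fin s → κ → F)) _).trans ?_
  rw [Finset.expect_comm]
  exact Finset.expect_congr rfl fun θ _ => expect_finrank_perp_unit (perp W θ) ψ

theorem perpDim_finZero (W : Submodule F (κ → F)) (θ : Fin 0 → κ → F) :
    perpDim W θ = Module.finrank F W := by
  have : perp W θ = W := by
    ext w
    simp [mem_perp]
  rw [perpDim, this]

theorem surjWeight_unit_step (x : ℝ) (t d : ℕ) :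
    x ^ d * surjWeight x t d + (1 - x ^ d) * surjWeight x t (d - 1) = surjWeight x (t + 1) d := by
  cases d with
  | zero => simp [surjWeight_zero]
  | succ d => exact surjWeight_step x t d

/-- Each random functional raises t by one, by the same recursion as for random quotients. For t = 0
the left side is the probability that s functionals separate the points of W. -/
theorem expect_surjWeight_perp (W : Submodule F (κ → F)) (s t : ℕ) :
    𝔼 θ : Fin s → κ → F, surjWeight (Fintype.card F : ℝ)⁻¹ t (perpDim W θ) =
      surjWeight (Fintype.card F : ℝ)⁻¹ (t + s) (Module.finrank F W) := by
  induction s generalizing t with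
  | zero => simp only [perpDim_finZero, Fintype.expect_const, Nat.add_zero]
  | succ s ih =>
    rw [expect_perp_succ]
    simp_rw [surjWeight_unit_step]
    rw [ih, Nat.add_right_comm, Nat.add_assoc]

theorem surjWeight_shift_step (x : ℝ) (t r d : ℕ) :
    x ^ d * surjWeight x t (r + 1 + d) + (1 - x ^ d) * surjWeight x t (r + 1 + (d - 1)) =
      (1 - x ^ (t - r)) * surjWeight x t (r + d) := by
  cases d with
  | zero => simp [surjWeight_succ, mul_comm]
  | succ d =>
    rw [Nat.add_sub_cancel, show r + 1 + (d + 1) = r + 1 + d + 1 by ring,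
      show r + (d + 1) = r + 1 + d by ring, surjWeight_succ]
    rcases lt_or_ge t (r + 1 + d) with h | h
    · rw [surjWeight_eq_zero h]; ring
    · have : x ^ (t - r) = x ^ (d + 1) * x ^ (t - (r + 1 + d)) := by
        rw [← pow_add]; congr 1; omega
      rw [this]; ring

/-- Removing one functional while lowering the offset by one costs the factor 1 - x^{t-r}, which
does not depend on the dimension that is left. Hence the offset and W decouple. -/
theorem expect_surjWeight_add_perp (W : Submodule F (κ → F)) (s t : ℕ) :
    𝔼 θ : Fin s → κ → F, surjWeight (Fintype.card F : ℝ)⁻¹ t (s + perpDim W θ) =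
      surjWeight (Fintype.card F : ℝ)⁻¹ t s *
        surjWeight (Fintype.card F : ℝ)⁻¹ t (Module.finrank F W) := by
  induction s with
  | zero => simp only [perpDim_finZero, Fintype.expect_const, surjWeight_zero, one_mul, Nat.zero_add]
  | succ s ih =>
    rw [expect_perp_succ W s fun d => surjWeight (Fintype.card F : ℝ)⁻¹ t (s + 1 + d)]
    simp_rw [surjWeight_shift_step]
    rw [← Finset.mul_expect, ih, surjWeight_succ]
    ring

/-! ### Symmetric matrices -/

/-- The group of symmetric matrices. -/
def symMatrix (κ : Type) [Fintype κ] [DecidableEq κ] (F : Type) [Field F] : AddSubgroup (Matrix κ κ F) where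
  carrier := {S | S.IsSymm}
  add_mem' := fun ha hb => ha.add hb
  zero_mem' := Matrix.isSymm_zero
  neg_mem' := fun ha => ha.neg

instance : Fintype (symMatrix κ F) :=
  have : Finite (Matrix κ κ F) := inferInstanceAs (Finite (κ → κ → F))
  Fintype.ofFinite _

/-- A bordered symmetric matrix. -/
def borderEquiv (κ : Type) [Fintype κ] [DecidableEq κ] (F : Type) [Field F] :
    (F × (κ → F)) × symMatrix κ F ≃ symMatrix (Unit ⊕ κ) F where
  toFun p := ⟨Matrix.fromBlocks (Matrix.of fun _ _ => p.1.1) (Matrix.of fun _ i => p.1.2 i)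
    (Matrix.of fun i _ => p.1.2 i) p.2.1,
    Matrix.IsSymm.fromBlocks (by ext; rfl) (by ext; rfl) p.2.2⟩
  invFun S := ⟨⟨S.1 (Sum.inl ()) (Sum.inl ()), fun i => S.1 (Sum.inr i) (Sum.inl ())⟩,
    S.1.toBlocks₂₂, by
      have := S.2
      ext i j
      exact congrFun (congrFun this (Sum.inr i)) (Sum.inr j)⟩
  left_inv p := rfl
  right_inv S := by
    refine Subtype.ext (Matrix.ext ?_)
    rintro (i | i) (j | j)
    · rfl
    · exact congrFun (congrFun S.2 (Sum.inl i)) (Sum.inr j)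
    · rfl
    · rfl

/-- The average of `surjWeight` over the coranks of symmetric matrices. -/
def symAverage (κ : Type) [Fintype κ] [DecidableEq κ] (F : Type) [Field F] [Fintype F] (t : ℕ) : ℝ :=
  𝔼 S : symMatrix κ F, surjWeight (Fintype.card F : ℝ)⁻¹ t
    (Module.finrank F (LinearMap.ker S.1.mulVecLin))

/-- `[S | θ]` has full row rank. -/
def FullRowRank {t : ℕ} (S : Matrix κ κ F) (θ : Fin t → κ → F) : Prop :=
  ∀ w, S.mulVec w = 0 → (∀ i, θ i ⬝ᵥ w = 0) → w = 0

open Classical in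
-- c_t of the corank is itself a probability, namely that t random extra rows cut the kernel of S to
-- zero. This form is the one that can be computed by bordering.
theorem symAverage_eq (t : ℕ) : symAverage κ F t =
    𝔼 S : symMatrix κ F, 𝔼 θ : Fin t → κ → F, if FullRowRank S.1 θ then 1 else 0 := by
  refine Finset.expect_congr rfl fun S _ => ?_
  have h := expect_surjWeight_perp (LinearMap.ker S.1.mulVecLin) t 0
  rw [Nat.zero_add] at h
  rw [← h]
  refine Finset.expect_congr rfl fun θ _ => ?_
  have h1 : FullRowRank S.1 θ ↔ perpDim (LinearMap.ker S.1.mulVecLin) θ = 0 := by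
    rw [perpDim, Submodule.finrank_eq_zero, Submodule.eq_bot_iff]
    refine forall_congr' fun w => ?_
    rw [mem_perp, and_imp]
    rfl
  split_ifs with h2
  · rw [h1.1 h2, surjWeight_zero]
  · rw [surjWeight_eq_zero (Nat.pos_of_ne_zero fun h => h2 (h1.2 h))]

end FiniteFieldAverages

/-! ### Bordering a symmetric matrix: the recurrence for the averages. -/

section SymmetricAverages

open scoped BigOperators

variable {F : Type} [Field F] [Fintype F] {κ : Type} [Fintype κ] [DecidableEq κ]

theorem border_mulVec_eq_zero (p : F × (κ → F)) (S : symMatrix κ F) (y : F) (w : κ → F) :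
    (borderEquiv κ F (p, S)).1.mulVec (Sum.elim (fun _ => y) w) = 0 ↔
      p.1 * y + p.2 ⬝ᵥ w = 0 ∧ S.1.mulVec w = -(y • p.2) := by
  have h : (borderEquiv κ F (p, S)).1.mulVec (Sum.elim (fun _ => y) w) =
      Sum.elim (fun _ => p.1 * y + p.2 ⬝ᵥ w) (y • p.2 + S.1.mulVec w) := by
    refine (Matrix.fromBlocks_mulVec _ _ _ _ _).trans ?_
    congr 1
    · ext; simp [Matrix.mulVec, dotProduct]
    · ext i; simp [Matrix.mulVec, dotProduct, mul_comm]
  rw [h]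
  constructor
  · intro h0
    refine ⟨congrFun h0 (Sum.inl ()), ?_⟩
    rw [eq_neg_iff_add_eq_zero, add_comm]
    exact funext fun i => congrFun h0 (Sum.inr i)
  · rintro ⟨h1, h2⟩
    rw [h1, h2, add_neg_cancel]
    ext (i | i) <;> rfl

theorem symMatrix_mulVec_dotProduct (S : symMatrix κ F) (w w' : κ → F) :
    S.1.mulVec w ⬝ᵥ w' = w ⬝ᵥ S.1.mulVec w' := by
  rw [Matrix.dotProduct_mulVec, ← Matrix.mulVec_transpose, S.2]

/-- `θ` with the entries `n` added in front. -/
def borderRows {t : ℕ} (n : Fin t → F) (θ : Fin t → κ → F) : Fin t → Unit ⊕ κ → F :=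
  fun i => Sum.elim (fun _ => n i) (θ i)

theorem borderRows_dotProduct {t : ℕ} (n : Fin t → F) (θ : Fin t → κ → F) (i : Fin t) (y : F)
    (w : κ → F) : borderRows n θ i ⬝ᵥ Sum.elim (fun _ => y) w = n i * y + θ i ⬝ᵥ w := by
  simp [borderRows, dotProduct, Fintype.sum_sum_type]

/-- The entries `p`, `n` of the new row of a bordered matrix are given by minus the combination of
the other rows with coefficients `w`. -/
def IsRowCombination {t : ℕ} (S : Matrix κ κ F) (θ : Fin t → κ → F) (w : κ → F)
    (p : F × (κ → F)) (n : Fin t → F) : Prop :=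
  S.mulVec w = -p.2 ∧ p.1 + p.2 ⬝ᵥ w = 0 ∧ ∀ i, n i + θ i ⬝ᵥ w = 0

theorem fullRowRank_cons {t : ℕ} (S : Matrix κ κ F) (v : κ → F) (θ : Fin t → κ → F) :
    FullRowRank S (Fin.cons v θ : Fin (t + 1) → κ → F) ↔
      ∀ w, S.mulVec w = 0 → v ⬝ᵥ w = 0 → (∀ i, θ i ⬝ᵥ w = 0) → w = 0 := by
  simp only [FullRowRank, Fin.forall_fin_succ, Fin.cons_zero, Fin.cons_succ, and_imp]

/-- Split a kernel vector by its entry y at the new index. For y = 0 the bordering vector `p.2` acts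
as one more row next to θ; for y ≠ 0 rescale to y = 1. -/
theorem fullRowRank_border_iff {t : ℕ} (p : F × (κ → F)) (S : symMatrix κ F) (n : Fin t → F)
    (θ : Fin t → κ → F) :
    FullRowRank (borderEquiv κ F (p, S)).1 (borderRows n θ) ↔
      FullRowRank S.1 (Fin.cons p.2 θ : Fin (t + 1) → κ → F) ∧
        ¬ ∃ w, IsRowCombination S.1 θ w p n := by
  rw [fullRowRank_cons]
  constructor
  · intro h
    refine ⟨fun w h1 h2 h3 => ?_, ?_⟩
    · have h4 := h (Sum.elim (fun _ => 0) w)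
        ((border_mulVec_eq_zero p S 0 w).2 ⟨by rw [h2, mul_zero, add_zero],
          by rw [h1, zero_smul, neg_zero]⟩) fun i => by
          rw [borderRows_dotProduct, h3, mul_zero, add_zero]
      exact funext fun i => congrFun h4 (Sum.inr i)
    · rintro ⟨w, h1, h2, h3⟩
      have h4 := h (Sum.elim (fun _ => 1) w)
        ((border_mulVec_eq_zero p S 1 w).2 ⟨by rw [mul_one, h2], by rw [h1, one_smul]⟩) fun i => by
          rw [borderRows_dotProduct, mul_one, h3]
      exact one_ne_zero (congrFun h4 (Sum.inl ()))
  · rintro ⟨h, h'⟩ z h1 h2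
    obtain ⟨y, w, rfl⟩ : ∃ (y : F) (w : κ → F), z = Sum.elim (fun _ => y) w :=
      ⟨z (Sum.inl ()), fun i => z (Sum.inr i), by ext (i | i) <;> rfl⟩
    simp only [borderRows_dotProduct] at h2
    rw [border_mulVec_eq_zero] at h1
    by_cases hy : y = 0
    · subst hy
      have : w = 0 := h w (by rw [h1.2, zero_smul, neg_zero]) (by simpa using h1.1)
        fun i => by simpa using h2 i
      rw [this]
      ext (i | i) <;> rfl
    · refine absurd ⟨y⁻¹ • w, ?_, ?_, fun i => ?_⟩ h'
      · rw [Matrix.mulVec_smul, h1.2, smul_neg, smul_smul, inv_mul_cancel₀ hy, one_smul]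
      · refine mul_left_cancel₀ hy ?_
        rw [dotProduct_smul, smul_eq_mul, mul_add, mul_inv_cancel_left₀ hy, mul_zero, mul_comm]
        exact h1.1
      · refine mul_left_cancel₀ hy ?_
        rw [dotProduct_smul, smul_eq_mul, mul_add, mul_inv_cancel_left₀ hy, mul_zero, mul_comm]
        exact h2 i

/-- By symmetry v = -Sw lies in the row space of S, so orthogonality to v is automatic on ker S. -/
theorem fullRowRank_cons_of_mulVec {t : ℕ} (S : symMatrix κ F) (θ : Fin t → κ → F) {v w : κ → F}
    (hw : S.1.mulVec w = -v) :
    FullRowRank S.1 (Fin.cons v θ : Fin (t + 1) → κ → F) ↔ FullRowRank S.1 θ := by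
  rw [fullRowRank_cons]
  refine ⟨fun h w' h1 h2 => h w' h1 ?_ h2, fun h w' h1 _ h2 => h w' h1 h2⟩
  rw [← neg_eq_zero, ← neg_dotProduct, ← hw, symMatrix_mulVec_dotProduct, h1, dotProduct_zero]

theorem IsRowCombination.unique {t : ℕ} {S : Matrix κ κ F} {θ : Fin t → κ → F} {w w' : κ → F}
    {p : F × (κ → F)} {n : Fin t → F}
    (h : FullRowRank S (Fin.cons p.2 θ : Fin (t + 1) → κ → F))
    (h1 : IsRowCombination S θ w p n) (h2 : IsRowCombination S θ w' p n) : w = w' := by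
  rw [fullRowRank_cons] at h
  rw [← sub_eq_zero]
  refine h _ ?_ ?_ fun i => ?_
  · rw [Matrix.mulVec_sub, h1.1, h2.1, sub_self]
  · rw [dotProduct_sub]
    linear_combination h1.2.1 - h2.2.1
  · rw [dotProduct_sub]
    linear_combination h1.2.2 i - h2.2.2 i

open Classical in
-- Under the full rank condition the combination w is unique, so the sum over w is the indicator of
-- its existence. Summing over w makes the later average a count for each fixed w.
theorem indicator_fullRowRank_border {t : ℕ} (p : F × (κ → F)) (S : symMatrix κ F) (n : Fin t → F)
    (θ : Fin t → κ → F) :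
    (if FullRowRank (borderEquiv κ F (p, S)).1 (borderRows n θ) then (1 : ℝ) else 0) =
      (if FullRowRank S.1 (Fin.cons p.2 θ : Fin (t + 1) → κ → F) then 1 else 0) -
        ∑ w, if IsRowCombination S.1 θ w p n then (if FullRowRank S.1 θ then 1 else 0) else 0 := by
  by_cases h : FullRowRank S.1 (Fin.cons p.2 θ : Fin (t + 1) → κ → F)
  · by_cases h' : ∃ w, IsRowCombination S.1 θ w p n
    · obtain ⟨w, hw⟩ := h'
      rw [if_neg fun h0 => ((fullRowRank_border_iff p S n θ).1 h0).2 ⟨w, hw⟩, if_pos h,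
        Finset.sum_eq_single w, if_pos hw, if_pos ((fullRowRank_cons_of_mulVec S θ hw.1).1 h),
        sub_self]
      · intro w' _ hne
        rw [if_neg fun hw' => hne (hw'.unique h hw)]
      · simp
    · rw [if_pos ((fullRowRank_border_iff p S n θ).2 ⟨h, h'⟩), if_pos h, Finset.sum_eq_zero,
        sub_zero]
      exact fun w _ => if_neg fun hw => h' ⟨w, hw⟩
  · rw [if_neg fun h0 => h ((fullRowRank_border_iff p S n θ).1 h0).1, if_neg h,
      Finset.sum_eq_zero, sub_zero]
    intro w _
    split_ifs with h1 h2
    · exact absurd ((fullRowRank_cons_of_mulVec S θ h1.1).2 h2) h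
    · rfl
    · rfl

open Classical in
-- Each w determines the 1 + |κ| + t new entries completely, and there are q^{|κ|} choices of w.
theorem expect_isRowCombination {t : ℕ} (S : Matrix κ κ F) (θ : Fin t → κ → F) (c : ℝ) :
    𝔼 z : (F × (κ → F)) × (Fin t → F),
      ∑ w, (if IsRowCombination S θ w z.1 z.2 then c else 0) =
        (Fintype.card F : ℝ)⁻¹ ^ (t + 1) * c := by
  rw [Fintype.expect_eq_sum_div_card, Finset.sum_comm]
  have h : ∀ w : κ → F, ∑ z : (F × (κ → F)) × (Fin t → F),
      (if IsRowCombination S θ w z.1 z.2 then c else 0) = c := by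
    intro w
    rw [Finset.sum_eq_single ((S.mulVec w ⬝ᵥ w, -S.mulVec w), fun i => -(θ i ⬝ᵥ w)), if_pos]
    · refine ⟨(neg_neg _).symm, ?_, fun i => neg_add_cancel _⟩
      change S.mulVec w ⬝ᵥ w + -S.mulVec w ⬝ᵥ w = 0
      rw [neg_dotProduct, add_neg_cancel]
    · rintro ⟨⟨a, v⟩, n⟩ _ hne
      refine if_neg fun hz => hne ?_
      obtain ⟨h1, h2, h3⟩ := hz
      have hv : v = -S.mulVec w := by rw [h1, neg_neg]
      refine Prod.ext (Prod.ext ?_ hv) (funext fun i => eq_neg_of_add_eq_zero_left (h3 i))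
      refine (eq_neg_of_add_eq_zero_left h2).trans ?_
      change -(v ⬝ᵥ w) = S.mulVec w ⬝ᵥ w
      rw [hv, neg_dotProduct, neg_neg]
    · simp
  rw [Finset.sum_congr rfl fun w _ => h w]
  have hq : (Fintype.card F : ℝ) ≠ 0 := Nat.cast_ne_zero.2 Fintype.card_ne_zero
  simp only [Finset.sum_const, nsmul_eq_mul, Finset.card_univ, Fintype.card_prod, Fintype.card_fun,
    Fintype.card_fin, inv_pow]
  push_cast
  field_simp
  ring

/-- Splitting off the first row. -/
def borderRowsEquiv (κ : Type) (F : Type) (t : ℕ) :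
    (Fin t → F) × (Fin t → κ → F) ≃ (Fin t → Unit ⊕ κ → F) where
  toFun p := fun i => Sum.elim (fun _ => p.1 i) (p.2 i)
  invFun z := (fun i => z i (Sum.inl ()), fun i j => z i (Sum.inr j))
  left_inv p := rfl
  right_inv z := by
    ext i (j | j) <;> rfl

theorem symAverage_border (t : ℕ) : symAverage (Unit ⊕ κ) F t =
    symAverage κ F (t + 1) - (Fintype.card F : ℝ)⁻¹ ^ (t + 1) * symAverage κ F t := by
  classical
  let G : (F × (κ → F)) → symMatrix κ F → (Fin t → F) → (Fin t → κ → F) → ℝ := fun p S n θ =>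
    if FullRowRank (borderEquiv κ F (p, S)).1 (borderRows n θ) then 1 else 0
  have h1 : symAverage (Unit ⊕ κ) F t = 𝔼 S, 𝔼 θ, 𝔼 z : (F × (κ → F)) × (Fin t → F),
      G z.1 S z.2 θ := by
    have hr : ∀ S : symMatrix (Unit ⊕ κ) F,
        (𝔼 θ : Fin t → Unit ⊕ κ → F, if FullRowRank S.1 θ then (1 : ℝ) else 0) =
          𝔼 n : Fin t → F, 𝔼 θ : Fin t → κ → F,
            if FullRowRank S.1 (borderRows n θ) then (1 : ℝ) else 0 := by
      intro S
      rw [← Fintype.expect_equiv (borderRowsEquiv κ F t)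
        (fun p => if FullRowRank S.1 (borderRows p.1 p.2) then (1 : ℝ) else 0) _ fun p => rfl]
      exact Finset.expect_product (Finset.univ : Finset (Fin t → F))
        (Finset.univ : Finset (Fin t → κ → F)) _
    rw [symAverage_eq, Finset.expect_congr rfl fun S _ => hr S,
      ← Fintype.expect_equiv (borderEquiv κ F) (fun p => 𝔼 n, 𝔼 θ, G p.1 p.2 n θ) _ fun p => rfl]
    refine (Finset.expect_product (Finset.univ : Finset (F × (κ → F)))
      (Finset.univ : Finset (symMatrix κ F)) _).trans ?_
    rw [Finset.expect_comm]
    refine Finset.expect_congr rfl fun S _ => ?_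
    have h2 : ∀ p, (𝔼 n, 𝔼 θ, G p S n θ) = 𝔼 θ, 𝔼 n, G p S n θ := fun p => Finset.expect_comm _ _ _
    rw [Finset.expect_congr rfl fun p _ => h2 p, Finset.expect_comm]
    refine Finset.expect_congr rfl fun θ _ => ?_
    exact (Finset.expect_product (Finset.univ : Finset (F × (κ → F)))
      (Finset.univ : Finset (Fin t → F)) fun z => G z.1 S z.2 θ).symm
  have h2 : ∀ (S : symMatrix κ F) (θ : Fin t → κ → F),
      (𝔼 z : (F × (κ → F)) × (Fin t → F), G z.1 S z.2 θ) =
        (𝔼 v : κ → F, if FullRowRank S.1 (Fin.cons v θ : Fin (t + 1) → κ → F) then (1 : ℝ) else 0) -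
          (Fintype.card F : ℝ)⁻¹ ^ (t + 1) * if FullRowRank S.1 θ then 1 else 0 := by
    intro S θ
    rw [Finset.expect_congr rfl fun z _ => indicator_fullRowRank_border z.1 S z.2 θ,
      Finset.expect_sub_distrib, expect_isRowCombination]
    congr 1
    refine expect_comp_of_surjective (((AddMonoidHom.snd F (κ → F)).comp
      (AddMonoidHom.fst (F × (κ → F)) (Fin t → F))))
      (fun v => ⟨((0, v), 0), rfl⟩)
      fun v => if FullRowRank S.1 (Fin.cons v θ : Fin (t + 1) → κ → F) then (1 : ℝ) else 0
  rw [h1, Finset.expect_congr rfl fun S _ => Finset.expect_congr rfl fun θ _ => h2 S θ]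
  simp_rw [Finset.expect_sub_distrib, ← Finset.mul_expect]
  rw [← symAverage_eq, symAverage_eq (t + 1)]
  congr 1
  refine Finset.expect_congr rfl fun S _ => ?_
  let e : (κ → F) × (Fin t → κ → F) ≃ (Fin (t + 1) → κ → F) := Fin.consEquiv fun _ => κ → F
  rw [← Fintype.expect_equiv e
    (fun p => if FullRowRank S.1 (Fin.cons p.1 p.2 : Fin (t + 1) → κ → F) then (1 : ℝ) else 0) _
    fun p => rfl]
  rw [Finset.expect_comm]
  exact (Finset.expect_product (Finset.univ : Finset (κ → F))
    (Finset.univ : Finset (Fin t → κ → F)) fun p =>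
      if FullRowRank S.1 (Fin.cons p.1 p.2 : Fin (t + 1) → κ → F) then (1 : ℝ) else 0).symm

theorem finrank_ker_mulVecLin_submatrix {κ' : Type} [Fintype κ'] [DecidableEq κ'] (e : κ' ≃ κ)
    (S : Matrix κ κ F) :
    Module.finrank F (LinearMap.ker (S.submatrix e e).mulVecLin) =
      Module.finrank F (LinearMap.ker S.mulVecLin) := by
  have h1 := LinearMap.finrank_range_add_finrank_ker S.mulVecLin
  have h2 := LinearMap.finrank_range_add_finrank_ker (S.submatrix e e).mulVecLin
  have h3 : (S.submatrix e e).rank = S.rank := Matrix.rank_submatrix S e e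
  rw [Matrix.rank, Matrix.rank] at h3
  rw [Module.finrank_fintype_fun_eq_card] at h1 h2
  have := Fintype.card_congr e
  omega

theorem symAverage_congr {κ' : Type} [Fintype κ'] [DecidableEq κ'] (e : κ' ≃ κ) (t : ℕ) :
    symAverage κ F t = symAverage κ' F t := by
  let E : symMatrix κ F ≃ symMatrix κ' F :=
    { toFun := fun S => ⟨S.1.submatrix e e, Matrix.IsSymm.submatrix S.2 e⟩
      invFun := fun S => ⟨S.1.submatrix e.symm e.symm, Matrix.IsSymm.submatrix S.2 e.symm⟩
      left_inv := fun S => Subtype.ext (by ext; simp)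
      right_inv := fun S => Subtype.ext (by ext; simp) }
  refine Fintype.expect_equiv E _ _ fun S => ?_
  rw [← finrank_ker_mulVecLin_submatrix e]
  rfl

theorem symAverage_succ (m t : ℕ) : symAverage (Fin (m + 1)) F t =
    symAverage (Fin m) F (t + 1) - (Fintype.card F : ℝ)⁻¹ ^ (t + 1) * symAverage (Fin m) F t := by
  rw [← symAverage_border]
  exact symAverage_congr (Fintype.equivOfCardEq (by simp [add_comm])) t

theorem symAverage_zero (t : ℕ) : symAverage (Fin 0) F t = 1 := by
  have h : ∀ S : symMatrix (Fin 0) F, surjWeight (Fintype.card F : ℝ)⁻¹ t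
      (Module.finrank F (LinearMap.ker S.1.mulVecLin)) = 1 := by
    intro S
    have : Module.finrank F (LinearMap.ker S.1.mulVecLin) = 0 := by
      have := LinearMap.finrank_range_add_finrank_ker S.1.mulVecLin
      rw [Module.finrank_fintype_fun_eq_card, Fintype.card_fin] at this
      omega
    rw [this, surjWeight_zero]
  rw [symAverage, Finset.expect_congr rfl fun S _ => h S, Fintype.expect_const]

end SymmetricAverages

/-! ### The limit of the recurrence. -/

section LimitProduct

/-- `∏_{i > t} (1 + x^i)⁻¹`. -/
def limitProduct (x : ℝ) (t : ℕ) : ℝ := ∏' i : ℕ, (1 + x ^ (t + 1 + i))⁻¹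

theorem multipliable_limitProduct {x : ℝ} (h0 : 0 ≤ x) (h1 : x < 1) (t : ℕ) :
    Multipliable fun i : ℕ => (1 + x ^ (t + 1 + i))⁻¹ := by
  have hp : ∀ i : ℕ, 0 ≤ x ^ (t + 1 + i) := fun i => pow_nonneg h0 _
  have hs : Summable fun i : ℕ => (1 + x ^ (t + 1 + i))⁻¹ - 1 := by
    refine Summable.of_norm_bounded (g := fun i => x ^ i)
      (summable_geometric_of_lt_one h0 h1) fun i => ?_
    have h2 : (1 + x ^ (t + 1 + i))⁻¹ - 1 = -(x ^ (t + 1 + i) / (1 + x ^ (t + 1 + i))) := by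
      have := hp i
      field_simp
      ring
    rw [h2, norm_neg, Real.norm_of_nonneg (div_nonneg (hp i) (by linarith [hp i]))]
    refine (div_le_self (hp i) (by linarith [hp i])).trans ?_
    rw [pow_add]
    exact mul_le_of_le_one_left (pow_nonneg h0 _) (pow_le_one₀ h0 h1.le)
  have := Real.multipliable_one_add_of_summable hs
  simpa using this

/-- Splitting off the first factor shows that the product is a stationary solution of the
recurrence. -/
theorem limitProduct_succ {x : ℝ} (h0 : 0 ≤ x) (h1 : x < 1) (t : ℕ) :
    limitProduct x (t + 1) - x ^ (t + 1) * limitProduct x t = limitProduct x t := by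
  have h := tprod_eq_zero_mul' (f := fun i : ℕ => (1 + x ^ (t + 1 + i))⁻¹)
    (by simpa [add_assoc, add_comm, add_left_comm] using multipliable_limitProduct h0 h1 (t + 1))
  have h2 : limitProduct x t = (1 + x ^ (t + 1))⁻¹ * limitProduct x (t + 1) := by
    rw [limitProduct, h, limitProduct]
    simp [add_comm, add_left_comm]
  have h3 : 0 < 1 + x ^ (t + 1) := by have := pow_nonneg h0 (t + 1); linarith
  rw [h2]
  field_simp
  ring

theorem one_sub_limitProduct {x : ℝ} (h0 : 0 ≤ x) (h1 : x < 1) (t : ℕ) :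
    |1 - limitProduct x t| ≤ x ^ t * (1 - x)⁻¹ := by
  have hp : ∀ i : ℕ, 0 ≤ x ^ (t + 1 + i) := fun i => pow_nonneg h0 _
  have hN : ∀ N, 1 - ∑ i ∈ Finset.range N, x ^ (t + 1 + i) ≤
      ∏ i ∈ Finset.range N, (1 + x ^ (t + 1 + i))⁻¹ ∧
      0 ≤ ∏ i ∈ Finset.range N, (1 + x ^ (t + 1 + i))⁻¹ ∧
      ∏ i ∈ Finset.range N, (1 + x ^ (t + 1 + i))⁻¹ ≤ 1 := by
    intro N
    induction N with
    | zero => simp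
    | succ N ih =>
      obtain ⟨ih1, ih2, ih3⟩ := ih
      rw [Finset.sum_range_succ, Finset.prod_range_succ]
      set y := x ^ (t + 1 + N)
      have hy : 0 ≤ y := hp N
      have hi0 : 0 ≤ (1 + y)⁻¹ := by positivity
      have hi1 : (1 + y)⁻¹ ≤ 1 := inv_le_one_of_one_le₀ (by linarith)
      have hi2 : 1 - y ≤ (1 + y)⁻¹ := by
        rw [← one_div, le_div_iff₀ (by linarith)]
        nlinarith
      refine ⟨?_, mul_nonneg ih2 hi0, mul_le_one₀ ih3 hi0 hi1⟩
      nlinarith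
  have hsum : ∀ N, ∑ i ∈ Finset.range N, x ^ (t + 1 + i) ≤ x ^ t * (1 - x)⁻¹ := by
    intro N
    rw [← tsum_geometric_of_lt_one h0 h1]
    have h2 : ∑ i ∈ Finset.range N, x ^ (t + 1 + i) ≤ x ^ t * ∑ i ∈ Finset.range N, x ^ i := by
      rw [Finset.mul_sum]
      refine Finset.sum_le_sum fun i _ => ?_
      rw [← pow_add]
      exact pow_le_pow_of_le_one h0 h1.le (by omega)
    exact h2.trans (mul_le_mul_of_nonneg_left
      ((summable_geometric_of_lt_one h0 h1).sum_le_tsum _ fun i _ => pow_nonneg h0 i)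
      (pow_nonneg h0 t))
  have hlim := (multipliable_limitProduct h0 h1 t).hasProd.tendsto_prod_nat
  have hle : limitProduct x t ≤ 1 := le_of_tendsto' hlim fun N => (hN N).2.2
  have hge : 1 - x ^ t * (1 - x)⁻¹ ≤ limitProduct x t :=
    ge_of_tendsto' hlim fun N => (sub_le_sub_left (hsum N) 1).trans (hN N).1
  rw [abs_of_nonneg (by linarith)]
  linarith

/-- The recurrence of the averages over symmetric matrices determines their limit. -/
theorem tendsto_of_recurrence {x : ℝ} (h0 : 0 ≤ x) (h1 : 2 * x < 1) {a : ℕ → ℕ → ℝ}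
    (ha0 : ∀ t, a 0 t = 1) (ha : ∀ m t, a (m + 1) t = a m (t + 1) - x ^ (t + 1) * a m t) (t : ℕ) :
    Tendsto (fun m => a m t) atTop (𝓝 (limitProduct x t)) := by
  have hx1 : x < 1 := by linarith
  have hK : 0 ≤ (1 - x)⁻¹ := inv_nonneg.2 (by linarith)
  -- The error satisfies the same linear recurrence. Both of its terms gain a factor x, one from t +
  -- 1 in place of t and one from x^{t+1}, so each step multiplies the bound by 2x; this is where 2x
  -- < 1 is needed.
  have key : ∀ m t, |a m t - limitProduct x t| ≤ x ^ t * (1 - x)⁻¹ * (2 * x) ^ m := by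
    intro m
    induction m with
    | zero =>
      intro t
      rw [ha0, pow_zero, mul_one]
      exact one_sub_limitProduct h0 hx1 t
    | succ m ih =>
      intro t
      have h2 : a (m + 1) t - limitProduct x t = (a m (t + 1) - limitProduct x (t + 1)) -
          x ^ (t + 1) * (a m t - limitProduct x t) := by
        rw [ha]
        linear_combination limitProduct_succ h0 hx1 t
      rw [h2]
      refine (abs_sub _ _).trans ((add_le_add
        (d := x ^ (t + 1) * ((1 - x)⁻¹ * (2 * x) ^ m)) (ih (t + 1)) ?_).trans ?_)
      · rw [abs_mul, abs_of_nonneg (pow_nonneg h0 _)]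
        refine mul_le_mul_of_nonneg_left ((ih t).trans ?_) (pow_nonneg h0 _)
        rw [mul_assoc]
        exact mul_le_of_le_one_left (mul_nonneg hK (pow_nonneg (by linarith) _))
          (pow_le_one₀ h0 hx1.le)
      · refine le_of_eq ?_
        ring
  rw [tendsto_iff_norm_sub_tendsto_zero]
  refine squeeze_zero (fun _ => norm_nonneg _) (fun m => key m t) ?_
  simpa using (tendsto_pow_atTop_nhds_zero_of_lt_one (by linarith : (0 : ℝ) ≤ 2 * x) h1).const_mul
    (x ^ t * (1 - x)⁻¹)

end LimitProduct

/-! ### Coranks of block triangular matrices. -/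

section BlockMatrices

open scoped BigOperators

variable {F : Type} [Field F] [Fintype F] {κ : Type} [Fintype κ] [DecidableEq κ]
  {π : Type} [Fintype π] [DecidableEq π]

theorem tendsto_symAverage (hF : 2 < Fintype.card F) (t : ℕ) :
    Tendsto (fun m => symAverage (Fin m) F t) atTop
      (𝓝 (limitProduct (Fintype.card F : ℝ)⁻¹ t)) := by
  have hq : (2 : ℝ) < Fintype.card F := by exact_mod_cast hF
  refine tendsto_of_recurrence (by positivity) ?_ (fun t => symAverage_zero t)
    (fun m t => symAverage_succ m t) t
  rw [← div_eq_mul_inv, div_lt_one (by linarith)]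
  exact hq

theorem symAverage_eq_fin (t : ℕ) : symAverage κ F t = symAverage (Fin (Fintype.card κ)) F t :=
  symAverage_congr (Fintype.equivFin κ).symm t

/-- A surjection with kernel the range of `P`. -/
theorem exists_cokernelMap (P : Matrix π π F) :
    ∃ ρ : (π → F) →ₗ[F] (Fin (Module.finrank F (LinearMap.ker P.mulVecLin)) → F),
      Function.Surjective ρ ∧ LinearMap.ker ρ = LinearMap.range P.mulVecLin := by
  have h1 := LinearMap.finrank_range_add_finrank_ker P.mulVecLin
  have h2 := Submodule.finrank_quotient_add_finrank (LinearMap.range P.mulVecLin)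
  have h3 : Module.finrank F ((π → F) ⧸ LinearMap.range P.mulVecLin) =
      Module.finrank F (Fin (Module.finrank F (LinearMap.ker P.mulVecLin)) → F) := by
    rw [Module.finrank_fintype_fun_eq_card] at h1
    rw [Module.finrank_fintype_fun_eq_card] at h2
    rw [Module.finrank_fin_fun]
    omega
  let e := LinearEquiv.ofFinrankEq _ _ h3
  refine ⟨e.toLinearMap.comp (Submodule.mkQ _), ?_, ?_⟩
  · exact e.surjective.comp (Submodule.mkQ_surjective _)
  · rw [LinearEquiv.ker_comp, Submodule.ker_mkQ]

theorem fromBlocks_mulVec_eq_zero (S : Matrix κ κ F) (U : π → κ → F) (P : Matrix π π F)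
    (y : κ → F) (z : π → F) :
    (Matrix.fromBlocks S 0 (Matrix.of U) P).mulVec (Sum.elim y z) = 0 ↔
      S.mulVec y = 0 ∧ (Matrix.of U).mulVec y + P.mulVec z = 0 := by
  rw [Matrix.fromBlocks_mulVec]
  simp only [Sum.elim_comp_inl, Sum.elim_comp_inr, Matrix.zero_mulVec, add_zero]
  constructor
  · intro h
    exact ⟨funext fun i => congrFun h (Sum.inl i), funext fun i => congrFun h (Sum.inr i)⟩
  · rintro ⟨h1, h2⟩
    rw [h1, h2]
    ext (i | i) <;> rfl

/-- The rows of `ρ ∘ U`. -/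
def composedRows {s : ℕ} (ρ : (π → F) →ₗ[F] (Fin s → F)) : (π → κ → F) →+ (Fin s → κ → F) :=
  AddMonoidHom.mk' (fun U i j => ρ (fun p => U p j) i) fun U U' => by
    ext i j
    exact congrFun (map_add ρ (fun p => U p j) (fun p => U' p j)) i

theorem composedRows_surjective {s : ℕ} {ρ : (π → F) →ₗ[F] (Fin s → F)}
    (hρ : Function.Surjective ρ) : Function.Surjective (composedRows (κ := κ) ρ) := by
  intro θ
  choose u hu using fun j : κ => hρ fun i => θ i j
  exact ⟨fun p j => u j p, funext fun i => funext fun j => congrFun (hu j) i⟩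

theorem composedRows_dotProduct {s : ℕ} (ρ : (π → F) →ₗ[F] (Fin s → F)) (U : π → κ → F) (y : κ → F)
    (i : Fin s) : composedRows ρ U i ⬝ᵥ y = ρ ((Matrix.of U).mulVec y) i := by
  have : (Matrix.of U).mulVec y = ∑ j, y j • fun p => U p j := by
    ext p
    simp [Matrix.mulVec, dotProduct, mul_comm]
  rw [this, map_sum, Finset.sum_apply]
  refine Finset.sum_congr rfl fun j _ => ?_
  rw [map_smul, Pi.smul_apply, smul_eq_mul, mul_comm]
  rfl

/-- Project a kernel vector (y, z) to y. The image consists of the y ∈ ker S with Uy ∈ im P, that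
is, with ρUy = 0, and the kernel of the projection is ker P. -/
theorem finrank_ker_fromBlocks {s : ℕ} (S : Matrix κ κ F) (U : π → κ → F) (P : Matrix π π F)
    (ρ : (π → F) →ₗ[F] (Fin s → F)) (hρ : LinearMap.ker ρ = LinearMap.range P.mulVecLin) :
    Module.finrank F (LinearMap.ker (Matrix.fromBlocks S 0 (Matrix.of U) P).mulVecLin) =
      Module.finrank F (LinearMap.ker P.mulVecLin) +
        perpDim (LinearMap.ker S.mulVecLin) (composedRows ρ U) := by
  set D := Matrix.fromBlocks S 0 (Matrix.of U) P
  let L : (κ ⊕ π → F) →ₗ[F] (κ → F) := LinearMap.funLeft F F Sum.inl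
  let K := LinearMap.ker D.mulVecLin
  have h1 := LinearMap.finrank_range_add_finrank_ker (L.domRestrict K)
  have hK : ∀ (y : κ → F) (z : π → F), Sum.elim y z ∈ K ↔
      S.mulVec y = 0 ∧ (Matrix.of U).mulVec y + P.mulVec z = 0 :=
    fun y z => fromBlocks_mulVec_eq_zero S U P y z
  have h2 : LinearMap.range (L.domRestrict K) =
      perp (LinearMap.ker S.mulVecLin) (composedRows ρ U) := by
    ext y
    have h3 : (∀ i, composedRows ρ U i ⬝ᵥ y = 0) ↔ ∃ z, P.mulVec z = (Matrix.of U).mulVec y := by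
      simp_rw [composedRows_dotProduct]
      have : (Matrix.of U).mulVec y ∈ LinearMap.ker ρ ↔ (Matrix.of U).mulVec y ∈
        LinearMap.range P.mulVecLin := by rw [hρ]
      rw [LinearMap.mem_ker, LinearMap.mem_range, funext_iff] at this
      exact this
    rw [mem_perp, h3]
    constructor
    · rintro ⟨⟨w, hw⟩, rfl⟩
      obtain ⟨y, z, rfl⟩ : ∃ (y : κ → F) (z : π → F), w = Sum.elim y z :=
        ⟨_, _, (Sum.elim_comp_inl_inr w).symm⟩
      have h4 := (hK y z).1 hw
      exact ⟨h4.1, -z, by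
        rw [Matrix.mulVec_neg]; exact (eq_neg_of_add_eq_zero_left h4.2).symm⟩
    · rintro ⟨h4, z, hz⟩
      exact ⟨⟨Sum.elim y (-z), (hK _ _).2 ⟨h4, by rw [Matrix.mulVec_neg, hz, add_neg_cancel]⟩⟩, rfl⟩
  let j : LinearMap.ker P.mulVecLin →ₗ[F] K :=
    { toFun := fun z => ⟨Sum.elim 0 z.1, (hK _ _).2 ⟨Matrix.mulVec_zero _, by
        rw [Matrix.mulVec_zero, zero_add]; exact z.2⟩⟩
      map_add' := fun a b => Subtype.ext (by ext (i | i) <;> simp)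
      map_smul' := fun c a => Subtype.ext (by ext (i | i) <;> simp) }
  have hj : Function.Injective j := fun a b h => Subtype.ext (funext fun i =>
    congrFun (congrArg Subtype.val h) (Sum.inr i))
  have h5 : LinearMap.range j = LinearMap.ker (L.domRestrict K) := by
    ext ⟨w, hw⟩
    obtain ⟨y, z, rfl⟩ : ∃ (y : κ → F) (z : π → F), w = Sum.elim y z :=
      ⟨_, _, (Sum.elim_comp_inl_inr w).symm⟩
    constructor
    · rintro ⟨a, ha⟩
      rw [← ha]
      rfl
    · intro h
      have hy : y = 0 := h
      subst hy
      have h4 := ((hK _ _).1 hw).2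
      rw [Matrix.mulVec_zero, zero_add] at h4
      exact ⟨⟨z, h4⟩, rfl⟩
  have h6 := LinearMap.finrank_range_of_inj hj
  rw [perpDim, ← h2, ← h6, h5, ← h1, add_comm]

/-- For uniform U the rows of ρU are independent and uniform, as many as the corank of P. They cut
ker S with exactly the offset for which the average of c_t factors. -/
theorem expect_surjWeight_fromBlocks (P : Matrix π π F) (t : ℕ) :
    𝔼 S : symMatrix κ F, 𝔼 U : π → κ → F, surjWeight (Fintype.card F : ℝ)⁻¹ t (Module.finrank F
      (LinearMap.ker (Matrix.fromBlocks S.1 0 (Matrix.of U) P).mulVecLin)) =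
      surjWeight (Fintype.card F : ℝ)⁻¹ t (Module.finrank F (LinearMap.ker P.mulVecLin)) *
        symAverage κ F t := by
  obtain ⟨ρ, hρ, hker⟩ := exists_cokernelMap P
  simp_rw [finrank_ker_fromBlocks _ _ P ρ hker]
  rw [symAverage, Finset.mul_expect]
  refine Finset.expect_congr rfl fun S _ => ?_
  rw [← expect_surjWeight_add_perp]
  exact expect_comp_of_surjective (composedRows ρ) (composedRows_surjective hρ) fun θ =>
    surjWeight _ t (Module.finrank F (LinearMap.ker P.mulVecLin) +
      perpDim (LinearMap.ker S.1.mulVecLin) θ)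

end BlockMatrices

/-! ### The rank of a kernel and the codimension of ψ as coranks modulo ℓ. -/

section Digits

variable {ℓ n g : ℕ} [hp : Fact ℓ.Prime]

theorem toZMod_eq_zero_iff (c : ℤ_[ℓ]) : PadicInt.toZMod c = 0 ↔ (ℓ : ℤ_[ℓ]) ∣ c := by
  rw [← RingHom.mem_ker, PadicInt.ker_toZMod, PadicInt.maximalIdeal_eq_span_p,
    Ideal.mem_span_singleton]

theorem toZMod_eq_iff (c c' : ℤ_[ℓ]) :
    (PadicInt.toZMod c : ZMod ℓ) = PadicInt.toZMod c' ↔ ∃ u, c = c' + ℓ * u := by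
  rw [← sub_eq_zero, ← map_sub, toZMod_eq_zero_iff]
  exact exists_congr fun u => sub_eq_iff_eq_add'

/-- Entrywise reduction. -/
def reduceVec (ℓ : ℕ) [Fact ℓ.Prime] (ι : Type) : (ι → ℤ_[ℓ]) →+ (ι → ZMod ℓ) :=
  AddMonoidHom.compLeft (PadicInt.toZMod (p := ℓ)).toAddMonoidHom ι

theorem reduceVec_apply {ι : Type} (c : ι → ℤ_[ℓ]) (i : ι) :
    reduceVec ℓ ι c i = PadicInt.toZMod (c i) := rfl

theorem reduceVec_surjective (ι : Type) : Function.Surjective (reduceVec ℓ ι) := by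
  intro z
  choose c hc using fun i => ZMod.ringHom_surjective (PadicInt.toZMod (p := ℓ)) (z i)
  exact ⟨c, funext hc⟩

/-- The hypotheses identify K modulo N with the cokernel of D; since D is square, its cokernel and
kernel have the same dimension. -/
theorem relIndex_eq_pow_finrank {ι : Type} [Fintype ι] [DecidableEq ι] {H : Type} [AddCommGroup H]
    {N K : AddSubgroup H} (Ξ : (ι → ℤ_[ℓ]) →+ H) (hK : Ξ.range = K) (D : Matrix ι ι (ZMod ℓ))
    (hD : ∀ c, Ξ c ∈ N ↔ ∃ y : ι → ZMod ℓ, D.mulVec y = reduceVec ℓ ι c) :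
    N.relIndex K = ℓ ^ Module.finrank (ZMod ℓ) (LinearMap.ker D.mulVecLin) := by
  have h1 : N.comap Ξ = (LinearMap.range D.mulVecLin).toAddSubgroup.comap (reduceVec ℓ ι) := by
    ext c
    exact hD c
  rw [← hK, AddMonoidHom.range_eq_map, ← AddSubgroup.relIndex_comap, AddSubgroup.relIndex_top_right,
    h1, AddSubgroup.index_comap_of_surjective _ (reduceVec_surjective ι)]
  have h2 := LinearMap.finrank_range_add_finrank_ker D.mulVecLin
  have h3 := Submodule.finrank_quotient_add_finrank (LinearMap.range D.mulVecLin)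
  have h4 : Module.finrank (ZMod ℓ) ((ι → ZMod ℓ) ⧸ LinearMap.range D.mulVecLin) =
      Module.finrank (ZMod ℓ) (LinearMap.ker D.mulVecLin) := by omega
  have h5 := Module.natCard_eq_pow_finrank (K := ZMod ℓ)
    (V := (ι → ZMod ℓ) ⧸ LinearMap.range D.mulVecLin)
  rw [h4, Nat.card_zmod] at h5
  exact h5

/-- Reductions of integral matrices. -/
theorem mulVec_reduceVec {ι : Type} [Fintype ι] (d : ι → ι → ℤ_[ℓ]) {D : Matrix ι ι (ZMod ℓ)}
    (hD : ∀ i j, PadicInt.toZMod (d i j) = D i j) (y : ι → ℤ_[ℓ]) :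
    D.mulVec (reduceVec ℓ ι y) = reduceVec ℓ ι fun i => ∑ j, d i j * y j := by
  ext i
  rw [reduceVec_apply, map_sum]
  refine Finset.sum_congr rfl fun j _ => ?_
  rw [map_mul, hD]
  rfl

theorem exists_mulVec_eq_reduceVec_iff {ι : Type} [Fintype ι] (d : ι → ι → ℤ_[ℓ])
    {D : Matrix ι ι (ZMod ℓ)} (hD : ∀ i j, PadicInt.toZMod (d i j) = D i j) (c : ι → ℤ_[ℓ]) :
    (∃ y : ι → ZMod ℓ, D.mulVec y = reduceVec ℓ ι c) ↔
      ∃ y c' : ι → ℤ_[ℓ], ∀ i, c i = ∑ j, d i j * y j + ℓ * c' i := by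
  constructor
  · rintro ⟨y, hy⟩
    obtain ⟨y, rfl⟩ := reduceVec_surjective ι y
    rw [mulVec_reduceVec d hD] at hy
    choose c' hc' using fun i => (toZMod_eq_iff _ _).1 (congrFun hy i).symm
    exact ⟨y, c', hc'⟩
  · rintro ⟨y, c', h⟩
    refine ⟨reduceVec ℓ ι y, ?_⟩
    rw [mulVec_reduceVec d hD]
    exact funext fun i => ((toZMod_eq_iff _ _).2 ⟨c' i, h i⟩).symm

variable {X : BEG ℓ n} {f : SympLattice ℓ g →+ X.carrier}

/-- `D` is the matrix of the numbers `⟨x_i, A x_j⟩ / ℓ^{k_i}` modulo `ℓ`. -/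
def IsDigitMatrix (B : AdaptedBasis f) (M : skewSymplectic ℓ g)
    (D : Matrix (Fin (g + g)) (Fin (g + g)) (ZMod ℓ)) : Prop :=
  ∀ i j, ∃ c : ℤ_[ℓ], pairEntry B M i j = (ℓ : ℤ_[ℓ]) ^ B.k i * c ∧ PadicInt.toZMod c = D i j

theorem AdaptedBasis.symp_x_sum_smul (B : AdaptedBasis f) (c : Fin (g + g) → ℤ_[ℓ])
    (i : Fin (g + g)) : symp (B.x i) (∑ j, c j • B.b j) = c i := by
  rw [symp_sum_right, Finset.sum_eq_single i]
  · rw [symp_smul_right, B.symp_x_b, if_pos rfl, mul_one]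
  · intro j _ hj
    rw [symp_smul_right, B.symp_x_b, if_neg hj.symm, mul_zero]
  · simp

theorem AdaptedBasis.symp_x_ext (B : AdaptedBasis f) {v w : SympLattice ℓ g}
    (h : ∀ i, symp (B.x i) v = symp (B.x i) w) : v = w := by
  rw [eq_sum_basis B.b v, eq_sum_basis B.b w]
  exact Finset.sum_congr rfl fun i _ => by rw [← AdaptedBasis.x, h]

/-- The linear map with images `v_i` of the basis. -/
def combineVec {ι : Type} [Fintype ι] {V H : Type} [AddCommGroup V] [Module ℤ_[ℓ] V]
    [AddCommGroup H] (f : V →+ H) (v : ι → V) : (ι → ℤ_[ℓ]) →+ H :=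
  f.comp (Fintype.linearCombination ℤ_[ℓ] v).toAddMonoidHom

theorem combineVec_apply {ι : Type} [Fintype ι] {V H : Type} [AddCommGroup V] [Module ℤ_[ℓ] V]
    [AddCommGroup H] (f : V →+ H) (v : ι → V) (c : ι → ℤ_[ℓ]) :
    combineVec f v c = f (∑ i, c i • v i) := by
  rw [← Fintype.linearCombination_apply]
  rfl

/-- ker π = ker f / im A is generated by the classes of ℓ^{k_i} b_i, with relations A x_j. In these
generators the relation matrix is ⟨x_i, A x_j⟩/ℓ^{k_i}, so modulo ℓ the group becomes the cokernel
of D. -/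
theorem genRank_eq_finrank {H : BEG ℓ n} {fH : SympLattice ℓ g →+ H.carrier}
    (hs : Function.Surjective fH) {M : skewSymplectic ℓ g}
    (hker : ∀ x, fH x = 0 ↔ ∃ y, x = shifted n M.1 y) (π : H.carrier →+ X.carrier)
    (hπ : π.comp fH = f) (B : AdaptedBasis f) {D : Matrix (Fin (g + g)) (Fin (g + g)) (ZMod ℓ)}
    (hD : IsDigitMatrix B M D) :
    genRank ℓ π.ker = Module.finrank (ZMod ℓ) (LinearMap.ker D.mulVecLin) := by
  choose d hd hdD using hD
  have hπ' : ∀ v, π (fH v) = f v := fun v => DFunLike.congr_fun hπ v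
  let b' : Fin (g + g) → SympLattice ℓ g := fun i => ((ℓ : ℤ_[ℓ]) ^ B.k i) • B.b i
  have hb' : ∀ (c : Fin (g + g) → ℤ_[ℓ]) i,
      symp (B.x i) (∑ j, c j • b' j) = (ℓ : ℤ_[ℓ]) ^ B.k i * c i := by
    intro c i
    simp only [b', smul_smul]
    rw [B.symp_x_sum_smul (fun j => c j * (ℓ : ℤ_[ℓ]) ^ B.k j), mul_comm]
  have hrange : (combineVec (ℓ := ℓ) fH b').range = π.ker := by
    ext h
    constructor
    · rintro ⟨c, rfl⟩
      rw [AddMonoidHom.mem_ker, combineVec_apply, hπ', B.map_eq_zero_iff]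
      exact fun i => ⟨c i, hb' c i⟩
    · intro hh
      obtain ⟨v, rfl⟩ := hs h
      rw [AddMonoidHom.mem_ker, hπ', B.map_eq_zero_iff] at hh
      choose c hc using hh
      refine ⟨c, ?_⟩
      rw [combineVec_apply]
      congr 1
      exact B.symp_x_ext fun i => by rw [hb', hc]
  rw [genRank, relIndex_eq_pow_finrank (combineVec fH b') hrange D, Nat.log_pow hp.out.one_lt]
  intro c
  rw [exists_mulVec_eq_reduceVec_iff d hdD]
  have hA : ∀ (y : Fin (g + g) → ℤ_[ℓ]) i, symp (B.x i) (shifted n M.1 (∑ j, y j • B.x j)) =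
      (ℓ : ℤ_[ℓ]) ^ B.k i * ∑ j, d i j * y j := by
    intro y i
    rw [map_sum, symp_sum_right, Finset.mul_sum]
    refine Finset.sum_congr rfl fun j _ => ?_
    rw [map_smul, symp_smul_right, ← mul_assoc, ← hd, mul_comm]
    rfl
  have hl : ∀ c' : Fin (g + g) → ℤ_[ℓ], ℓ • combineVec fH b' c' = combineVec fH b' fun i => (ℓ : ℤ_[ℓ]) * c' i := by
    intro c'
    rw [← map_nsmul]
    congr 1
  constructor
  · rintro ⟨h, hh, hc⟩
    rw [SetLike.mem_coe, ← hrange] at hh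
    obtain ⟨c', rfl⟩ := hh
    have h1 : combineVec fH b' c - combineVec fH b' (fun i => (ℓ : ℤ_[ℓ]) * c' i) = 0 := by
      rw [← hl, sub_eq_zero]
      exact hc.symm
    rw [← map_sub, combineVec_apply, hker] at h1
    obtain ⟨y, hy⟩ := h1
    refine ⟨fun j => symp y (B.b j), c', fun i => ?_⟩
    rw [eq_sum_sympDual B.b y] at hy
    have h2 := congrArg (symp (B.x i)) hy
    rw [hb', hA] at h2
    have h3 := mul_left_cancel₀ (pow_ne_zero _ padic_prime_ne_zero) h2
    rw [← h3]
    simp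
  · rintro ⟨y, c', h⟩
    refine ⟨combineVec fH b' c', ?_, ?_⟩
    · rw [SetLike.mem_coe, ← hrange]
      exact ⟨c', rfl⟩
    · change ℓ • combineVec fH b' c' = _
      rw [hl, eq_comm, ← sub_eq_zero, ← map_sub, combineVec_apply, hker]
      refine ⟨∑ j, y j • B.x j, B.symp_x_ext fun i => ?_⟩
      rw [hb', hA]
      congr 1
      simp [h i]

/-- The matrix of `ψ : X^∨[ℓ] → X[ℓ]`. -/
def psiDigit (hs : Function.Surjective f) {B : AdaptedBasis f} (Q : PsiLift B)
    (i j : Fin (g + g)) : ℤ_[ℓ] :=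
  (Q.dvd hs i j).choose

theorem psiDigit_spec (hs : Function.Surjective f) {B : AdaptedBasis f} (Q : PsiLift B)
    (i j : Fin (g + g)) : (ℓ : ℤ_[ℓ]) ^ B.m j * symp (B.x i) (Q.q j) =
      (ℓ : ℤ_[ℓ]) ^ B.k i * psiDigit hs Q i j :=
  (Q.dvd hs i j).choose_spec

theorem AdaptedBasis.m_pos (hn : 0 < n) {B : AdaptedBasis f} {j : Fin (g + g)} (hj : ¬ B.k j = 0) :
    0 < B.m j := lt_min (Nat.pos_of_ne_zero hj) hn

/-- X^∨[ℓ] is generated by the characters x_j/ℓ with k_j > 0, which are ℓ^{m_j - 1} times the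
generators of X^∨[ℓ^n]. -/
theorem mem_psiImage_iff (hn : 0 < n) (hs : Function.Surjective f) {B : AdaptedBasis f}
    (Q : PsiLift B) (y : X.carrier) :
    y ∈ X.psiImage ↔ ∃ t : Fin (g + g) → ℤ_[ℓ],
      y = f (∑ j, t j • (ℓ : ℤ_[ℓ]) ^ (B.m j - 1) • Q.q j) := by
  obtain ⟨e₀, he₀⟩ := exists_forall_pow_nsmul_eq_zero X.isPGroup
  have he : ∀ x : X.carrier, ℓ ^ (e₀ + n) • x = 0 := fun x => by
    rw [pow_add, mul_comm, mul_smul, he₀, smul_zero]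
  choose γ' hγ' using fun j => B.exists_char hs j
  have hψ : ∀ t : Fin (g + g) → ℤ_[ℓ],
      (X.ψ (∑ j, (t j).appr (e₀ + n) • ℓ ^ (B.m j - 1) • γ' j) : X.carrier) =
        f (∑ j, t j • (ℓ : ℤ_[ℓ]) ^ (B.m j - 1) • Q.q j) := by
    intro t
    rw [map_sum, map_sum, AddSubgroup.val_finsetSum]
    refine Finset.sum_congr rfl fun j _ => ?_
    rw [map_padic_smul he, ← Nat.cast_pow, Nat.cast_smul_eq_nsmul, map_nsmul f, ← Q.spec j _ (hγ' j),
      map_nsmul, map_nsmul]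
    rfl
  have hk : ∀ j, B.k j = 0 → γ' j = 0 := fun j hj => torsChar_ext hs fun v => by
    rw [hγ', AdaptedBasis.m, hj, Nat.zero_min, Nat.sub_zero, symp_smul_right]
    exact (padicCircle_eq_zero_iff _ _).2 (Dvd.intro _ rfl)
  have hγ1 : ∀ j v, ((ℓ ^ (B.m j - 1) • γ' j : Tors (DualGroup X.carrier) (ℓ ^ n)) :
      DualGroup X.carrier) (f v) = if B.k j = 0 then 0 else
        padicCircle ℓ n ((ℓ : ℤ_[ℓ]) ^ (n - 1) * symp v (B.x j)) := by
    intro j v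
    split_ifs with hj
    · rw [hk j hj, smul_zero]; rfl
    · change ℓ ^ (B.m j - 1) • (γ' j : DualGroup X.carrier) (f v) = _
      rw [hγ', nsmul_padicCircle, symp_smul_right, ← mul_assoc, Nat.cast_pow, ← pow_add]
      congr 3
      have := B.m_pos hn hj
      have := B.m_le j
      omega
  constructor
  · rintro ⟨γ, hγ, rfl⟩
    have hγ : ℓ • (γ : DualGroup X.carrier) = 0 := mem_Tors.1 hγ
    obtain ⟨w, hw⟩ := exists_char_lift f (mem_Tors.1 γ.2)
    have hw1 : ∃ w', (ℓ : ℤ_[ℓ]) ^ (n - 1) • w' = w := by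
      rw [exists_pow_smul_eq_iff]
      intro v
      have h1 : ℓ • (γ : DualGroup X.carrier) (f v) = 0 := DFunLike.congr_fun hγ (f v)
      rw [hw, nsmul_padicCircle, padicCircle_eq_zero_iff] at h1
      obtain ⟨n', rfl⟩ : ∃ n', n = n' + 1 := ⟨n - 1, by omega⟩
      rw [pow_succ'] at h1
      exact (mul_dvd_mul_iff_left padic_prime_ne_zero).1 h1
    obtain ⟨w', rfl⟩ := hw1
    refine ⟨fun j => symp w' (B.b j), ?_⟩
    rw [← hψ]
    change (X.ψ γ : X.carrier) = _
    congr 2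
    refine torsChar_ext hs fun v => ?_
    rw [hw, AddSubgroup.val_finsetSum, AddMonoidHom.finsetSum_apply, symp_smul_right]
    conv_lhs => rw [eq_sum_sympDual B.b w', symp_sum_right, Finset.mul_sum, map_sum]
    refine Finset.sum_congr rfl fun j _ => ?_
    change _ = (symp w' (B.b j)).appr (e₀ + n) •
      ((ℓ ^ (B.m j - 1) • γ' j : Tors (DualGroup X.carrier) (ℓ ^ n)) : DualGroup X.carrier) (f v)
    rw [hγ1]
    split_ifs with hj
    · rw [smul_zero, padicCircle_eq_zero_iff, symp_smul_right]
      have h0 : f (B.b j) = 0 := by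
        rw [B.map_eq_zero_iff]
        intro i
        rw [B.symp_x_b]
        split_ifs with hij
        · rw [hij, hj, pow_zero]
        · exact dvd_zero _
      have h1 := hw (B.b j)
      rw [h0, map_zero, eq_comm, padicCircle_eq_zero_iff, symp_smul_right, symp_swap, mul_neg,
        dvd_neg] at h1
      rw [← mul_assoc]
      exact Dvd.dvd.mul_right h1 _
    · rw [symp_smul_right, ← padicCircle_mul_appr (Nat.le_add_left n e₀)]
      congr 1
      ring
  · rintro ⟨t, rfl⟩
    rw [← hψ]
    refine ⟨_, ?_, rfl⟩
    change _ ∈ Tors (DualGroup X.carrier) ℓ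
    rw [mem_Tors]
    have : ℓ • (∑ j, (t j).appr (e₀ + n) • ℓ ^ (B.m j - 1) • γ' j) = 0 := by
      rw [Finset.smul_sum]
      refine Finset.sum_eq_zero fun j _ => ?_
      rw [smul_comm ℓ]
      have : ℓ • ℓ ^ (B.m j - 1) • γ' j = 0 := torsChar_ext hs fun v => by
        change ℓ • ((ℓ ^ (B.m j - 1) • γ' j : Tors (DualGroup X.carrier) (ℓ ^ n)) :
          DualGroup X.carrier) (f v) = 0
        rw [hγ1]
        split_ifs
        · rw [smul_zero]
        · rw [nsmul_padicCircle, ← mul_assoc, ← pow_succ', Nat.sub_add_cancel hn,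
            padicCircle_eq_zero_iff]
          exact Dvd.intro _ rfl
      rw [this, smul_zero]
    exact congrArg Subtype.val this

/-- X[ℓ] has the basis ℓ^{k_i - 1} b_i with k_i > 0; in it the image of x_j/ℓ has coordinates
ℓ^{m_j} ⟨x_i, q_j⟩/ℓ^{k_i}. -/
theorem relIndex_psiImage (hn : 0 < n) (hs : Function.Surjective f) {B : AdaptedBasis f}
    (Q : PsiLift B) :
    X.psiImage.relIndex (Tors X.carrier ℓ) = ℓ ^ Module.finrank (ZMod ℓ) (LinearMap.ker
      (Matrix.of fun i j : {i // ¬ B.k i = 0} =>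
        (PadicInt.toZMod (psiDigit hs Q i j) : ZMod ℓ)).mulVecLin) := by
  let b' : {i // ¬ B.k i = 0} → SympLattice ℓ g := fun i => (ℓ : ℤ_[ℓ]) ^ (B.k i - 1) • B.b i
  have hb' : ∀ (c : {i // ¬ B.k i = 0} → ℤ_[ℓ]) i,
      symp (B.x i) (∑ j, c j • b' j) =
        if h : B.k i = 0 then 0 else (ℓ : ℤ_[ℓ]) ^ (B.k i - 1) * c ⟨i, h⟩ := by
    intro c i
    rw [symp_sum_right]
    split_ifs with h
    · refine Finset.sum_eq_zero fun j _ => ?_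
      rw [symp_smul_right, symp_smul_right, B.symp_x_b, if_neg, mul_zero, mul_zero]
      rintro rfl
      exact j.2 h
    · rw [Finset.sum_eq_single ⟨i, h⟩]
      · rw [symp_smul_right, symp_smul_right, B.symp_x_b, if_pos rfl, mul_one, mul_comm]
      · intro j _ hj
        rw [symp_smul_right, symp_smul_right, B.symp_x_b, if_neg, mul_zero, mul_zero]
        rintro rfl
        exact hj rfl
      · simp
  have hpk : ∀ i, ¬ B.k i = 0 → (ℓ : ℤ_[ℓ]) ^ B.k i = ℓ * (ℓ : ℤ_[ℓ]) ^ (B.k i - 1) := fun i hi => by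
    rw [← pow_succ', Nat.sub_add_cancel (Nat.pos_of_ne_zero hi)]
  refine relIndex_eq_pow_finrank (combineVec f b') ?_ _ fun c => ?_
  · ext y
    constructor
    · rintro ⟨c, rfl⟩
      rw [mem_Tors, combineVec_apply, ← map_nsmul, ← Nat.cast_smul_eq_nsmul ℤ_[ℓ],
        B.map_eq_zero_iff]
      intro i
      rw [symp_smul_right, hb']
      split_ifs with h
      · rw [mul_zero]; exact dvd_zero _
      · rw [← mul_assoc, ← hpk i h]
        exact Dvd.intro _ rfl
    · intro hy
      obtain ⟨v, rfl⟩ := hs y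
      rw [mem_Tors, ← map_nsmul, ← Nat.cast_smul_eq_nsmul ℤ_[ℓ], B.map_eq_zero_iff] at hy
      have h1 : ∀ i : {i // ¬ B.k i = 0}, (ℓ : ℤ_[ℓ]) ^ (B.k i - 1) ∣ symp (B.x i) v := fun i => by
        have := hy i
        rw [symp_smul_right, hpk i i.2] at this
        exact (mul_dvd_mul_iff_left padic_prime_ne_zero).1 this
      choose c hc using h1
      refine ⟨c, ?_⟩
      rw [combineVec_apply, ← sub_eq_zero, ← map_sub, B.map_eq_zero_iff]
      intro i
      rw [symp_sub_right, hb']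
      split_ifs with h
      · rw [h, pow_zero]; exact one_dvd _
      · rw [hc ⟨i, h⟩, sub_self]; exact dvd_zero _
  · rw [mem_psiImage_iff hn hs Q, exists_mulVec_eq_reduceVec_iff
      (D := Matrix.of fun i j : {i // ¬ B.k i = 0} =>
        (PadicInt.toZMod (psiDigit hs Q i j) : ZMod ℓ))
      (fun i j : {i // ¬ B.k i = 0} => psiDigit hs Q i j) fun i j => rfl]
    have hq : ∀ (t : Fin (g + g) → ℤ_[ℓ]) (i : {i // ¬ B.k i = 0}),
        symp (B.x i) (∑ j, t j • (ℓ : ℤ_[ℓ]) ^ (B.m j - 1) • Q.q j) =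
          (ℓ : ℤ_[ℓ]) ^ (B.k i - 1) *
            ∑ j : {j // ¬ B.k j = 0}, psiDigit hs Q i j * t j := by
      intro t i
      rw [symp_sum_right, Finset.mul_sum,
        ← Fintype.sum_subtype_add_sum_subtype (fun j => B.k j = 0), Finset.sum_eq_zero, zero_add]
      · refine Finset.sum_congr rfl fun j _ => ?_
        rw [symp_smul_right, symp_smul_right]
        have h1 := psiDigit_spec hs Q i j
        rw [hpk i i.2, ← Nat.sub_add_cancel (B.m_pos hn j.2), pow_succ', mul_assoc, mul_assoc] at h1
        rw [mul_left_cancel₀ padic_prime_ne_zero h1]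
        ring
      · intro j _
        rw [Q.q_eq_zero j j.2, smul_zero, smul_zero, symp_zero_right]
    constructor
    · rintro ⟨t, ht⟩
      rw [combineVec_apply, ← sub_eq_zero, ← map_sub, B.map_eq_zero_iff] at ht
      have h1 : ∀ i : {i // ¬ B.k i = 0}, ∃ u,
          c i = ∑ j : {j // ¬ B.k j = 0}, psiDigit hs Q i j * t j + ℓ * u := by
        intro i
        have h2 := ht i
        rw [symp_sub_right, hb', dif_neg i.2, hq, ← mul_sub, hpk i i.2, mul_comm (ℓ : ℤ_[ℓ])] at h2
        obtain ⟨u, hu⟩ := (mul_dvd_mul_iff_left (pow_ne_zero _ padic_prime_ne_zero)).1 h2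
        exact ⟨u, sub_eq_iff_eq_add'.1 hu⟩
      choose u hu using h1
      exact ⟨fun j => t j, u, hu⟩
    · rintro ⟨y, u, h⟩
      refine ⟨fun j => if hj : B.k j = 0 then 0 else y ⟨j, hj⟩, ?_⟩
      rw [combineVec_apply, ← sub_eq_zero, ← map_sub, B.map_eq_zero_iff]
      intro i
      by_cases hi : B.k i = 0
      · rw [hi, pow_zero]; exact one_dvd _
      · rw [symp_sub_right, hb', dif_neg hi, hq _ ⟨i, hi⟩, ← mul_sub, hpk i hi,
          mul_comm (ℓ : ℤ_[ℓ])]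
        refine mul_dvd_mul_left _ ⟨u ⟨i, hi⟩, ?_⟩
        rw [sub_eq_iff_eq_add', h ⟨i, hi⟩]
        congr 1
        refine Finset.sum_congr rfl fun j _ => ?_
        rw [dif_neg j.2]

end Digits

/-! ### The law of the digit matrix under Haar measure. -/

section DigitFibers

open scoped BigOperators

variable {ℓ n g : ℕ} [hp : Fact ℓ.Prime] {X : BEG ℓ n} {f : SympLattice ℓ g →+ X.carrier}

/-- The index set of the upper triangular part. -/
abbrev UpperPair (g : ℕ) : Type := {p : Fin (g + g) × Fin (g + g) // p.1 ≤ p.2}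

/-- The precision to which a push-forward condition determines an entry. -/
def digitExp (B : AdaptedBasis f) (p : UpperPair g) : ℕ := B.k p.1.2 + B.m p.1.1

/-- The upper triangular entries with one more digit than is determined by the push-forward
condition. -/
def upperHom (B : AdaptedBasis f) :
    skewSymplectic ℓ g →+ (∀ p : UpperPair g, ZMod (ℓ ^ (digitExp B p + 1))) :=
  AddMonoidHom.mk' (fun M p => PadicInt.toZModPow _ (symp (B.x p.1.2) (M.1.mulVec (B.x p.1.1))))
    fun M M' => by
      ext p
      simp [Matrix.add_mulVec, symp_add_right]

theorem upperHom_apply (B : AdaptedBasis f) (M : skewSymplectic ℓ g) (p : UpperPair g) :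
    upperHom B M p = PadicInt.toZModPow _ (symp (B.x p.1.2) (M.1.mulVec (B.x p.1.1))) := rfl

theorem symp_x_mulVec (B : AdaptedBasis f) (M : skewSymplectic ℓ g) (i j : Fin (g + g)) :
    symp (B.x j) (M.1.mulVec (B.x i)) =
      pairEntry B M j i - (ℓ : ℤ_[ℓ]) ^ n * symp (B.x j) (B.x i) := by
  rw [pairEntry, shifted_apply, symp_add_right, symp_smul_right, add_sub_cancel_right]

/-- Skew-symplectic matrices are the same as symmetric forms ⟨·, M·⟩, whose Gram matrix in the basis
x_i can have any upper triangle. -/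
theorem upperHom_surjective (B : AdaptedBasis f) : Function.Surjective (upperHom B) := by
  intro z
  choose c hc using fun p => toZModPow_surjective (ℓ := ℓ) (digitExp B p + 1) (z p)
  let C : Fin (g + g) → Fin (g + g) → ℤ_[ℓ] := fun i j => c ⟨(min i j, max i j), min_le_max⟩
  have hC : ∀ i j, C i j = C j i := fun i j => by
    simp only [C, min_comm i j, max_comm i j]
  let S : LinearMap.BilinForm ℤ_[ℓ] (SympLattice ℓ g) :=
    LinearMap.mk₂ ℤ_[ℓ] (fun v w => ∑ i, ∑ j, C i j * (symp v (B.b i) * symp w (B.b j)))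
      (fun v v' w => by
        simp only [symp_add_left, add_mul, mul_add, Finset.sum_add_distrib])
      (fun a v w => by
        simp only [symp_smul_left, smul_eq_mul, Finset.mul_sum]
        exact Finset.sum_congr rfl fun i _ => Finset.sum_congr rfl fun j _ => by ring)
      (fun v w w' => by
        simp only [symp_add_left, mul_add, Finset.sum_add_distrib])
      (fun a v w => by
        simp only [symp_smul_left, smul_eq_mul, Finset.mul_sum]
        exact Finset.sum_congr rfl fun i _ => Finset.sum_congr rfl fun j _ => by ring)
  have hS0 : ∀ v w, S v w = ∑ i, ∑ j, C i j * (symp v (B.b i) * symp w (B.b j)) := fun _ _ => rfl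
  obtain ⟨M, hM⟩ := exists_skewSymplectic S fun v w => by
    rw [hS0, hS0, Finset.sum_comm]
    exact Finset.sum_congr rfl fun i _ => Finset.sum_congr rfl fun j _ => by
      rw [hC, mul_comm (symp v _)]
  refine ⟨M, funext fun p => ?_⟩
  obtain ⟨⟨i, j⟩, hij⟩ := p
  rw [upperHom_apply, hM, hS0, ← hc]
  congr 1
  have h1 : ∀ a b, C a b * (symp (B.x j) (B.b a) * symp (B.x i) (B.b b)) =
      if a = j then (if b = i then C a b else 0) else 0 := by
    intro a b
    rw [B.symp_x_b, B.symp_x_b]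
    by_cases ha : a = j
    · by_cases hb : b = i
      · simp [ha, hb]
      · simp [hb, Ne.symm hb]
    · simp [ha, Ne.symm ha]
  simp only [h1]
  simp only [Finset.sum_ite_irrel, Finset.sum_const_zero, Finset.sum_ite_eq', Finset.mem_univ,
    if_true]
  simp only [C]
  congr 2
  exact Prod.ext (min_eq_right hij) (max_eq_left hij)

/-- The value that the push-forward condition prescribes. -/
def digitTarget {B : AdaptedBasis f} (Q : PsiLift B) (p : UpperPair g) : ℤ_[ℓ] :=
  (ℓ : ℤ_[ℓ]) ^ B.m p.1.1 * symp (B.x p.1.2) (Q.q p.1.1) -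
    (ℓ : ℤ_[ℓ]) ^ n * symp (B.x p.1.2) (B.x p.1.1)

/-- The prescribed value together with the next digit. -/
def digitPoint {B : AdaptedBasis f} (Q : PsiLift B) (σ : UpperPair g → ZMod ℓ) :
    ∀ p : UpperPair g, ZMod (ℓ ^ (digitExp B p + 1)) := fun p =>
  PadicInt.toZModPow _ (digitTarget Q p + (ℓ : ℤ_[ℓ]) ^ digitExp B p * ((σ p).val : ℤ_[ℓ]))

theorem upperHom_eq_digitPoint_iff {B : AdaptedBasis f} (Q : PsiLift B)
    (σ : UpperPair g → ZMod ℓ) (M : skewSymplectic ℓ g) :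
    upperHom B M = digitPoint Q σ ↔ ∀ p : UpperPair g, (ℓ : ℤ_[ℓ]) ^ (digitExp B p + 1) ∣
      pairEntry B M p.1.2 p.1.1 - (ℓ : ℤ_[ℓ]) ^ B.m p.1.1 * symp (B.x p.1.2) (Q.q p.1.1) -
        (ℓ : ℤ_[ℓ]) ^ digitExp B p * ((σ p).val : ℤ_[ℓ]) := by
  rw [funext_iff]
  refine forall_congr' fun p => ?_
  rw [upperHom_apply, digitPoint, toZModPow_eq_iff, symp_x_mulVec, digitTarget]
  refine iff_of_eq (congrArg _ ?_)
  ring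

theorem toZMod_natCast_val (a : ZMod ℓ) : PadicInt.toZMod ((a.val : ℕ) : ℤ_[ℓ]) = a := by
  rw [map_natCast, ZMod.natCast_zmod_val]

theorem digitPoint_injective {B : AdaptedBasis f} (Q : PsiLift B) :
    Function.Injective (digitPoint Q) := by
  intro σ σ' h
  ext1 p
  have h1 := congrFun h p
  rw [digitPoint, digitPoint, toZModPow_eq_iff, add_sub_add_left_eq_sub, ← mul_sub, pow_succ] at h1
  obtain ⟨u, hu⟩ := (mul_dvd_mul_iff_left (pow_ne_zero _ padic_prime_ne_zero)).1 h1
  rw [← toZMod_natCast_val (σ p), ← toZMod_natCast_val (σ' p), toZMod_eq_iff]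
  exact ⟨u, sub_eq_iff_eq_add'.1 hu⟩

/-- The congruence fixes an entry modulo ℓ^{digitExp} and leaves its next digit σ free. Recording
that digit makes the rank of the kernel a function of finitely many digits. -/
theorem isPush_iff_exists_digits (hs : Function.Surjective f) (hω : X.ω = omegaSum f)
    {B : AdaptedBasis f} (Q : PsiLift B) (M : skewSymplectic ℓ g) :
    IsPush M.1 X f ↔ ∃ σ, upperHom B M = digitPoint Q σ := by
  rw [isPush_iff_forall_le hs hω B Q]
  constructor
  · intro h
    choose u hu using fun p : UpperPair g => h p.1.1 p.1.2 p.2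
    refine ⟨fun p => PadicInt.toZMod (u p), (upperHom_eq_digitPoint_iff Q _ M).2 fun p => ?_⟩
    obtain ⟨u', hu'⟩ := (toZMod_eq_iff (u p) _).1
      (toZMod_natCast_val (PadicInt.toZMod (u p) : ZMod ℓ)).symm
    refine ⟨u', ?_⟩
    rw [hu p]
    change (ℓ : ℤ_[ℓ]) ^ digitExp B p * u p - _ = _
    rw [pow_succ]
    linear_combination (ℓ : ℤ_[ℓ]) ^ digitExp B p * hu'
  · rintro ⟨σ, hσ⟩ i j hij
    have h := (upperHom_eq_digitPoint_iff Q σ M).1 hσ ⟨(i, j), hij⟩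
    exact (dvd_sub_left (Dvd.intro _ rfl)).1 ((pow_dvd_pow _ (Nat.le_succ _)).trans h)

theorem measurableSet_upperHom_ker (B : AdaptedBasis f) :
    MeasurableSet (upperHom B ⁻¹' {0}) := by
  have : upperHom B ⁻¹' {0} = ⋂ p : UpperPair g, {M : skewSymplectic ℓ g |
      (ℓ : ℤ_[ℓ]) ^ (digitExp B p + 1) ∣ symp (B.x p.1.2) (M.1.mulVec (B.x p.1.1))} := by
    ext M
    rw [Set.mem_preimage, Set.mem_singleton_iff, funext_iff, Set.mem_iInter]
    exact forall_congr' fun p => toZModPow_eq_zero_iff _ _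
  rw [this]
  exact MeasurableSet.iInter fun p => measurableSet_pow_dvd_symp _ _ _

theorem setOf_isPush_eq (hs : Function.Surjective f) (hω : X.ω = omegaSum f)
    {B : AdaptedBasis f} (Q : PsiLift B) :
    {M : skewSymplectic ℓ g | IsPush M.1 X f} = ⋃ σ, upperHom B ⁻¹' {digitPoint Q σ} := by
  ext M
  rw [Set.mem_ofPred_eq, isPush_iff_exists_digits hs hω Q, Set.mem_iUnion]
  rfl

theorem setLIntegral_isPush (hs : Function.Surjective f) (hω : X.ω = omegaSum f)
    {B : AdaptedBasis f} (Q : PsiLift B) {G : skewSymplectic ℓ g → ℝ≥0∞}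
    {W : (UpperPair g → ZMod ℓ) → ℝ≥0∞}
    (hG : ∀ M σ, upperHom B M = digitPoint Q σ → G M = W σ) :
    ∫⁻ M in {M : skewSymplectic ℓ g | IsPush M.1 X f}, G M ∂skewHaar ℓ g =
      (∏ p : UpperPair g, (ℓ : ℝ≥0∞) ^ (digitExp B p + 1))⁻¹ * ∑ σ, W σ := by
  have hfib := fun z => skewHaar_fiber (upperHom B) (upperHom_surjective B)
    (measurableSet_upperHom_ker B) z
  rw [setOf_isPush_eq hs hω Q, lintegral_iUnion (fun σ => (hfib _).1), tsum_fintype,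
    Finset.mul_sum]
  · refine Finset.sum_congr rfl fun σ _ => ?_
    rw [setLIntegral_congr_fun (g := fun _ => W σ) (hfib _).1 fun M hM => hG M σ hM,
      setLIntegral_const, (hfib _).2, mul_comm, Nat.card_pi]
    congr 2
    push_cast
    refine Finset.prod_congr rfl fun p _ => ?_
    rw [Nat.card_zmod, Nat.cast_pow]
  · intro σ σ' hne
    refine Set.disjoint_left.2 fun M h1 h2 => hne (digitPoint_injective Q ?_)
    exact Eq.trans (Eq.symm h1) h2

/-- The digit matrix with prescribed free entries. -/
def digitMatrix (hs : Function.Surjective f) {B : AdaptedBasis f} (Q : PsiLift B)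
    (σ : UpperPair g → ZMod ℓ) : Matrix (Fin (g + g)) (Fin (g + g)) (ZMod ℓ) := fun i j =>
  if B.k j = 0 then σ ⟨(min i j, max i j), min_le_max⟩ else PadicInt.toZMod (psiDigit hs Q i j)

/-- In a column with k_j = 0, the congruences leave open precisely the digit that enters D. If
moreover i ≤ j, then k_i = 0 as well and the entry equals its mirror image up to 2ℓ^n ⟨x_i, x_j⟩,
which vanishes modulo ℓ. In a column with k_j > 0, the congruence modulo ℓ^{k_i + m_j} already
reaches this digit because m_j > 0. -/
theorem isDigitMatrix_digitMatrix (hn : 0 < n) (hs : Function.Surjective f) (hω : X.ω = omegaSum f)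
    {B : AdaptedBasis f} (Q : PsiLift B) {σ : UpperPair g → ZMod ℓ} {M : skewSymplectic ℓ g}
    (h : upperHom B M = digitPoint Q σ) : IsDigitMatrix B M (digitMatrix hs Q σ) := by
  have hpush := (isPush_iff_exists_digits hs hω Q M).2 ⟨σ, h⟩
  rw [isPush_iff_forall hs hω B Q] at hpush
  rw [upperHom_eq_digitPoint_iff] at h
  intro i j
  by_cases hj : B.k j = 0
  · have hval : ∀ u : ℤ_[ℓ], ∀ a : ZMod ℓ, PadicInt.toZMod ((a.val : ℤ_[ℓ]) + (ℓ : ℤ_[ℓ]) * u) = a := by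
      intro u a
      exact ((toZMod_eq_iff _ _).2 ⟨u, rfl⟩).trans (toZMod_natCast_val a)
    rw [digitMatrix, if_pos hj]
    rcases le_total j i with hij | hij
    · obtain ⟨u, hu⟩ := h ⟨(j, i), hij⟩
      have hm : B.m j = 0 := by rw [AdaptedBasis.m, hj, Nat.zero_min]
      refine ⟨((σ ⟨(j, i), hij⟩).val : ℤ_[ℓ]) + ℓ * u, ?_, ?_⟩
      · simp only [digitExp, hm, Q.q_eq_zero j hj, symp_zero_right, mul_zero, sub_zero,
          Nat.add_zero] at hu
        rw [sub_eq_iff_eq_add] at hu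
        rw [hu]
        ring
      · rw [hval]
        congr 2
        exact Prod.ext (min_eq_right hij).symm (max_eq_left hij).symm
    · obtain ⟨u, hu⟩ := h ⟨(i, j), hij⟩
      have hi : B.k i = 0 := Nat.eq_zero_of_le_zero (hj ▸ B.mono hij)
      have hm : B.m i = 0 := by rw [AdaptedBasis.m, hi, Nat.zero_min]
      obtain ⟨n', rfl⟩ : ∃ n', n = n' + 1 := ⟨n - 1, by omega⟩
      refine ⟨((σ ⟨(i, j), hij⟩).val : ℤ_[ℓ]) +
        ℓ * (u + 2 * (ℓ : ℤ_[ℓ]) ^ n' * symp (B.x i) (B.x j)), ?_, ?_⟩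
      · simp only [digitExp, hm, hj, Q.q_eq_zero i hi, symp_zero_right, mul_zero, sub_zero,
          pow_zero, one_mul, zero_add, pow_one] at hu
        rw [sub_eq_iff_eq_add] at hu
        rw [pairEntry_swap, hu, hi]
        ring
      · rw [hval]
        congr 2
        exact Prod.ext (min_eq_left hij).symm (max_eq_right hij).symm
  · obtain ⟨u, hu⟩ := hpush i j
    rw [digitMatrix, if_neg hj]
    obtain ⟨m', hm'⟩ : ∃ m', B.m j = m' + 1 := ⟨B.m j - 1, by have := B.m_pos hn hj; omega⟩
    refine ⟨psiDigit hs Q i j + ℓ * ((ℓ : ℤ_[ℓ]) ^ m' * u), ?_, (toZMod_eq_iff _ _).2 ⟨_, rfl⟩⟩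
    rw [psiDigit_spec hs, sub_eq_iff_eq_add, pow_add, hm', pow_succ] at hu
    rw [hu]
    ring

theorem psiDigit_reduction_eq_zero (hn : 0 < n) (hs : Function.Surjective f) {B : AdaptedBasis f}
    (Q : PsiLift B) {i j : Fin (g + g)} (hi : B.k i = 0) (hj : ¬ B.k j = 0) :
    (PadicInt.toZMod (psiDigit hs Q i j) : ZMod ℓ) = 0 := by
  have h := psiDigit_spec hs Q i j
  rw [hi, pow_zero, one_mul] at h
  rw [toZMod_eq_zero_iff, ← h]
  exact Dvd.dvd.mul_right (dvd_pow_self _ (B.m_pos hn hj).ne') _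

/-- The free blocks of a digit matrix. -/
def digitBlocks (B : AdaptedBasis f) : (UpperPair g → ZMod ℓ) →+
    symMatrix {i // B.k i = 0} (ZMod ℓ) × ({i // ¬ B.k i = 0} → {i // B.k i = 0} → ZMod ℓ) :=
  AddMonoidHom.mk' (fun σ => (⟨fun i j => σ ⟨(min i.1 j.1, max i.1 j.1), min_le_max⟩, by
    ext i j
    exact congrArg σ (Subtype.ext (Prod.ext (min_comm _ _) (max_comm _ _)))⟩,
    fun i j => σ ⟨(min i.1 j.1, max i.1 j.1), min_le_max⟩)) fun _ _ => rfl

theorem digitBlocks_surjective (B : AdaptedBasis f) : Function.Surjective (digitBlocks B) := by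
  rintro ⟨S, U⟩
  let σ : UpperPair g → ZMod ℓ := fun p =>
    if h1 : B.k p.1.1 = 0 then
      if h2 : B.k p.1.2 = 0 then S.1 ⟨p.1.1, h1⟩ ⟨p.1.2, h2⟩ else U ⟨p.1.2, h2⟩ ⟨p.1.1, h1⟩
    else 0
  refine ⟨σ, Prod.ext (Subtype.ext (Matrix.ext fun i j => ?_)) (funext fun i => funext fun j => ?_)⟩
  · change σ _ = _
    rcases le_total i.1 j.1 with h | h
    · simp only [σ, min_eq_left h, max_eq_right h, i.2, j.2, dif_pos]
    · simp only [σ, min_eq_right h, max_eq_left h, i.2, j.2, dif_pos]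
      exact congrFun (congrFun S.2 i) j
  · change σ _ = _
    -- Exponents increase, so indices with exponent 0 come first.
    have h : j.1 ≤ i.1 := by
      by_contra hc
      exact i.2 (Nat.eq_zero_of_le_zero ((B.mono (not_le.1 hc).le).trans_eq j.2))
    simp only [σ, min_eq_right h, max_eq_left h, j.2, dif_pos, i.2, dif_neg, not_false_eq_true]

theorem digitMatrix_submatrix (hn : 0 < n) (hs : Function.Surjective f) {B : AdaptedBasis f}
    (Q : PsiLift B) (σ : UpperPair g → ZMod ℓ) :
    (digitMatrix hs Q σ).submatrix (Equiv.sumCompl fun i => B.k i = 0)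
      (Equiv.sumCompl fun i => B.k i = 0) =
      Matrix.fromBlocks (digitBlocks B σ).1.1 0 (Matrix.of (digitBlocks B σ).2)
        (Matrix.of fun i j : {i // ¬ B.k i = 0} => PadicInt.toZMod (psiDigit hs Q i j)) := by
  ext (i | i) (j | j)
  · exact if_pos j.2
  · exact (if_neg j.2).trans (psiDigit_reduction_eq_zero hn hs Q i.2 j.2)
  · exact if_pos j.2
  · exact if_neg j.2

theorem expect_surjWeight_digitMatrix (hn : 0 < n) (hs : Function.Surjective f)
    {B : AdaptedBasis f} (Q : PsiLift B) (t : ℕ) :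
    𝔼 σ, surjWeight (ℓ : ℝ)⁻¹ t
      (Module.finrank (ZMod ℓ) (LinearMap.ker (digitMatrix hs Q σ).mulVecLin)) =
      surjWeight (ℓ : ℝ)⁻¹ t (Module.finrank (ZMod ℓ) (LinearMap.ker
        (Matrix.of fun i j : {i // ¬ B.k i = 0} =>
          (PadicInt.toZMod (psiDigit hs Q i j) : ZMod ℓ)).mulVecLin)) *
        symAverage (Fin (Fintype.card {i // B.k i = 0})) (ZMod ℓ) t := by
  have h := expect_surjWeight_fromBlocks (κ := {i // B.k i = 0}) (Matrix.of fun i j :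
    {i // ¬ B.k i = 0} => (PadicInt.toZMod (psiDigit hs Q i j) : ZMod ℓ)) t
  rw [ZMod.card] at h
  rw [← symAverage_eq_fin, ← h]
  rw [Finset.expect_congr rfl fun σ _ => by
    rw [← finrank_ker_mulVecLin_submatrix (Equiv.sumCompl fun i => B.k i = 0)
      (digitMatrix hs Q σ), digitMatrix_submatrix hn hs Q]]
  refine (expect_comp_of_surjective (digitBlocks B) (digitBlocks_surjective B) fun p =>
    surjWeight (ℓ : ℝ)⁻¹ t (Module.finrank (ZMod ℓ) (LinearMap.ker
      (Matrix.fromBlocks p.1.1 0 (Matrix.of p.2) (Matrix.of fun i j : {i // ¬ B.k i = 0} =>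
        (PadicInt.toZMod (psiDigit hs Q i j) : ZMod ℓ))).mulVecLin))).trans ?_
  exact Finset.expect_product _ _ _

/-- The fibres over the choices of free digits have equal mass, so the integral is the mass of the
push-forward condition times the average of c_t(corank) over these digits, which the block structure
evaluates. -/
theorem setLIntegral_isPush_surjWeight (hn : 0 < n) (hs : Function.Surjective f)
    (hω : X.ω = omegaSum f) (B : AdaptedBasis f) {s : ℕ} (hX : X.PsiCodim s) (t : ℕ)
    {d : skewSymplectic ℓ g → ℕ} (hd : ∀ M D, IsPush M.1 X f → IsDigitMatrix B M D →
      d M = Module.finrank (ZMod ℓ) (LinearMap.ker D.mulVecLin)) :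
    ∫⁻ M in {M : skewSymplectic ℓ g | IsPush M.1 X f}, surjWeightENN ℓ t (d M) ∂skewHaar ℓ g =
      (∏ p : UpperPair g, (ℓ : ℝ≥0∞) ^ digitExp B p)⁻¹ * ENNReal.ofReal
        (surjWeight (ℓ : ℝ)⁻¹ t s *
          symAverage (Fin (Fintype.card {i // B.k i = 0})) (ZMod ℓ) t) := by
  obtain ⟨Q⟩ := nonempty_psiLift hs B
  have hl : (ℓ : ℝ≥0∞) ≠ 0 := Nat.cast_ne_zero.2 hp.out.ne_zero
  have hs' : Module.finrank (ZMod ℓ) (LinearMap.ker (Matrix.of fun i j : {i // ¬ B.k i = 0} =>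
      (PadicInt.toZMod (psiDigit hs Q i j) : ZMod ℓ)).mulVecLin) = s :=
    Nat.pow_right_injective hp.out.two_le ((relIndex_psiImage hn hs Q).symm.trans hX)
  have h := expect_surjWeight_digitMatrix hn hs Q t
  rw [hs', Fintype.expect_eq_sum_div_card, div_eq_iff (Nat.cast_ne_zero.2 Fintype.card_ne_zero)] at h
  rw [setLIntegral_isPush hs hω Q (W := fun σ => surjWeightENN ℓ t
    (Module.finrank (ZMod ℓ) (LinearMap.ker (digitMatrix hs Q σ).mulVecLin))) fun M σ hM => by
      rw [hd M _ ((isPush_iff_exists_digits hs hω Q M).2 ⟨σ, hM⟩)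
        (isDigitMatrix_digitMatrix hn hs hω Q hM)]]
  simp only [surjWeightENN]
  rw [← ENNReal.ofReal_sum_of_nonneg fun σ _ => surjWeight_inv_nonneg _ _, h,
    ENNReal.ofReal_mul' (Nat.cast_nonneg _), ENNReal.ofReal_natCast, Fintype.card_fun, ZMod.card]
  simp_rw [pow_succ]
  rw [Finset.prod_mul_distrib, Finset.prod_const, Finset.card_univ,
    ENNReal.mul_inv (Or.inr (by finiteness)) (Or.inr (pow_ne_zero _ hl)), mul_assoc,
    mul_comm (ENNReal.ofReal _)]
  push_cast
  rw [ENNReal.inv_mul_cancel_left (pow_ne_zero _ hl) (by finiteness)]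

end DigitFibers

/-! ### Orders of tensor and symmetric squares -/

section SquareOrders

/-- If ∑ c_t a_t maps to zero, then N_t divides c_t for every t, and each term is already zero. This
replaces the computation of tensor products of cyclic groups. -/
theorem bijective_of_generators {A T : Type} [AddCommGroup A] [Fintype T] [DecidableEq T]
    {N : T → ℕ} {a : T → A} (hgen : AddSubgroup.closure (Set.range a) = ⊤)
    (hN : ∀ t, N t • a t = 0) (θ : A →+ ∀ t, ZMod (N t)) (hθ : ∀ t, θ (a t) = Pi.single t 1) :
    Function.Bijective θ := by
  have hsum : ∀ c : T → ℤ, θ (∑ t, c t • a t) = fun t => (c t : ZMod (N t)) := by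
    intro c
    ext t
    rw [map_sum, Finset.sum_apply, Finset.sum_eq_single t]
    · rw [map_zsmul, hθ, Pi.smul_apply, Pi.single_eq_same, zsmul_eq_mul, mul_one]
    · intro t' _ hne
      rw [map_zsmul, hθ, Pi.smul_apply, Pi.single_eq_of_ne hne.symm, smul_zero]
    · simp
  have hex : ∀ x : A, ∃ c : T → ℤ, x = ∑ t, c t • a t := by
    intro x
    have hx : x ∈ AddSubgroup.closure (Set.range a) := hgen ▸ AddSubgroup.mem_top x
    induction hx using AddSubgroup.closure_induction with
    | mem x hx =>
      obtain ⟨t, rfl⟩ := hx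
      refine ⟨Pi.single t 1, ?_⟩
      rw [Finset.sum_eq_single t]
      · simp
      · intro t' _ hne
        rw [Pi.single_eq_of_ne hne, zero_smul]
      · simp
    | zero => exact ⟨0, by simp⟩
    | add x y _ _ hx hy =>
      obtain ⟨c, rfl⟩ := hx
      obtain ⟨c', rfl⟩ := hy
      exact ⟨c + c', by simp [add_smul, Finset.sum_add_distrib]⟩
    | neg x _ hx =>
      obtain ⟨c, rfl⟩ := hx
      exact ⟨-c, by simp⟩
  constructor
  · rw [injective_iff_map_eq_zero]
    intro x hx
    obtain ⟨c, rfl⟩ := hex x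
    rw [hsum] at hx
    refine Finset.sum_eq_zero fun t _ => ?_
    obtain ⟨d, hd⟩ := (ZMod.intCast_zmod_eq_zero_iff_dvd (c t) (N t)).1 (congrFun hx t)
    rw [hd, mul_comm, mul_smul, natCast_zsmul, hN, smul_zero]
  · intro z
    choose c hc using fun t => ZMod.intCast_surjective (z t)
    exact ⟨_, (hsum c).trans (funext hc)⟩

variable {ℓ : ℕ} [hp : Fact ℓ.Prime] {H : Type} [AddCommGroup H] {ι : Type} [Fintype ι]
  [LinearOrder ι] {k : ι → ℕ} (e : H ≃+ ∀ i, ZMod (ℓ ^ k i))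

/-- The generators of the cyclic factors. -/
def coordGen (i : ι) : H := e.symm (Pi.single i 1)

/-- The coordinates with reduced precision. -/
def coordChar {N : ℕ} (i : ι) (h : N ≤ k i) : H →+ ZMod (ℓ ^ N) :=
  ((ZMod.castHom (pow_dvd_pow ℓ h) (ZMod (ℓ ^ N))).toAddMonoidHom.comp
    (Pi.evalAddMonoidHom (fun i => ZMod (ℓ ^ k i)) i)).comp e.toAddMonoidHom

theorem coordChar_coordGen {N : ℕ} (i j : ι) (h : N ≤ k i) :
    coordChar e i h (coordGen e j) = if i = j then 1 else 0 := by
  change ZMod.castHom (pow_dvd_pow ℓ h) (ZMod (ℓ ^ N)) (e (e.symm (Pi.single j 1)) i) = _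
  rw [e.apply_symm_apply]
  split_ifs with hij
  · subst hij
    rw [Pi.single_eq_same, map_one]
  · rw [Pi.single_eq_of_ne hij, map_zero]

theorem pow_nsmul_coordGen (i : ι) : ℓ ^ k i • coordGen e i = 0 := by
  apply e.injective
  rw [map_nsmul, coordGen, e.apply_symm_apply, map_zero, ← Pi.single_smul,
    ZModModule.char_nsmul_eq_zero, Pi.single_zero]

theorem closure_coordGen : AddSubgroup.closure (Set.range (coordGen e)) = ⊤ := by
  refine top_unique fun x _ => ?_
  rw [← e.symm_apply_apply x, ← Finset.univ_sum_single (e x), map_sum]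
  refine AddSubgroup.sum_mem _ fun i _ => ?_
  obtain ⟨c, hc⟩ := ZMod.intCast_surjective (e x i)
  have : (Pi.single i (e x i) : ∀ i, ZMod (ℓ ^ k i)) = c • Pi.single i 1 := by
    rw [← hc, ← Pi.single_smul, zsmul_eq_mul, mul_one]
  rw [this, map_zsmul]
  exact AddSubgroup.zsmul_mem _ (AddSubgroup.subset_closure (Set.mem_range_self i)) _

theorem closure_tmul_coordGen :
    AddSubgroup.closure (Set.range fun p : ι × ι => coordGen e p.1 ⊗ₜ[ℤ] coordGen e p.2) = ⊤ := by
  set C := AddSubgroup.closure (Set.range fun p : ι × ι => coordGen e p.1 ⊗ₜ[ℤ] coordGen e p.2)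
  have h1 : ∀ i y, coordGen e i ⊗ₜ[ℤ] y ∈ C := by
    intro i y
    have hy : y ∈ AddSubgroup.closure (Set.range (coordGen e)) :=
      closure_coordGen e ▸ AddSubgroup.mem_top y
    induction hy using AddSubgroup.closure_induction with
    | mem y hy =>
      obtain ⟨j, rfl⟩ := hy
      exact AddSubgroup.subset_closure ⟨(i, j), rfl⟩
    | zero => rw [TensorProduct.tmul_zero]; exact C.zero_mem
    | add y z _ _ hy hz => rw [TensorProduct.tmul_add]; exact C.add_mem hy hz
    | neg y _ hy => rw [TensorProduct.tmul_neg]; exact C.neg_mem hy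
  have h2 : ∀ x y : H, x ⊗ₜ[ℤ] y ∈ C := by
    intro x y
    have hx : x ∈ AddSubgroup.closure (Set.range (coordGen e)) :=
      closure_coordGen e ▸ AddSubgroup.mem_top x
    induction hx using AddSubgroup.closure_induction with
    | mem x hx =>
      obtain ⟨i, rfl⟩ := hx
      exact h1 i y
    | zero => rw [TensorProduct.zero_tmul]; exact C.zero_mem
    | add y z _ _ hy hz => rw [TensorProduct.add_tmul]; exact C.add_mem hy hz
    | neg y _ hy => rw [TensorProduct.neg_tmul]; exact C.neg_mem hy
  refine top_unique fun z _ => ?_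
  induction z with
  | zero => exact C.zero_mem
  | tmul x y => exact h2 x y
  | add a b ha hb => exact C.add_mem (ha trivial) (hb trivial)

theorem nsmul_tmul_coordGen {N : ℕ} (i j : ι) (h : k i = N ∨ k j = N) :
    ℓ ^ N • (coordGen e i ⊗ₜ[ℤ] coordGen e j) = 0 := by
  rcases h with rfl | rfl
  · rw [TensorProduct.smul_tmul', pow_nsmul_coordGen, TensorProduct.zero_tmul]
  · rw [← TensorProduct.tmul_smul, pow_nsmul_coordGen, TensorProduct.tmul_zero]

theorem tensorPairing_tmul {N : ℕ} (α β : H →+ ZMod N) (x y : H) :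
    tensorPairing α β (x ⊗ₜ[ℤ] y) = α x * β y := rfl

theorem card_tensorSq (e : H ≃+ ∀ i, ZMod (ℓ ^ k i)) : Nat.card (H ⊗[ℤ] H) = ∏ p : ι × ι, ℓ ^ min (k p.1) (k p.2) := by
  let θ : H ⊗[ℤ] H →+ ∀ p : ι × ι, ZMod (ℓ ^ min (k p.1) (k p.2)) :=
    AddMonoidHom.mk' (fun z p => tensorPairing (coordChar e p.1 (min_le_left _ _))
      (coordChar e p.2 (min_le_right _ _)) z) fun a b => funext fun p => map_add _ _ _
  have hθ : Function.Bijective θ := by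
    refine bijective_of_generators (closure_tmul_coordGen e) (fun p => ?_) θ fun p => ?_
    · refine nsmul_tmul_coordGen e p.1 p.2 ?_
      rcases min_choice (k p.1) (k p.2) with h | h
      · exact Or.inl h.symm
      · exact Or.inr h.symm
    · ext q
      change tensorPairing (coordChar e q.1 (min_le_left _ _)) (coordChar e q.2 (min_le_right _ _))
        (coordGen e p.1 ⊗ₜ[ℤ] coordGen e p.2) = _
      rw [tensorPairing_tmul, coordChar_coordGen, coordChar_coordGen]
      by_cases hq : q = p
      · subst hq
        rw [if_pos rfl, if_pos rfl, mul_one, Pi.single_eq_same]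
      · rw [Pi.single_eq_of_ne hq, ite_zero_mul_ite_zero, if_neg]
        exact fun h => hq (Prod.ext h.1 h.2)
  rw [Nat.card_congr (Equiv.ofBijective θ hθ), Nat.card_pi]
  exact Finset.prod_congr rfl fun p _ => Nat.card_zmod _

/-- The coordinates of the symmetric square. -/
def symSqCoord (hk : Monotone k) (p : {p : ι × ι // p.1 ≤ p.2}) : H ⊗[ℤ] H →+ ZMod (ℓ ^ k p.1.1) :=
  -- On the diagonal the symmetrised pairing would take the value 2 on the generator, hence the
  -- single pairing.
  if p.1.1 = p.1.2 then
    tensorPairing (coordChar e p.1.1 le_rfl) (coordChar e p.1.1 le_rfl)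
  else
    tensorPairing (coordChar e p.1.1 le_rfl) (coordChar e p.1.2 (hk p.2)) +
      tensorPairing (coordChar e p.1.2 (hk p.2)) (coordChar e p.1.1 le_rfl)

theorem wedgeSq_le_ker_symSqCoord (hk : Monotone k) (p : {p : ι × ι // p.1 ≤ p.2}) :
    wedgeSq H ≤ (symSqCoord e hk p).ker := by
  refine (AddSubgroup.closure_le _).2 ?_
  rintro _ ⟨x, y, rfl⟩
  rw [SetLike.mem_coe, AddMonoidHom.mem_ker, map_sub, sub_eq_zero, symSqCoord]
  split_ifs
  · rw [tensorPairing_tmul, tensorPairing_tmul, mul_comm]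
  · rw [AddMonoidHom.add_apply, AddMonoidHom.add_apply]
    simp only [tensorPairing_tmul]
    ring

theorem exists_symSqEquiv (e : H ≃+ ∀ i, ZMod (ℓ ^ k i)) (hk : Monotone k) :
    Nonempty (SymSq H ≃+ ∀ p : {p : ι × ι // p.1 ≤ p.2}, ZMod (ℓ ^ k p.1.1)) := by
  let Θ : H ⊗[ℤ] H →+ ∀ p : {p : ι × ι // p.1 ≤ p.2}, ZMod (ℓ ^ k p.1.1) :=
    AddMonoidHom.mk' (fun z p => symSqCoord e hk p z) fun a b => funext fun p => map_add _ _ _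
  let θ : SymSq H →+ ∀ p : {p : ι × ι // p.1 ≤ p.2}, ZMod (ℓ ^ k p.1.1) :=
    QuotientAddGroup.lift (wedgeSq H) Θ fun z hz =>
      funext fun p => wedgeSq_le_ker_symSqCoord e hk p hz
  let a : {p : ι × ι // p.1 ≤ p.2} → SymSq H := fun p =>
    QuotientAddGroup.mk' _ (coordGen e p.1.1 ⊗ₜ[ℤ] coordGen e p.1.2)
  refine ⟨AddEquiv.ofBijective θ (bijective_of_generators (a := a) ?_ (fun p => ?_) θ fun p => ?_)⟩
  · have hsymm : ∀ i j, (QuotientAddGroup.mk' (wedgeSq H)) (coordGen e i ⊗ₜ[ℤ] coordGen e j) =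
        QuotientAddGroup.mk' (wedgeSq H) (coordGen e j ⊗ₜ[ℤ] coordGen e i) := fun i j => by
      rw [← sub_eq_zero, ← map_sub]
      exact (QuotientAddGroup.eq_zero_iff _).2 (AddSubgroup.subset_closure ⟨_, _, rfl⟩)
    have h1 := congrArg (AddSubgroup.map (QuotientAddGroup.mk' (wedgeSq H)))
      (closure_tmul_coordGen e)
    rw [AddMonoidHom.map_closure, AddSubgroup.map_top_of_surjective _
      (QuotientAddGroup.mk'_surjective _)] at h1
    refine top_unique (h1.symm.le.trans ((AddSubgroup.closure_le _).2 ?_))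
    rintro _ ⟨_, ⟨⟨i, j⟩, rfl⟩, rfl⟩
    rcases le_total i j with h | h
    · exact AddSubgroup.subset_closure ⟨⟨(i, j), h⟩, rfl⟩
    · exact AddSubgroup.subset_closure ⟨⟨(j, i), h⟩, hsymm _ _⟩
  · rw [← map_nsmul, nsmul_tmul_coordGen e _ _ (Or.inl rfl), map_zero]
  · ext ⟨⟨i, j⟩, hij⟩
    obtain ⟨⟨i', j'⟩, hij'⟩ := p
    change symSqCoord e hk ⟨(i, j), hij⟩ (coordGen e i' ⊗ₜ[ℤ] coordGen e j') = _
    rw [symSqCoord]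
    dsimp only at hij hij' ⊢
    by_cases hq : i = i' ∧ j = j'
    · obtain ⟨rfl, rfl⟩ := hq
      rw [Pi.single_eq_same]
      split_ifs with h
      · subst h
        simp [tensorPairing_tmul, coordChar_coordGen]
      · simp [tensorPairing_tmul, coordChar_coordGen, h, Ne.symm h]
    · rw [Pi.single_eq_of_ne (by
        intro h
        exact hq ⟨congrArg (fun p => p.1.1) h, congrArg (fun p => p.1.2) h⟩)]
      split_ifs with h
      · subst h
        simp only [tensorPairing_tmul, coordChar_coordGen]
        by_cases h1 : i = i'
        · simp [h1]
          rintro rfl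
          exact absurd ⟨h1, h1⟩ hq
        · simp [h1]
      · simp only [AddMonoidHom.add_apply, tensorPairing_tmul, coordChar_coordGen]
        have h2 : ¬ (j = i' ∧ i = j') := by
          rintro ⟨rfl, rfl⟩
          exact h (le_antisymm hij hij')
        by_cases h1 : i = i'
        · have h3 : ¬ j = j' := fun h3 => hq ⟨h1, h3⟩
          by_cases h4 : j = i'
          · exact absurd (h1.trans h4.symm) h
          · simp [h3, h4]
        · by_cases h4 : j = i'
          · have : ¬ i = j' := fun h5 => h2 ⟨h4, h5⟩
            simp [h1, this]
          · simp [h1, h4]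

theorem card_symSq (e : H ≃+ ∀ i, ZMod (ℓ ^ k i)) (hk : Monotone k) :
    Nat.card (SymSq H) = ∏ p : {p : ι × ι // p.1 ≤ p.2}, ℓ ^ k p.1.1 := by
  obtain ⟨θ⟩ := exists_symSqEquiv e hk
  rw [Nat.card_congr θ.toEquiv, Nat.card_pi]
  exact Finset.prod_congr rfl fun p _ => Nat.card_zmod _

theorem card_tors_congr {A B : Type} [AddCommGroup A] [AddCommGroup B] (θ : A ≃+ B) (m : ℕ) :
    Nat.card (Tors A m) = Nat.card (Tors B m) := by
  refine Nat.card_congr (θ.toEquiv.subtypeEquiv fun x => ?_)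
  rw [mem_Tors, mem_Tors]
  change _ ↔ m • θ x = 0
  rw [← map_nsmul, map_eq_zero_iff θ θ.injective]

theorem card_tors_zmod (N d : ℕ) [NeZero N] : Nat.card (Tors (ZMod N) d) = N.gcd d := by
  have h := IsAddCyclic.card_nsmulAddMonoidHom_ker (G := ZMod N) d
  rw [Nat.card_zmod] at h
  rw [← h]
  refine Nat.card_congr (Equiv.subtypeEquivRight fun x => ?_)
  rw [mem_Tors]
  rfl

theorem gcd_pow_pow (a b : ℕ) : (ℓ ^ a).gcd (ℓ ^ b) = ℓ ^ min a b := by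
  rcases le_total a b with h | h
  · rw [min_eq_left h, Nat.gcd_eq_left (pow_dvd_pow ℓ h)]
  · rw [min_eq_right h, Nat.gcd_eq_right (pow_dvd_pow ℓ h)]

theorem card_tors_pi {T : Type} [Fintype T] (r : T → ℕ) (m : ℕ) :
    Nat.card (Tors (∀ t, ZMod (ℓ ^ r t)) (ℓ ^ m)) = ∏ t, ℓ ^ min (r t) m := by
  have e1 : Tors (∀ t, ZMod (ℓ ^ r t)) (ℓ ^ m) ≃ ∀ t, Tors (ZMod (ℓ ^ r t)) (ℓ ^ m) :=
    { toFun := fun x t => ⟨x.1 t, by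
        have := mem_Tors.1 x.2
        exact mem_Tors.2 (congrFun this t)⟩
      invFun := fun y => ⟨fun t => (y t).1, mem_Tors.2 (funext fun t => mem_Tors.1 (y t).2)⟩
      left_inv := fun _ => rfl
      right_inv := fun _ => rfl }
  rw [Nat.card_congr e1, Nat.card_pi]
  refine Finset.prod_congr rfl fun t _ => ?_
  rw [card_tors_zmod, gcd_pow_pow]

theorem card_tors_symSq (e : H ≃+ ∀ i, ZMod (ℓ ^ k i)) (hk : Monotone k) (m : ℕ) : Nat.card (Tors (SymSq H) (ℓ ^ m)) =
    ∏ p : {p : ι × ι // p.1 ≤ p.2}, ℓ ^ min (k p.1.1) m := by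
  obtain ⟨θ⟩ := exists_symSqEquiv e hk
  rw [card_tors_congr θ, card_tors_pi]

/-! ### Products over pairs -/

theorem prod_le_mul_prod_le (F : ι → ι → ℕ) :
    (∏ p : {p : ι × ι // p.1 ≤ p.2}, F p.1.1 p.1.2) * ∏ p : {p : ι × ι // p.1 ≤ p.2}, F p.1.2 p.1.1 =
      (∏ p : ι × ι, F p.1 p.2) * ∏ i, F i i := by
  have h1 : ∀ G : ι → ι → ℕ, (∏ p : {p : ι × ι // p.1 ≤ p.2}, G p.1.1 p.1.2) =
      ∏ i, ∏ j, if i ≤ j then G i j else 1 := by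
    intro G
    rw [← Finset.prod_subtype (Finset.univ.filter fun p : ι × ι => p.1 ≤ p.2) (by simp)
      (fun p => G p.1 p.2), Finset.prod_filter, ← Finset.univ_product_univ, Finset.prod_product]
  have h2 : ∏ i, F i i = ∏ i, ∏ j, if i = j then F i j else 1 := by
    refine Finset.prod_congr rfl fun i _ => ?_
    rw [Finset.prod_ite_eq Finset.univ i (fun j => F i j), if_pos (Finset.mem_univ _)]
  have h3 := h1 fun i j => F j i
  rw [Finset.prod_comm] at h3
  rw [h1 F, h3, h2, ← Finset.univ_product_univ, Finset.prod_product, ← Finset.prod_mul_distrib,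
    ← Finset.prod_mul_distrib]
  refine Finset.prod_congr rfl fun i _ => ?_
  rw [← Finset.prod_mul_distrib, ← Finset.prod_mul_distrib]
  refine Finset.prod_congr rfl fun j _ => ?_
  rcases lt_trichotomy i j with h | rfl | h
  · rw [if_pos h.le, if_neg (not_le.2 h), if_neg h.ne]
  · rw [if_pos le_rfl, if_pos rfl]
  · rw [if_neg (not_le.2 h), if_pos h.le, if_neg h.ne', one_mul, mul_one]

/-- The product over all pairs, with the diagonal counted once more, is a square: |H⊗H| |H| =
|Sym²H|². Cancel against |H⊗H| = |Sym²H| |∧²H|. -/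
theorem card_wedgeSq_mul [Finite H] (e : H ≃+ ∀ i, ZMod (ℓ ^ k i)) (hk : Monotone k) :
    Nat.card (wedgeSq H) * Nat.card H = Nat.card (SymSq H) := by
  have h1 : Nat.card (H ⊗[ℤ] H) = Nat.card (SymSq H) * Nat.card (wedgeSq H) :=
    AddSubgroup.card_eq_card_quotient_mul_card_addSubgroup _
  have h2 := prod_le_mul_prod_le fun i j : ι => ℓ ^ min (k i) (k j)
  have h3 : Nat.card H = ∏ i, ℓ ^ k i := by
    rw [Nat.card_congr e.toEquiv, Nat.card_pi]
    exact Finset.prod_congr rfl fun i _ => Nat.card_zmod _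
  simp only [min_self] at h2
  rw [← h3, ← card_tensorSq e, h1] at h2
  have h4 : ∀ p : {p : ι × ι // p.1 ≤ p.2}, min (k p.1.1) (k p.1.2) = k p.1.1 := fun p =>
    min_eq_left (hk p.2)
  have h5 : ∀ p : {p : ι × ι // p.1 ≤ p.2}, min (k p.1.2) (k p.1.1) = k p.1.1 := fun p =>
    min_eq_right (hk p.2)
  simp only [h4, h5] at h2
  rw [← card_symSq e hk, mul_assoc] at h2
  exact (Nat.eq_of_mul_eq_mul_left Nat.card_pos h2).symm

/-- The factors ℓ^{k_j} over i ≤ j, together with those ℓ^{k_i} that make up |Sym²H|, form |H| to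
the power of the number of indices plus one; the minima give the torsion of Sym²H. It converts the
probability of a push-forward into group orders. -/
theorem prod_pow_add_min [Finite H] (e : H ≃+ ∀ i, ZMod (ℓ ^ k i)) (hk : Monotone k) (m : ℕ) :
    (∏ p : {p : ι × ι // p.1 ≤ p.2}, ℓ ^ (k p.1.2 + min (k p.1.1) m)) * Nat.card (SymSq H) =
      Nat.card H ^ (Fintype.card ι + 1) * Nat.card (Tors (SymSq H) (ℓ ^ m)) := by
  have h3 : Nat.card H = ∏ i, ℓ ^ k i := by
    rw [Nat.card_congr e.toEquiv, Nat.card_pi]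
    exact Finset.prod_congr rfl fun i _ => Nat.card_zmod _
  have h2 := prod_le_mul_prod_le fun i _ : ι => ℓ ^ k i
  have h4 : ∏ p : ι × ι, ℓ ^ k p.1 = Nat.card H ^ Fintype.card ι := by
    rw [← Finset.univ_product_univ, Finset.prod_product, h3, ← Finset.prod_pow]
    exact Finset.prod_congr rfl fun i _ => Finset.prod_const (ℓ ^ k i)
  rw [h4, ← h3, ← pow_succ, ← card_symSq e hk] at h2
  rw [card_tors_symSq e hk, ← h2]
  simp_rw [pow_add]
  rw [Finset.prod_mul_distrib]
  ring

end SquareOrders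

/-! ### Counting homomorphisms with prescribed `ω` -/

section Counting

theorem addChar_sum_eq_prod {A ι : Type} [AddCommGroup A] (ψ : AddChar A ℂ) (s : Finset ι)
    (w : ι → A) : ψ (∑ i ∈ s, w i) = ∏ i ∈ s, ψ (w i) := by
  classical
  induction s using Finset.induction_on with
  | empty => simp
  | insert i s hi ih => rw [Finset.sum_insert hi, Finset.prod_insert hi, AddChar.map_add_eq_mul, ih]

open Classical in
/-- Equidistribution of sums of independent elements of a finite abelian group. -/
theorem tendsto_card_sum_eq {A S : Type} [AddCommGroup A] [Fintype A] [Fintype S] [Nonempty S]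
    (w : S → A) (hw : ∀ ψ : AddChar A ℂ, ψ ≠ 0 → ‖∑ s, ψ (w s)‖ < Fintype.card S) (a : A) :
    Tendsto (fun g : ℕ => ((Finset.univ.filter fun v : Fin g → S => ∑ i, w (v i) = a).card : ℝ) /
      (Fintype.card S : ℝ) ^ g) atTop (𝓝 (Fintype.card A : ℝ)⁻¹) := by
  have hA : (Fintype.card A : ℂ) ≠ 0 := Nat.cast_ne_zero.2 Fintype.card_ne_zero
  have hS : (Fintype.card S : ℝ) ≠ 0 := Nat.cast_ne_zero.2 Fintype.card_ne_zero
  -- Fourier inversion on A: the indicator of a is an average of characters, and the sum over v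
  -- factors over its coordinates.
  have hcount : ∀ g : ℕ,
      (((Finset.univ.filter fun v : Fin g → S => ∑ i, w (v i) = a).card : ℝ) /
        (Fintype.card S : ℝ) ^ g : ℝ) = (∑ ψ : AddChar A ℂ, (Fintype.card A : ℂ)⁻¹ * ψ (-a) *
          ((∑ s, ψ (w s)) / (Fintype.card S : ℂ)) ^ g : ℂ) := by
    intro g
    have h1 : ∀ v : Fin g → S, (if ∑ i, w (v i) = a then (1 : ℂ) else 0) =
        (Fintype.card A : ℂ)⁻¹ * ∑ ψ : AddChar A ℂ, ψ (-a) * ∏ i, ψ (w (v i)) := by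
      intro v
      have h2 : ∀ ψ : AddChar A ℂ, ψ (-a) * ∏ i, ψ (w (v i)) = ψ (∑ i, w (v i) - a) := by
        intro ψ
        rw [sub_eq_neg_add, AddChar.map_add_eq_mul, addChar_sum_eq_prod]
      simp_rw [h2]
      rw [AddChar.sum_apply_eq_ite, sub_eq_zero]
      split_ifs
      · rw [inv_mul_cancel₀ hA]
      · rw [mul_zero]
    push_cast
    rw [Finset.card_filter]
    push_cast
    rw [Finset.sum_congr rfl fun v _ => h1 v, ← Finset.mul_sum, Finset.sum_comm, Finset.mul_sum,
      Finset.sum_div]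
    refine Finset.sum_congr rfl fun ψ _ => ?_
    rw [← Finset.mul_sum, ← Fintype.sum_pow (fun s => ψ (w s)), div_pow]
    ring
  have hlim : Tendsto (fun g : ℕ => ∑ ψ : AddChar A ℂ, (Fintype.card A : ℂ)⁻¹ * ψ (-a) *
      ((∑ s, ψ (w s)) / (Fintype.card S : ℂ)) ^ g) atTop
      (𝓝 (∑ ψ : AddChar A ℂ, if ψ = 0 then (Fintype.card A : ℂ)⁻¹ else 0)) := by
    refine tendsto_finsetSum _ fun ψ _ => ?_
    split_ifs with h
    · subst h
      have h3 : (∑ s, (0 : AddChar A ℂ) (w s)) / (Fintype.card S : ℂ) = 1 := by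
        simp only [AddChar.zero_apply, Finset.sum_const, Finset.card_univ, nsmul_eq_mul, mul_one]
        exact div_self (by exact_mod_cast hS)
      simp only [h3, one_pow, mul_one]
      simp only [AddChar.zero_apply, mul_one]
      exact tendsto_const_nhds
    · have h3 : ‖(∑ s, ψ (w s)) / (Fintype.card S : ℂ)‖ < 1 := by
        rw [norm_div, Complex.norm_natCast, div_lt_one (by positivity)]
        exact hw ψ h
      simpa using (tendsto_pow_atTop_nhds_zero_of_norm_lt_one h3).const_mul
        ((Fintype.card A : ℂ)⁻¹ * ψ (-a))
  rw [Finset.sum_ite_eq' Finset.univ, if_pos (Finset.mem_univ _)] at hlim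
  have hre := (Complex.continuous_re.tendsto _).comp hlim
  refine (hre.congr fun g => ?_).trans_eq ?_
  · rw [Function.comp_apply, ← hcount, Complex.ofReal_re]
  · rw [← Complex.ofReal_natCast, ← Complex.ofReal_inv, Complex.ofReal_re]

variable {H : Type} [AddCommGroup H] [Finite H]

/-- `x ∧ y`. -/
def wedgeElt (p : H × H) : wedgeSq H :=
  ⟨p.1 ⊗ₜ[ℤ] p.2 - p.2 ⊗ₜ[ℤ] p.1, AddSubgroup.subset_closure ⟨_, _, rfl⟩⟩

theorem addChar_wedge_eq_zero {ψ : AddChar (wedgeSq H) ℂ} (h : ∀ x y, ψ (wedgeElt (x, y)) = 1) :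
    ψ = 0 := by
  ext ⟨z, hz⟩
  rw [AddChar.zero_apply]
  induction hz using AddSubgroup.closure_induction with
  | mem z hz =>
    obtain ⟨x, y, rfl⟩ := hz
    exact h x y
  | zero => exact AddChar.map_zero_eq_one ψ
  | add a b ha hb h1 h2 =>
    have := AddChar.map_add_eq_mul ψ ⟨a, ha⟩ ⟨b, hb⟩
    rw [h1, h2, mul_one] at this
    exact this
  | neg a ha h1 =>
    have := AddChar.map_neg_eq_inv ψ ⟨a, ha⟩
    rw [h1, inv_one] at this
    exact this

/-- For fixed x, y ↦ ψ(x ∧ y) is a character of H and sums to |H| or 0. A nontrivial ψ gives 0 for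
at least one x, because the elements x ∧ y generate. -/
theorem norm_sum_addChar_wedge_lt [Fintype H] {ψ : AddChar (wedgeSq H) ℂ} (hψ : ψ ≠ 0) :
    ‖∑ p : H × H, ψ (wedgeElt p)‖ < Fintype.card (H × H) := by
  classical
  let χ : H → AddChar H ℂ := fun x =>
    { toFun := fun y => ψ (wedgeElt (x, y))
      map_zero_eq_one' := by
        rw [← AddChar.map_zero_eq_one ψ]
        congr 1
        exact Subtype.ext (by simp [wedgeElt])
      map_add_eq_mul' := fun y z => by
        rw [← AddChar.map_add_eq_mul]
        congr 1
        refine Subtype.ext ?_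
        simp only [wedgeElt, AddSubgroup.coe_add, TensorProduct.tmul_add, TensorProduct.add_tmul]
        abel }
  have hχ : ∀ x y, χ x y = ψ (wedgeElt (x, y)) := fun _ _ => rfl
  have hx : ∃ x, χ x ≠ 0 := by
    by_contra! h
    refine hψ (addChar_wedge_eq_zero fun x y => ?_)
    rw [← hχ, h, AddChar.zero_apply]
  obtain ⟨x₀, hx₀⟩ := hx
  have h1 : ∀ x, ‖∑ y, χ x y‖ ≤ Fintype.card H := fun x => by
    rw [AddChar.sum_eq_ite]
    split_ifs
    · rw [Complex.norm_natCast]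
    · rw [norm_zero]; positivity
  rw [Fintype.sum_prod_type, Fintype.card_prod]
  refine (norm_sum_le _ _).trans_lt ?_
  have h2 : ∑ x : H, ‖∑ y, χ x y‖ < ∑ _x : H, (Fintype.card H : ℝ) := by
    refine Finset.sum_lt_sum (fun x _ => h1 x) ⟨x₀, Finset.mem_univ _, ?_⟩
    rw [AddChar.sum_eq_ite, if_neg hx₀, norm_zero]
    exact Nat.cast_pos.2 Fintype.card_pos
  refine h2.trans_eq ?_
  rw [Finset.sum_const, nsmul_eq_mul, Finset.card_univ]
  push_cast
  rfl

variable {ℓ : ℕ} [hp : Fact ℓ.Prime]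

/-- A homomorphism is given by the images of the pairs `e_i`, `f_i`. -/
def sympHomEquiv (hH : ∀ x : H, ∃ k : ℕ, ℓ ^ k • x = 0) (g : ℕ) :
    (SympLattice ℓ g →+ H) ≃ (Fin g → H × H) :=
  (latticeHomEquiv hH (Fin g ⊕ Fin g)).trans
    ((Equiv.sumArrowEquivProdArrow _ _ _).trans (Equiv.arrowProdEquivProdArrow _ _ _).symm)

theorem omegaSum_eq_sum_wedgeElt (hH : ∀ x : H, ∃ k : ℕ, ℓ ^ k • x = 0) {g : ℕ}
    (f : SympLattice ℓ g →+ H) :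
    omegaSum f = ((∑ i, wedgeElt (sympHomEquiv hH g f i) : wedgeSq H) : H ⊗[ℤ] H) := by
  rw [AddSubgroup.val_finsetSum]
  rfl

theorem card_omegaSum_eq (hH : ∀ x : H, ∃ k : ℕ, ℓ ^ k • x = 0) (ω : wedgeSq H) [Fintype H] (g : ℕ)
    [DecidableEq (wedgeSq H)] :
    Nat.card {f : SympLattice ℓ g →+ H // (ω : H ⊗[ℤ] H) = omegaSum f} =
      (Finset.univ.filter fun v : Fin g → H × H => ∑ i, wedgeElt (v i) = ω).card := by
  rw [← Fintype.card_subtype, ← Nat.card_eq_fintype_card]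
  refine Nat.card_congr ((sympHomEquiv hH g).subtypeEquiv fun f => ?_)
  rw [omegaSum_eq_sum_wedgeElt hH, Subtype.coe_inj, eq_comm]

theorem card_not_surjective_le (hH : ∀ x : H, ∃ k : ℕ, ℓ ^ k • x = 0)
    [Fintype {K : AddSubgroup H // K ≠ ⊤}] (g : ℕ) :
    Nat.card {f : SympLattice ℓ g →+ H // ¬ Function.Surjective f} ≤
      ∑ K : {K : AddSubgroup H // K ≠ ⊤}, Nat.card K.1 ^ (g + g) := by
  let φ : {f : SympLattice ℓ g →+ H // ¬ Function.Surjective f} →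
      Σ K : {K : AddSubgroup H // K ≠ ⊤}, (Fin g ⊕ Fin g → K.1) := fun f =>
    ⟨⟨f.1.range, fun h => f.2 (AddMonoidHom.range_eq_top.1 h)⟩,
      fun i => ⟨f.1 (Pi.single i 1), Pi.single i 1, rfl⟩⟩
  have hφ : Function.Injective φ := by
    refine Function.Injective.of_comp
      (f := fun p : Σ K : {K : AddSubgroup H // K ≠ ⊤}, (Fin g ⊕ Fin g → K.1) =>
        fun i => (p.2 i : H)) ?_
    exact (latticeHomEquiv hH (Fin g ⊕ Fin g)).injective.comp Subtype.val_injective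
  refine (Nat.card_le_card_of_injective φ hφ).trans_eq ?_
  rw [Nat.card_sigma]
  refine Finset.sum_congr rfl fun K _ => ?_
  rw [Nat.card_fun, Nat.card_sum, Nat.card_fin]

/-- The images of the pairs (e_i, f_i) are independent, so ω is equidistributed in ∧²H.
Non-surjective maps have image in a proper subgroup K, and ∑ (|K|/|H|)^{2g} → 0. -/
theorem tendsto_card_surjective_omegaSum (hH : ∀ x : H, ∃ k : ℕ, ℓ ^ k • x = 0) (ω : wedgeSq H) :
    Tendsto (fun g : ℕ => (Nat.card {f : SympLattice ℓ g →+ H //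
      Function.Surjective f ∧ (ω : H ⊗[ℤ] H) = omegaSum f} : ℝ) / (Nat.card H : ℝ) ^ (g + g)) atTop
      (𝓝 (Nat.card (wedgeSq H) : ℝ)⁻¹) := by
  classical
  have := Fintype.ofFinite H
  have := Fintype.ofFinite (wedgeSq H)
  have := Fintype.ofFinite {K : AddSubgroup H // K ≠ ⊤}
  have hH0 : (0 : ℝ) < Nat.card H := Nat.cast_pos.2 Nat.card_pos
  have h1 := tendsto_card_sum_eq (wedgeElt (H := H)) (fun ψ hψ => norm_sum_addChar_wedge_lt hψ) ω
  have hcard := fun g => card_omegaSum_eq (ℓ := ℓ) hH ω g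
  have hpow : ∀ g : ℕ, (Fintype.card (H × H) : ℝ) ^ g = (Nat.card H : ℝ) ^ (g + g) := fun g => by
    rw [Fintype.card_prod, ← Nat.card_eq_fintype_card, Nat.cast_mul, mul_pow, pow_add]
  simp_rw [hpow] at h1
  rw [← Nat.card_eq_fintype_card] at h1
  replace h1 : Tendsto (fun g : ℕ => (Nat.card {f : SympLattice ℓ g →+ H //
      (ω : H ⊗[ℤ] H) = omegaSum f} : ℝ) / (Nat.card H : ℝ) ^ (g + g)) atTop
      (𝓝 (Nat.card (wedgeSq H) : ℝ)⁻¹) := by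
    refine h1.congr fun g => ?_
    rw [hcard]
    congr!
  have h2 : Tendsto (fun g : ℕ => ∑ K : {K : AddSubgroup H // K ≠ ⊤},
      ((Nat.card K.1 : ℝ) / Nat.card H) ^ (g + g)) atTop (𝓝 0) := by
    rw [← Finset.sum_const_zero (s := (Finset.univ : Finset {K : AddSubgroup H // K ≠ ⊤}))]
    refine tendsto_finsetSum _ fun K _ => ?_
    have hK : Nat.card K.1 < Nat.card H := by
      refine lt_of_le_of_ne (AddSubgroup.card_le_card_addGroup _) fun h => K.2 ?_
      exact AddSubgroup.eq_top_of_card_eq _ h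
    have h3 : (Nat.card K.1 : ℝ) / Nat.card H < 1 := by
      rw [div_lt_one hH0]
      exact_mod_cast hK
    exact (tendsto_pow_atTop_nhds_zero_of_lt_one (by positivity) h3).comp
      (tendsto_atTop_mono (fun g => Nat.le_add_left g g) tendsto_id)
  have hfin : ∀ g : ℕ, Finite (SympLattice ℓ g →+ H) := fun g =>
    Finite.of_equiv _ (latticeHomEquiv hH (Fin g ⊕ Fin g)).symm
  have hle : ∀ g : ℕ, Nat.card {f : SympLattice ℓ g →+ H // (ω : H ⊗[ℤ] H) = omegaSum f} ≤
      Nat.card {f : SympLattice ℓ g →+ H //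
        Function.Surjective f ∧ (ω : H ⊗[ℤ] H) = omegaSum f} +
        Nat.card {f : SympLattice ℓ g →+ H // ¬ Function.Surjective f} := by
    intro g
    have := hfin g
    rw [← Nat.card_sum]
    refine Nat.card_le_card_of_injective (fun f => if h : Function.Surjective f.1 then
      Sum.inl ⟨f.1, h, f.2⟩ else Sum.inr ⟨f.1, h⟩) fun f f' hff => ?_
    dsimp only at hff
    split_ifs at hff
    · exact Subtype.ext (Subtype.mk.inj (Sum.inl.inj hff))
    · exact Subtype.ext (Subtype.mk.inj (Sum.inr.inj hff))
  have hlow := h1.sub h2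
  rw [sub_zero] at hlow
  refine tendsto_of_tendsto_of_tendsto_of_le_of_le hlow h1 (fun g => ?_) fun g => ?_
  · have h4 : (Nat.card {f : SympLattice ℓ g →+ H // ¬ Function.Surjective f} : ℝ) ≤
        ∑ K : {K : AddSubgroup H // K ≠ ⊤}, (Nat.card K.1 : ℝ) ^ (g + g) := by
      exact_mod_cast card_not_surjective_le hH g
    have h5 : (Nat.card {f : SympLattice ℓ g →+ H // (ω : H ⊗[ℤ] H) = omegaSum f} : ℝ) ≤
      Nat.card {f : SympLattice ℓ g →+ H //
        Function.Surjective f ∧ (ω : H ⊗[ℤ] H) = omegaSum f} +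
        Nat.card {f : SympLattice ℓ g →+ H // ¬ Function.Surjective f} := by
      exact_mod_cast hle g
    simp_rw [div_pow]
    rw [← Finset.sum_div, ← sub_div]
    exact div_le_div_of_nonneg_right (by linarith) (by positivity)
  · have := hfin g
    refine div_le_div_of_nonneg_right (Nat.cast_le.2 ?_) (by positivity)
    exact Nat.card_le_card_of_injective (fun f => ⟨f.1, f.2.2⟩) fun f f' hff =>
      Subtype.ext (Subtype.mk.inj hff)

end Counting

/-! ### The law of the cokernel -/

section CokernelLaw

variable {ℓ n g : ℕ} [hp : Fact ℓ.Prime]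

theorem IsDigitMatrix.unique {X : BEG ℓ n} {f : SympLattice ℓ g →+ X.carrier} {B : AdaptedBasis f}
    {M : skewSymplectic ℓ g} {D D' : Matrix (Fin (g + g)) (Fin (g + g)) (ZMod ℓ)}
    (h : IsDigitMatrix B M D) (h' : IsDigitMatrix B M D') : D = D' := by
  ext i j
  obtain ⟨c, hc, hD⟩ := h i j
  obtain ⟨c', hc', hD'⟩ := h' i j
  rw [← hD, ← hD', mul_left_cancel₀ (pow_ne_zero _ padic_prime_ne_zero) (hc.symm.trans hc')]

theorem measurable_upperHom {X : BEG ℓ n} {f : SympLattice ℓ g →+ X.carrier} (B : AdaptedBasis f)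
    {T : Type*} [MeasurableSpace T] (W : (∀ p : UpperPair g, ZMod (ℓ ^ (digitExp B p + 1))) → T) :
    Measurable fun M => W (upperHom B M) := fun s _ => by
  have h : (fun M => W (upperHom B M)) ⁻¹' s = ⋃ b ∈ W ⁻¹' s, upperHom B ⁻¹' {b} := by
    ext M; simp
  rw [h]
  exact MeasurableSet.biUnion (Set.to_countable _) fun b _ =>
    (skewHaar_fiber _ (upperHom_surjective B) (measurableSet_upperHom_ker B) b).1

theorem measurableSet_isPush {X : BEG ℓ n} {f : SympLattice ℓ g →+ X.carrier}
    (hs : Function.Surjective f) : MeasurableSet {M : skewSymplectic ℓ g | IsPush M.1 X f} := by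
  by_cases hω : X.ω = omegaSum f
  · obtain ⟨B⟩ := nonempty_adaptedBasis X.isPGroup f
    obtain ⟨Q⟩ := nonempty_psiLift hs B
    rw [setOf_isPush_eq hs hω Q]
    exact MeasurableSet.iUnion fun σ =>
      (skewHaar_fiber _ (upperHom_surjective B) (measurableSet_upperHom_ker B) _).1
  · convert MeasurableSet.empty using 1
    exact Set.eq_empty_of_forall_notMem fun M hM => hω hM.omega_eq

/-- The rank of the kernel of the morphism induced by `f`, as a function of `M`. -/
theorem exists_kerRank (hn : 0 < n) {X : BEG ℓ n} {f : SympLattice ℓ g →+ X.carrier}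
    (hs : Function.Surjective f) (hω : X.ω = omegaSum f) (B : AdaptedBasis f) :
    ∃ d : skewSymplectic ℓ g → ℕ, Measurable d ∧
      (∀ M D, IsPush M.1 X f → IsDigitMatrix B M D →
        d M = Module.finrank (ZMod ℓ) (LinearMap.ker D.mulVecLin)) ∧
      ∀ (M : skewSymplectic ℓ g) (H : BEG ℓ n) (fH : SympLattice ℓ g →+ H.carrier)
        (π : H.carrier →+ X.carrier), IsPush M.1 X f → Function.Surjective fH →
        (∀ x, fH x = 0 ↔ ∃ y, x = shifted n M.1 y) → π.comp fH = f →
        d M = genRank ℓ π.ker := by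
  obtain ⟨Q⟩ := nonempty_psiLift hs B
  -- The free digits are read off from finitely many entries by inverting `digitPoint`. Off the
  -- push-forward set the value is irrelevant, but the function is defined and measurable
  -- everywhere.
  let W : (∀ p : UpperPair g, ZMod (ℓ ^ (digitExp B p + 1))) → ℕ := fun b =>
    Module.finrank (ZMod ℓ)
      (LinearMap.ker (digitMatrix hs Q (Function.invFun (digitPoint Q) b)).mulVecLin)
  have hD : ∀ M, IsPush M.1 X f → ∃ D, IsDigitMatrix B M D ∧
      W (upperHom B M) = Module.finrank (ZMod ℓ) (LinearMap.ker D.mulVecLin) := by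
    intro M hM
    obtain ⟨σ, hσ⟩ := (isPush_iff_exists_digits hs hω Q M).1 hM
    refine ⟨_, isDigitMatrix_digitMatrix hn hs hω Q hσ, ?_⟩
    simp only [W]
    rw [hσ, Function.leftInverse_invFun (digitPoint_injective Q) σ]
  refine ⟨fun M => W (upperHom B M), measurable_upperHom B W, ?_, ?_⟩
  · intro M D hM hMD
    obtain ⟨D', h1, h2⟩ := hD M hM
    exact h2.trans (by rw [h1.unique hMD])
  · intro M H fH π hM hfs hker hπ
    obtain ⟨D', h1, h2⟩ := hD M hM
    exact h2.trans (genRank_eq_finrank hfs hker π hπ B h1).symm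

/-- The set is closed: by compactness of the lattice, projecting away y preserves closedness. -/
theorem measurableSet_ker_le_range_shifted (K : Set (SympLattice ℓ g)) :
    MeasurableSet {M : skewSymplectic ℓ g | ∀ x ∈ K, ∃ y, x = shifted n M.1 y} := by
  refine IsClosed.measurableSet ?_
  simp only [Set.ofPred_forall]
  refine isClosed_iInter fun x => isClosed_iInter fun _ => ?_
  have h : {M : skewSymplectic ℓ g | ∃ y, x = shifted n M.1 y} =
      Prod.fst '' {p : skewSymplectic ℓ g × SympLattice ℓ g | x = shifted n p.1.1 p.2} := by
    ext M; simp
  rw [h]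
  refine isClosedMap_fst_of_compactSpace _ (isClosed_eq continuous_const ?_)
  simp only [shifted_apply]
  have h1 : Continuous fun p : skewSymplectic ℓ g × SympLattice ℓ g => (ℓ : ℤ_[ℓ]) ^ n • p.2 :=
    continuous_pi fun i => continuous_const.mul ((continuous_apply i).comp continuous_snd)
  refine Continuous.add ?_ h1
  exact Continuous.matrix_mulVec (continuous_subtype_val.comp continuous_fst) continuous_snd

instance finite_latticeHom (X : BEG ℓ n) (g : ℕ) : Finite (SympLattice ℓ g →+ X.carrier) :=
  Finite.of_equiv _ (latticeHomEquiv X.isPGroup (Fin g ⊕ Fin g)).symm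

theorem measurableSet_isCokernelBEG (X : BEG ℓ n) :
    MeasurableSet {M : skewSymplectic ℓ g | IsCokernelBEG M.1 X} := by
  have h : {M : skewSymplectic ℓ g | IsCokernelBEG M.1 X} =
      ⋃ f : {f : SympLattice ℓ g →+ X.carrier // Function.Surjective f},
        {M | IsPush M.1 X f.1} ∩ {M | ∀ x ∈ {x | f.1 x = 0}, ∃ y, x = shifted n M.1 y} := by
    ext M
    rw [Set.mem_ofPred_eq, isCokernelBEG_iff]
    simp [and_left_comm]
  rw [h]
  exact MeasurableSet.iUnion fun f =>
    (measurableSet_isPush f.2).inter (measurableSet_ker_le_range_shifted _)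

/-- The matrices `M` with cokernel of class `c`. -/
def cokernelSet (g : ℕ) (c : BEGClass ℓ n) : Set (skewSymplectic ℓ g) :=
  {M | IsCokernelBEG M.1 c.rep}

theorem linearMeasure_singleton (g : ℕ) (c : BEGClass ℓ n) :
    linearMeasure ℓ n g {c} = skewHaar ℓ g (cokernelSet g c) := by
  classical
  rw [linearMeasure, Measure.sum_apply _ (measurableSet_singleton c), tsum_eq_single c]
  · simp [cokernelSet]
  · intro c' hc
    simp [hc]

theorem pairwise_disjoint_cokernelSet :
    Pairwise (Function.onFun Disjoint (cokernelSet (ℓ := ℓ) (n := n) g)) := by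
  intro c c' hc
  refine Set.disjoint_left.2 fun M hM hM' => hc ?_
  rw [← BEG.cls_rep c, ← BEG.cls_rep c']
  exact BEG.cls_eq_iff.2 (IsCokernelBEG.iso hM hM')

theorem tendsto_tail_bound (ℓ : ℕ) [Fact ℓ.Prime] :
    Tendsto (fun N : ℕ => ((N : ℝ≥0∞) + 1) / (ℓ ^ N : ℝ≥0∞)) atTop (𝓝 0) := by
  have hl : (1 : ℝ) < ℓ := by exact_mod_cast (Fact.out : ℓ.Prime).one_lt
  have h1 : Tendsto (fun N : ℕ => ((N : ℝ) + 1) / (ℓ : ℝ) ^ N) atTop (𝓝 0) := by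
    have h2 := tendsto_pow_const_div_const_pow_of_one_lt 1 hl
    have h3 := tendsto_pow_const_div_const_pow_of_one_lt 0 hl
    have h4 := h2.add h3
    simp only [pow_one, pow_zero, add_zero] at h4
    exact h4.congr fun N => (add_div _ _ _).symm
  have h5 := (ENNReal.continuous_ofReal.tendsto 0).comp h1
  rw [ENNReal.ofReal_zero] at h5
  refine h5.congr fun N => ?_
  have : (0 : ℝ) < (ℓ : ℝ) ^ N := by positivity
  rw [Function.comp_apply, ENNReal.ofReal_div_of_pos this, ENNReal.ofReal_add (by positivity) (by simp),
    ENNReal.ofReal_natCast, ENNReal.ofReal_one, ENNReal.ofReal_pow (by positivity),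
    ENNReal.ofReal_natCast]

theorem skewHaar_compl_iUnion_cokernelSet (hℓ : ℓ ≠ 2) (n g : ℕ) :
    skewHaar ℓ g (⋃ c : BEGClass ℓ n, cokernelSet g c)ᶜ = 0 := by
  refine le_antisymm (ge_of_tendsto' (tendsto_tail_bound ℓ) fun N => ?_) bot_le
  refine (measure_mono fun M hM => ?_).trans (skewHaar_not_exists_le (g := g) hℓ n N)
  rintro ⟨X, hX, -⟩
  exact hM (Set.mem_iUnion.2 ⟨X.cls, hX.of_iso (BEG.iso_rep_cls X).symm⟩)

theorem lintegral_skewHaar_eq_tsum (hℓ : ℓ ≠ 2) (n g : ℕ) (G : skewSymplectic ℓ g → ℝ≥0∞) :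
    ∫⁻ M, G M ∂skewHaar ℓ g = ∑' c : BEGClass ℓ n, ∫⁻ M in cokernelSet g c, G M ∂skewHaar ℓ g := by
  rw [← lintegral_iUnion (s := cokernelSet g) (fun c => measurableSet_isCokernelBEG c.rep)
    pairwise_disjoint_cokernelSet]
  rw [Measure.restrict_eq_self_of_ae_mem]
  rw [ae_iff]
  exact skewHaar_compl_iUnion_cokernelSet hℓ n g

theorem tsum_linearMeasure (hℓ : ℓ ≠ 2) (n g : ℕ) :
    ∑' c : BEGClass ℓ n, linearMeasure ℓ n g {c} = 1 := by
  have h := lintegral_skewHaar_eq_tsum hℓ n g fun _ => 1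
  simp only [lintegral_const, one_mul, measure_univ, Measure.restrict_apply MeasurableSet.univ,
    Set.univ_inter] at h
  rw [h]
  exact tsum_congr fun c => linearMeasure_singleton g c

theorem tsum_linearMeasure_tail (hℓ : ℓ ≠ 2) (n g N : ℕ) :
    ∑' c : {c : BEGClass ℓ n | ℓ ^ N < Nat.card c.rep.carrier}, linearMeasure ℓ n g {c.1} ≤
      (N + 1) / (ℓ ^ N : ℝ≥0∞) := by
  calc ∑' c : {c : BEGClass ℓ n | ℓ ^ N < Nat.card c.rep.carrier}, linearMeasure ℓ n g {c.1}
      = skewHaar ℓ g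
        (⋃ c : {c : BEGClass ℓ n | ℓ ^ N < Nat.card c.rep.carrier}, cokernelSet g c.1) := by
        rw [measure_iUnion (f := fun c : {c : BEGClass ℓ n | ℓ ^ N < Nat.card c.rep.carrier} =>
          cokernelSet g c.1) (fun c c' h => pairwise_disjoint_cokernelSet
          fun h' => h (Subtype.ext h')) fun c => measurableSet_isCokernelBEG (c : BEGClass ℓ n).rep]
        exact tsum_congr fun c => linearMeasure_singleton g c.1
    _ ≤ _ := (measure_mono fun M hM => ?_).trans (skewHaar_not_exists_le (g := g) hℓ n N)
  obtain ⟨c, hc⟩ := Set.mem_iUnion.1 hM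
  rintro ⟨X, hX, hle⟩
  exact absurd c.2 (not_lt.2 ((IsCokernelBEG.iso hc hX).card_eq.trans_le hle))

/-- Integrals of weighted counts of surjections against the linear measures. -/
theorem lintegral_surjSum_linearMeasure (hℓ : ℓ ≠ 2) (hn : 0 < n) (X : BEG ℓ n) (t g : ℕ)
    [Fintype {f : SympLattice ℓ g →+ X.carrier // Function.Surjective f ∧ X.ω = omegaSum f}]
    {V : ℝ≥0∞}
    (hV : ∀ f : {f : SympLattice ℓ g →+ X.carrier // Function.Surjective f ∧ X.ω = omegaSum f},
      ∃ B : AdaptedBasis f.1, ∀ d : skewSymplectic ℓ g → ℕ,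
      (∀ M D, IsPush M.1 X f.1 → IsDigitMatrix B M D →
        d M = Module.finrank (ZMod ℓ) (LinearMap.ker D.mulVecLin)) →
      ∫⁻ M in {M : skewSymplectic ℓ g | IsPush M.1 X f.1}, surjWeightENN ℓ t (d M) ∂skewHaar ℓ g = V) :
    ∫⁻ c, surjSum (surjWeightENN ℓ t) c.rep X ∂linearMeasure ℓ n g =
      Nat.card {f : SympLattice ℓ g →+ X.carrier // Function.Surjective f ∧ X.ω = omegaSum f} * V := by
  classical
  choose B hB using hV
  choose d hdm hd1 hd2 using fun f : {f : SympLattice ℓ g →+ X.carrier //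
    Function.Surjective f ∧ X.ω = omegaSum f} => exists_kerRank hn f.2.1 f.2.2 (B f)
  -- The index set involves ω only and not M, so the sum over surjections can be exchanged with the
  -- integral; the dependence on M sits in the indicator.
  let G : {f : SympLattice ℓ g →+ X.carrier // Function.Surjective f ∧ X.ω = omegaSum f} →
      skewSymplectic ℓ g → ℝ≥0∞ := fun f =>
    {M : skewSymplectic ℓ g | IsPush M.1 X f.1}.indicator fun M => surjWeightENN ℓ t (d f M)
  have hGm : ∀ f, Measurable (G f) := fun f =>
    Measurable.indicator ((measurable_of_countable (surjWeightENN ℓ t)).comp (hdm f))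
      (measurableSet_isPush f.2.1)
  have hG : ∀ f, ∫⁻ M, G f M ∂skewHaar ℓ g = V := fun f => by
    rw [lintegral_indicator (measurableSet_isPush f.2.1), hB f (d f) (hd1 f)]
  have hsum : ∫⁻ M, ∑ f, G f M ∂skewHaar ℓ g =
      Nat.card {f : SympLattice ℓ g →+ X.carrier // Function.Surjective f ∧ X.ω = omegaSum f} * V := by
    rw [lintegral_finsetSum _ fun f _ => hGm f]
    simp only [hG, Finset.sum_const, Finset.card_univ, nsmul_eq_mul, Nat.card_eq_fintype_card]
  rw [← hsum, lintegral_skewHaar_eq_tsum hℓ n g, lintegral_countable']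
  refine tsum_congr fun c => ?_
  rw [linearMeasure_singleton, ← setLIntegral_const]
  refine setLIntegral_congr_fun (measurableSet_isCokernelBEG c.rep) fun M hM => ?_
  obtain ⟨fH, h1, h2, h3⟩ := (isCokernelBEG_iff _ _).1 hM
  have hker : ∀ x, fH x = 0 ↔ ∃ y, x = shifted n M.1 y :=
    fun x => ⟨h3 x, by rintro ⟨y, rfl⟩; exact h2.map_shifted y⟩
  let E := surjEquivPush h1 h2 h3 X
  have hE : ∀ π, (E π).1 = π.1.comp fH := fun π => rfl
  have step : ∀ f', surjWeightENN ℓ t (genRank ℓ (E.symm f').1.ker) =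
      G ⟨f'.1, f'.2.1, f'.2.2.omega_eq⟩ M := fun f' => by
    have hc : (E.symm f').1.comp fH = f'.1 := by rw [← hE, Equiv.apply_symm_apply]
    rw [← hd2 ⟨f'.1, f'.2.1, f'.2.2.omega_eq⟩ M c.rep fH (E.symm f').1 f'.2.2 h1 hker hc]
    exact (Set.indicator_of_mem (s := {M : skewSymplectic ℓ g | IsPush M.1 X f'.1})
      (f := fun M => surjWeightENN ℓ t (d ⟨f'.1, f'.2.1, f'.2.2.omega_eq⟩ M)) f'.2.2).symm
  rw [surjSum, ← E.symm.tsum_eq]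
  simp only [step]
  rw [← tsum_fintype (L := .unconditional _)]
  let J : {f' : SympLattice ℓ g →+ X.carrier // Function.Surjective f' ∧ IsPush M.1 X f'} →
    {f : SympLattice ℓ g →+ X.carrier // Function.Surjective f ∧ X.ω = omegaSum f} :=
    fun f' => ⟨f'.1, f'.2.1, f'.2.2.omega_eq⟩
  have hJ : Function.Injective J := fun a b h => Subtype.ext (congrArg (fun f => f.1) h)
  refine hJ.tsum_eq (f := fun f => G f M) fun f hf => ?_
  by_cases hM' : IsPush M.1 X f.1
  · exact ⟨⟨f.1, f.2.1, hM'⟩, rfl⟩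
  · exact absurd (Set.indicator_of_notMem (s := {M : skewSymplectic ℓ g | IsPush M.1 X f.1}) hM' _) hf

end CokernelLaw

/-! ### Limits of the linear measures -/

/-- Convergence of integrals of bounded functions along a tight sequence of discrete measures. -/
theorem tendsto_tsum_mul_of_tight {C : Type*} {a : ℕ → C → ℝ≥0∞} {L : C → ℝ≥0∞}
    (ha : ∀ c, Tendsto (fun g => a g c) atTop (𝓝 (L c))) {S : ℕ → Set C} (hS : ∀ N, (S N).Finite)
    {ε : ℕ → ℝ≥0∞} (hε : Tendsto ε atTop (𝓝 0))
    (htight : ∀ g N, ∑' c : ((S N)ᶜ : Set C), a g c ≤ ε N) {K : C → ℝ≥0∞} (hK : ∀ c, K c ≤ 1) :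
    Tendsto (fun g => ∑' c, K c * a g c) atTop (𝓝 (∑' c, K c * L c)) := by
  have hlim : ∀ s : Finset C, Tendsto (fun g => ∑ c ∈ s, K c * a g c) atTop
      (𝓝 (∑ c ∈ s, K c * L c)) := fun s => tendsto_finsetSum _ fun c _ =>
    ENNReal.Tendsto.const_mul (ha c) (Or.inr ((hK c).trans_lt ENNReal.one_lt_top).ne)
  -- The lower bound is Fatou, through finite partial sums. The upper bound splits off the tail,
  -- which is at most ε N because K ≤ 1.
  refine tendsto_of_le_liminf_of_limsup_le ?_ ?_
  · rw [ENNReal.tsum_eq_iSup_sum]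
    refine iSup_le fun s => ?_
    rw [← (hlim s).liminf_eq]
    exact liminf_le_liminf (Eventually.of_forall fun g => ENNReal.sum_le_tsum s)
  · have hN : ∀ N, limsup (fun g => ∑' c, K c * a g c) atTop ≤ ∑' c, K c * L c + ε N := by
      intro N
      have hle : ∀ g, ∑' c, K c * a g c ≤ ∑ c ∈ (hS N).toFinset, K c * a g c + ε N := by
        intro g
        rw [← ENNReal.summable.tsum_add_tsum_compl (s := S N) ENNReal.summable]
        refine add_le_add (le_of_eq ?_) (le_trans (ENNReal.tsum_le_tsum fun c => ?_) (htight g N))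
        · rw [← Finset.tsum_subtype' (hS N).toFinset fun c => K c * a g c, (hS N).coe_toFinset]
        · exact mul_le_of_le_one_left' (hK _)
      refine (limsup_le_limsup (Eventually.of_forall hle)).trans ?_
      rw [((hlim (hS N).toFinset).add_const (ε N)).limsup_eq]
      exact add_le_add (ENNReal.sum_le_tsum _) le_rfl
    have h := (tendsto_const_nhds (x := ∑' c, K c * L c)).add hε
    rw [add_zero] at h
    exact ge_of_tendsto' h hN

section Limit

variable {ℓ n : ℕ} [hp : Fact ℓ.Prime]

theorem tendsto_tsum_linearMeasure (hℓ : ℓ ≠ 2) {L : BEGClass ℓ n → ℝ≥0∞}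
    (hL : ∀ c, Tendsto (fun g => linearMeasure ℓ n g {c}) atTop (𝓝 (L c)))
    {K : BEGClass ℓ n → ℝ≥0∞} (hK : ∀ c, K c ≤ 1) :
    Tendsto (fun g => ∑' c, K c * linearMeasure ℓ n g {c}) atTop (𝓝 (∑' c, K c * L c)) := by
  refine tendsto_tsum_mul_of_tight hL (S := fun N => {c | Nat.card c.rep.carrier ≤ ℓ ^ N})
    (fun N => BEG.finite_setOf_card_le ℓ n (ℓ ^ N)) (tendsto_tail_bound ℓ) (fun g N => ?_) hK
  refine (le_of_eq ?_).trans (tsum_linearMeasure_tail hℓ n g N)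
  have h : ({c : BEGClass ℓ n | Nat.card c.rep.carrier ≤ ℓ ^ N}ᶜ : Set _) =
      {c | ℓ ^ N < Nat.card c.rep.carrier} := by
    ext c; simp
  rw [h]

/-! ### The limit of the weighted counts -/

theorem exists_adaptedBasis_surjective (X : BEG ℓ n) : ∃ (g : ℕ) (f : SympLattice ℓ g →+ X.carrier),
    Function.Surjective f ∧ Nonempty (AdaptedBasis f) := by
  have := Fintype.ofFinite X.carrier
  let e := Fintype.equivFin X.carrier
  let f := (latticeHomEquiv X.isPGroup (Fin (Fintype.card X.carrier) ⊕ Fin _)).symm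
    (Sum.elim e.symm e.symm)
  refine ⟨_, f, fun x => ⟨Pi.single (Sum.inl (e x)) 1, ?_⟩, nonempty_adaptedBasis X.isPGroup f⟩
  have h := (latticeHomEquiv X.isPGroup (Fin (Fintype.card X.carrier) ⊕ Fin _)).apply_symm_apply
    (Sum.elim e.symm e.symm)
  exact (congrFun h (Sum.inl (e x))).trans (e.symm_apply_apply x)

theorem card_wedgeSq_mul_card (X : BEG ℓ n) :
    Nat.card (wedgeSq X.carrier) * Nat.card X.carrier = Nat.card (SymSq X.carrier) := by
  obtain ⟨g, f, hs, ⟨B⟩⟩ := exists_adaptedBasis_surjective X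
  exact card_wedgeSq_mul (B.coordEquiv hs) B.mono

variable {g : ℕ} {X : BEG ℓ n} {f : SympLattice ℓ g →+ X.carrier}

/-- Nonzero exponents correspond to a basis of X[ℓ]. The size of the symmetric block thus depends
only on X and g, and it tends to infinity with g. -/
theorem card_exponent_eq_zero (hs : Function.Surjective f) (B : AdaptedBasis f) :
    Fintype.card {i // B.k i = 0} = (g + g) - Nat.log ℓ (Nat.card (Tors X.carrier ℓ)) := by
  have h1 : Nat.card (Tors X.carrier ℓ) = ℓ ^ Fintype.card {i // ¬ B.k i = 0} := by
    have h2 := card_tors_pi (ℓ := ℓ) B.k 1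
    rw [← card_tors_congr (B.coordEquiv hs), pow_one] at h2
    rw [h2, Finset.prod_pow_eq_pow_sum, Fintype.card_subtype, Finset.card_filter]
    congr 1
    refine Finset.sum_congr rfl fun i _ => ?_
    split_ifs with h <;> omega
  rw [h1, Nat.log_pow hp.out.one_lt, Fintype.card_subtype_compl, Fintype.card_fin]
  have := Fintype.card_subtype_le fun i => B.k i = 0
  rw [Fintype.card_fin] at this
  omega

theorem prod_pow_digitExp (hs : Function.Surjective f) (B : AdaptedBasis f) :
    (∏ p : UpperPair g, ℓ ^ digitExp B p) * Nat.card (SymSq X.carrier) =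
      Nat.card X.carrier ^ (g + g + 1) * Nat.card (Tors (SymSq X.carrier) (ℓ ^ n)) := by
  have h := prod_pow_add_min (B.coordEquiv hs) B.mono n
  rw [Fintype.card_fin] at h
  exact h

theorem prod_pow_digitExp_inv (hs : Function.Surjective f) (B : AdaptedBasis f) :
    (∏ p : UpperPair g, (ℓ : ℝ≥0∞) ^ digitExp B p)⁻¹ = ENNReal.ofReal
      ((Nat.card (SymSq X.carrier) : ℝ) /
        ((Nat.card X.carrier : ℝ) ^ (g + g + 1) *
          (Nat.card (Tors (SymSq X.carrier) (ℓ ^ n)) : ℝ))) := by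
  have h := prod_pow_digitExp hs B
  have h0 : 0 < ∏ p : UpperPair g, ℓ ^ digitExp B p :=
    Finset.prod_pos fun p _ => pow_pos hp.out.pos _
  have hS : (0 : ℝ) < Nat.card (SymSq X.carrier) := Nat.cast_pos.2 Nat.card_pos
  have hT : (0 : ℝ) < Nat.card (Tors (SymSq X.carrier) (ℓ ^ n)) := Nat.cast_pos.2 Nat.card_pos
  have hX : (0 : ℝ) < Nat.card X.carrier := Nat.cast_pos.2 Nat.card_pos
  have h' : ((∏ p : UpperPair g, ℓ ^ digitExp B p : ℕ) : ℝ) * Nat.card (SymSq X.carrier) =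
      (Nat.card X.carrier : ℝ) ^ (g + g + 1) * Nat.card (Tors (SymSq X.carrier) (ℓ ^ n)) := by
    exact_mod_cast h
  have hP : (∏ p : UpperPair g, (ℓ : ℝ≥0∞) ^ digitExp B p) =
      ENNReal.ofReal ((∏ p : UpperPair g, ℓ ^ digitExp B p : ℕ) : ℝ) := by
    rw [ENNReal.ofReal_natCast]; push_cast; rfl
  rw [hP, ← ENNReal.ofReal_inv_of_pos (Nat.cast_pos.2 h0), ← h']
  congr 1
  have : ((∏ p : UpperPair g, ℓ ^ digitExp B p : ℕ) : ℝ) ≠ 0 := (Nat.cast_pos.2 h0).ne'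
  field_simp

/-- The integrals against `μ_g` of the weighted counts of surjections. -/
theorem lintegral_surjSum_linearMeasure_eq (hℓ : ℓ ≠ 2) (hn : 0 < n) {X : BEG ℓ n} {s : ℕ}
    (hX : X.PsiCodim s) (t g : ℕ) :
    ∫⁻ c, surjSum (surjWeightENN ℓ t) c.rep X ∂linearMeasure ℓ n g = ENNReal.ofReal
      ((Nat.card {f : SympLattice ℓ g →+ X.carrier //
          Function.Surjective f ∧ X.ω = omegaSum f} : ℝ) / (Nat.card X.carrier : ℝ) ^ (g + g) *
        (Nat.card (wedgeSq X.carrier) / Nat.card (Tors (SymSq X.carrier) (ℓ ^ n)) *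
          (surjWeight (ℓ : ℝ)⁻¹ t s * symAverage
            (Fin ((g + g) - Nat.log ℓ (Nat.card (Tors X.carrier ℓ)))) (ZMod ℓ) t))) := by
  have := Fintype.ofFinite
    {f : SympLattice ℓ g →+ X.carrier // Function.Surjective f ∧ X.ω = omegaSum f}
  have hT : (0 : ℝ) < Nat.card (Tors (SymSq X.carrier) (ℓ ^ n)) := Nat.cast_pos.2 Nat.card_pos
  have hXp : (0 : ℝ) < Nat.card X.carrier := Nat.cast_pos.2 Nat.card_pos
  have hw : (Nat.card (wedgeSq X.carrier) : ℝ) * Nat.card X.carrier = Nat.card (SymSq X.carrier) := by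
    exact_mod_cast card_wedgeSq_mul_card X
  rw [lintegral_surjSum_linearMeasure hℓ hn X t g fun f => by
    obtain ⟨B⟩ := nonempty_adaptedBasis X.isPGroup f.1
    refine ⟨B, fun d hd => ?_⟩
    rw [setLIntegral_isPush_surjWeight hn f.2.1 f.2.2 B hX t hd, prod_pow_digitExp_inv f.2.1 B,
      card_exponent_eq_zero f.2.1 B]]
  rw [← ENNReal.ofReal_natCast, ← ENNReal.ofReal_mul (by positivity),
    ← ENNReal.ofReal_mul (by positivity), ← hw]
  congr 1
  field_simp
  ring

theorem tendsto_lintegral_surjSum (hℓ : ℓ ≠ 2) (hn : 0 < n) {X : BEG ℓ n} {s : ℕ}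
    (hX : X.PsiCodim s) (t : ℕ) :
    Tendsto (fun g => ∫⁻ c, surjSum (surjWeightENN ℓ t) c.rep X ∂linearMeasure ℓ n g) atTop
      (𝓝 (ENNReal.ofReal ((Nat.card (Tors (SymSq X.carrier) (ℓ ^ n)) : ℝ)⁻¹ *
        (surjWeight (ℓ : ℝ)⁻¹ t s * limitProduct (ℓ : ℝ)⁻¹ t)))) := by
  simp_rw [lintegral_surjSum_linearMeasure_eq hℓ hn hX t]
  refine (ENNReal.continuous_ofReal.tendsto _).comp ?_
  have h1 := tendsto_card_surjective_omegaSum (ℓ := ℓ) X.isPGroup ⟨X.ω, X.ω_mem⟩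
  have hℓ2 : 2 < ℓ := lt_of_le_of_ne hp.out.two_le (Ne.symm hℓ)
  have h2 := tendsto_symAverage (F := ZMod ℓ) (by rwa [ZMod.card]) t
  rw [ZMod.card] at h2
  have h3 : Tendsto (fun g : ℕ => (g + g) - Nat.log ℓ (Nat.card (Tors X.carrier ℓ))) atTop atTop :=
    tendsto_atTop_mono (fun g => by
      change g - Nat.log ℓ (Nat.card (Tors X.carrier ℓ)) ≤ _
      omega) (tendsto_sub_atTop_nat _)
  have h4 := h1.mul (((h2.comp h3).const_mul (surjWeight (ℓ : ℝ)⁻¹ t s)).const_mul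
    ((Nat.card (wedgeSq X.carrier) : ℝ) / Nat.card (Tors (SymSq X.carrier) (ℓ ^ n))))
  have hW : (Nat.card (wedgeSq X.carrier) : ℝ) ≠ 0 := (Nat.cast_pos.2 Nat.card_pos).ne'
  have h5 : ∀ w T y : ℝ, w ≠ 0 → w⁻¹ * (w / T * y) = T⁻¹ * y := fun w T y h => by field_simp
  rw [h5 _ _ _ hW] at h4
  exact h4

theorem exists_psiCodim (X : BEG ℓ n) : ∃ s, X.PsiCodim s :=
  exists_relIndex_eq_pow X.isPGroup _ _

theorem exists_tendsto_linearMeasure (hℓ : ℓ ≠ 2) (hn : 0 < n) (c : BEGClass ℓ n) :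
    ∃ L, Tendsto (fun g => linearMeasure ℓ n g {c}) atTop (𝓝 L) := by
  obtain ⟨s, hs⟩ := exists_psiCodim c.rep
  have hA : (Nat.card c.rep.Aut : ℝ≥0∞) ≠ 0 := Nat.cast_ne_zero.2 (card_aut_ne_zero _)
  have hA' : (Nat.card c.rep.Aut : ℝ≥0∞)⁻¹ ≠ ⊤ := ENNReal.inv_ne_top.2 hA
  refine ⟨_, (ENNReal.Tendsto.const_mul (tendsto_lintegral_surjSum hℓ hn hs 0)
    (Or.inr hA')).congr fun g => ?_⟩
  rw [lintegral_surjSum_zero, ← mul_assoc, ENNReal.inv_mul_cancel hA (ENNReal.natCast_ne_top _),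
    one_mul, BEG.cls_rep]

/-- The limits of the point masses come from the weighted counts with t = 0. Tightness, applied to
the constant function 1, shows that no mass escapes; on a countable discrete space the point masses
determine the measure. -/
theorem existsUnique_isUniversalMeasure (hℓ : ℓ ≠ 2) (hn : 0 < n) :
    ∃! μ : Measure (BEGClass ℓ n), IsUniversalMeasure ℓ n μ := by
  choose L hL using exists_tendsto_linearMeasure (n := n) hℓ hn
  have hμ : ∀ c, (Measure.sum fun c => L c • Measure.dirac c) {c} = L c := fun c => by
    classical
    rw [Measure.sum_apply _ (measurableSet_singleton c), tsum_eq_single c]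
    · simp
    · intro c' hc
      simp [hc]
  refine ⟨Measure.sum fun c => L c • Measure.dirac c, ⟨⟨?_⟩, fun c => ?_⟩, fun ν hν => ?_⟩
  · have h := tendsto_tsum_linearMeasure hℓ hL (K := fun _ => 1) fun _ => le_rfl
    simp only [one_mul, tsum_linearMeasure hℓ] at h
    rw [Measure.sum_apply _ MeasurableSet.univ]
    simp only [Measure.smul_apply, measure_univ, smul_eq_mul, mul_one]
    exact tendsto_nhds_unique h tendsto_const_nhds
  · rw [hμ]; exact hL c
  · refine Measure.ext_of_singleton fun c => ?_
    rw [hμ]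
    exact tendsto_nhds_unique (hν.2 c) (hL c)

/-- Q^t μ(X) is the μ-integral of a kernel bounded by 1, hence the limit of the same integrals
against μ_g, and these have been computed. -/
theorem iterate_quotientMeasure_eq (hℓ : ℓ ≠ 2) (hn : 0 < n) {μ : Measure (BEGClass ℓ n)}
    (hμ : IsUniversalMeasure ℓ n μ) (t : ℕ) {X : BEG ℓ n} {s : ℕ} (hX : X.PsiCodim s) :
    ((quotientMeasure ℓ n)^[t] μ) {X.cls} =
      ((Nat.card X.Aut : ℝ≥0∞) * (Nat.card X.carrier : ℝ≥0∞) ^ t)⁻¹ *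
        ENNReal.ofReal ((Nat.card (Tors (SymSq X.carrier) (ℓ ^ n)) : ℝ)⁻¹ *
          (surjWeight (ℓ : ℝ)⁻¹ t s * limitProduct (ℓ : ℝ)⁻¹ t)) := by
  have hA : (Nat.card X.Aut : ℝ≥0∞) * (Nat.card X.carrier : ℝ≥0∞) ^ t ≠ 0 :=
    mul_ne_zero (Nat.cast_ne_zero.2 (card_aut_ne_zero _))
      (pow_ne_zero _ (Nat.cast_ne_zero.2 (card_carrier_ne_zero _)))
  rw [quotientMeasure_iterate_singleton', lintegral_countable']
  refine tendsto_nhds_unique (tendsto_tsum_linearMeasure hℓ hμ.2 (iterateKernel_le_one t X)) ?_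
  refine (ENNReal.Tendsto.const_mul (tendsto_lintegral_surjSum hℓ hn hX t)
    (Or.inr (ENNReal.inv_ne_top.2 hA))).congr fun g => ?_
  rw [← quotientMeasure_iterate_singleton, quotientMeasure_iterate_singleton',
    lintegral_countable']

end Limit

/-- The universal measure `μ` exists and is unique; for all `t`, the measure `Q^t μ` is given by the
explicit formula on the BEGs for which the codimension `s` of `ψ_G(G^∨[ℓ])` in `G[ℓ]` is at most `t`,
it vanishes on those with `s > t`, and its moments are `|G|^{-t}` times those of `μ`. -/
theorem theorem8p16 (ℓ n : ℕ) [Fact ℓ.Prime] (hℓ : ℓ ≠ 2) (hn : 0 < n) :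
    (∃! μ : Measure (BEGClass ℓ n), IsUniversalMeasure ℓ n μ) ∧
    ∀ μ : Measure (BEGClass ℓ n), IsUniversalMeasure ℓ n μ →
      ∀ (t : ℕ) (X : BEG ℓ n),
        (∀ s : ℕ, X.PsiCodim s → s ≤ t →
          ((quotientMeasure ℓ n)^[t] μ) {X.cls} = ENNReal.ofReal
            (1 / ((Nat.card X.Aut : ℝ) *
                (Nat.card (Tors (SymSq X.carrier) (ℓ ^ n)) : ℝ) *
                (Nat.card X.carrier : ℝ) ^ t) *
              (qPochhammer (ℓ : ℝ)⁻¹ t / qPochhammer (ℓ : ℝ)⁻¹ (t - s)) *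
              ∏' i : ℕ, (1 + (ℓ : ℝ)⁻¹ ^ (t + 1 + i))⁻¹)) ∧
        (∀ s : ℕ, X.PsiCodim s → t < s → ((quotientMeasure ℓ n)^[t] μ) {X.cls} = 0) ∧
        moment ((quotientMeasure ℓ n)^[t] μ) X =
          ((Nat.card X.carrier : ℝ≥0∞) ^ t)⁻¹ * moment μ X := by
  refine ⟨existsUnique_isUniversalMeasure hℓ hn, fun μ hμ t X =>
    ⟨fun s hX hst => ?_, fun s hX hst => ?_, moment_iterate t μ X⟩⟩
  · have hA : (0 : ℝ) < Nat.card X.Aut := Nat.cast_pos.2 (Nat.pos_of_ne_zero (card_aut_ne_zero X))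
    have hXp : (0 : ℝ) < Nat.card X.carrier := Nat.cast_pos.2 Nat.card_pos
    -- Needed to write c_t(s) as the quotient (x)_t/(x)_{t-s}, which is legitimate only for s ≤ t.
    have hq : qPochhammer (ℓ : ℝ)⁻¹ (t - s) ≠ 0 := by
      refine Finset.prod_ne_zero_iff.2 fun i _ => (sub_pos.2 ?_).ne'
      have hl : (1 : ℝ) < ℓ := Nat.one_lt_cast.2 (Fact.out : ℓ.Prime).one_lt
      exact pow_lt_one₀ (by positivity) (inv_lt_one_of_one_lt₀ hl) (Nat.succ_ne_zero i)
    rw [iterate_quotientMeasure_eq hℓ hn hμ t hX, ← surjWeight_mul_qPochhammer _ hst,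
      mul_div_cancel_right₀ _ hq, ← ENNReal.ofReal_natCast, ← ENNReal.ofReal_natCast,
      ← ENNReal.ofReal_pow hXp.le, ← ENNReal.ofReal_mul hA.le,
      ← ENNReal.ofReal_inv_of_pos (by positivity), ← ENNReal.ofReal_mul (by positivity)]
    congr 1
    rw [limitProduct, one_div, mul_inv, mul_inv, mul_inv]
    ring
  · rw [iterate_quotientMeasure_eq hℓ hn hμ t hX, surjWeight_eq_zero hst, zero_mul, mul_zero,
      ENNReal.ofReal_zero, mul_zero]

end
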